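/- **Proposition.** Let $\mathcal A$ be an alphabet with exactly two symbols, and let $\mathcal N\subset\mathbb Z^2$ be a five-site neighbourhood that has the shape of a T-, V-, X- or Z-pentomino, i.e. $\mathcal N$ is the image under an isometry of $\mathbb Z^2$ of one of $$T=\{(0,0),(1,0),(2,0),(1,1),(1,2)\},\quad V=\{(0,0),(1,0),(2,0),(0,1),(0,2)\},$$ $$X=\{(0,0),(\pm1,0),(0,\pm1)\}\ \text{(the von Neumann neighbourhood)},\quad Z=\{(0,1),(0,2),(1,1),(2,1),(2,0)\}.$$ Let $f:\mathcal A^{\mathcal N}\to\mathcal A$ be a local rule that truly depends on all five sites: for every $v\in\mathcal N$ there are two patterns in $\mathcal A^{\mathcal N}$ that agree off $v$ and have different images under $f$. Let $F:\mathcal A^{\mathbb Z^2}\to\mathcal A^{\mathbb Z^2}$, $F(s)_x=f\big((s_{u+x})_{u\in\mathcal N}\big)$, be the induced global map. Then $F$ is surjective if and only if $f$ is slice permutive. Here a site $v\in\mathcal N$ *can be sliced* if there is a line $\ell$, either $y=mx+c$ with $m,c\in\mathbb Q$ or $x=c$ with $c\in\mathbb Q$, such that $v\in\ell$ and all other sites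 of $\mathcal N$ lie strictly on one and the same side of $\ell$. The rule $f$ is *permutive with respect to $v$* if, for every choice of the symbols at the sites of $\mathcal N\setminus\{v\}$, the value of $f$ is a one-to-one function of the symbol at $v$. The rule is *slice permutive* if it is permutive with respect to some site of $\mathcal N$ that can be sliced. -/

import Mathlib

/-- Sites of the two-dimensional lattice `ℤ²`. -/
abbrev Site := ℤ × ℤ

/-- The global map induced by the local rule `f : A^N → A`:
`F(s)_x = f(s_{N(x)})`, where `N(x) = {u + x : u ∈ N}`. -/
def globalMap {A : Type*} {N : Finset Site} (f : (N → A) → A) : (Site → A) → (Site → A) :=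
  fun s x => f (fun u => s (u.1 + x))

/-- The local rule depends on the site `v` of its neighbourhood: two patterns that differ at most
at `v` can be mapped to different symbols. -/
def DependsOnSite {A : Type*} {N : Finset Site} (f : (N → A) → A) (v : N) : Prop :=
  ∃ b b' : N → A, (∀ u, u ≠ v → b u = b' u) ∧ f b ≠ f b'

/-- The rule is permutive with respect to `v`: whatever the symbols at the other sites are
(given by `b`, whose entry at `v` is overwritten by `x`), the map `x ↦ f [x, b]` is one-to-one. -/
def PermutiveAt {A : Type*} {N : Finset Site} (f : (N → A) → A) (v : N) : Prop :=
  ∀ b : N → A, Function.Injective (fun x : A => f (Function.update b v x))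

/-- Lines in the plane with rational coefficients: `y = m x + c` (`sloped m c`) or
`x = c` (`vertical c`). -/
inductive RatLine where
  | sloped (m c : ℚ) : RatLine
  | vertical (c : ℚ) : RatLine

namespace RatLine

/-- The lattice point `p` lies on the line. -/
def On : RatLine → Site → Prop
  | sloped m c, p => (p.2 : ℚ) = m * p.1 + c
  | vertical c, p => (p.1 : ℚ) = c

/-- The lattice point `p` lies in the open half-plane `ℓ⁺`. -/
def Pos : RatLine → Site → Prop
  | sloped m c, p => (p.2 : ℚ) > m * p.1 + c
  | vertical c, p => (p.1 : ℚ) > c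

/-- The lattice point `p` lies in the open half-plane `ℓ⁻`. -/
def Neg : RatLine → Site → Prop
  | sloped m c, p => (p.2 : ℚ) < m * p.1 + c
  | vertical c, p => (p.1 : ℚ) < c

end RatLine

/-- The site `v` of `N` can be sliced: some line through `v` has all other sites of `N` strictly
on one and the same side. -/
def Sliceable (N : Finset Site) (v : Site) : Prop :=
  v ∈ N ∧ ∃ l : RatLine, l.On v ∧
    ((∀ u ∈ N, u ≠ v → l.Pos u) ∨ (∀ u ∈ N, u ≠ v → l.Neg u))

/-- The rule is permutive with respect to some site that can be sliced. -/
def SlicePermutive {A : Type*} {N : Finset Site} (f : (N → A) → A) : Prop :=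
  ∃ v : N, Sliceable N v.1 ∧ PermutiveAt f v

/-- `N` has the shape of `P`: it is the image of `P` under an isometry of `ℤ²`, that is, an
additive automorphism `g` preserving the Euclidean norm followed by a translation by `t`. -/
def HasShape (N P : Finset Site) : Prop :=
  ∃ (g : Site ≃+ Site) (t : Site),
    (∀ p : Site, (g p).1 ^ 2 + (g p).2 ^ 2 = p.1 ^ 2 + p.2 ^ 2) ∧
      N = P.image (fun p => g p + t)

/-- The T-pentomino. -/
def pentominoT : Finset Site := {(0, 0), (1, 0), (2, 0), (1, 1), (1, 2)}

/-- The V-pentomino. -/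
def pentominoV : Finset Site := {(0, 0), (1, 0), (2, 0), (0, 1), (0, 2)}

/-- The X-pentomino (von Neumann neighbourhood). -/
def pentominoX : Finset Site := {(0, 0), (1, 0), (-1, 0), (0, 1), (0, -1)}

/-- The Z-pentomino. -/
def pentominoZ : Finset Site := {(0, 1), (0, 2), (1, 1), (2, 1), (2, 0)}

/-! ### Surjectivity of slice permutive rules -/

/-! If a rule is permutive at a site `v` that can be sliced, a linear functional `l` is strictly
maximal on `N` at `v`. Finitely many image values can then be prescribed one after another in order
of increasing `l`: the image at `x` is adjusted through the cell `v + x`, which no earlier position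
sees. Compactness (`Finset.rado_selection`) gives a preimage of a whole configuration.

Conversely, call a rule erasable if two configurations that differ at a nonempty finite set of cells
have the same image. By Moore's counting argument (`not_surjective_of_pair`) an erasable rule is not
surjective. It remains to show that a rule which depends on all five sites and is permutive at no
extremal site is erasable. A shear of `ℤ²` takes X to Z and respects everything involved, so three
stencils remain: corner (V), tee (T) and cross (X).

For the corner and the tee one first tries a pair that differs in a single cell. Each of the five
positions that see the cell asks for a local pattern in which that cell is irrelevant, and these
patterns overlap in only a few cells. If they cannot be chosen consistently, then for fixed values
of one or two arguments the rule is permutive in another one. Such a relation fixes many of the 32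
values of the rule in terms of others and leaves an explicit family.

For the cross, the case split is on the set of arm patterns at which the centre is irrelevant. If it
contains the zero pattern, then either some arm is permutive when the centre holds zero, which is a
family, or a pair supported on a chessboard sublattice arises from a rule on a 2×2 block. The case
of the pattern of ones is the complement. In the remaining case the part of the set consisting of
patterns of odd weight is brought to one of 34 normal forms by the symmetries of the cross and
complementation, again giving families.

Every family is settled by a verified computation for all its rules at once. Rule number `i` is bit
`i` of large masks. For a fixed difference set, the condition that a pair exists is a conjunction of
tables in the unknown cells, one for each position that sees the difference set; the unknown cells
are eliminated one by one, with `and` joining the tables and `or` ranging over the two values of a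
cell. The mask that is left lists rules that have such a pair (`erasable_of_planMask`). A family is
covered when the masks of finitely many such searches exhaust all its candidates
(`covered_of_checkFamily`). -/

theorem Sliceable.exists_hom {N : Finset Site} {v : Site} (h : Sliceable N v) :
    ∃ l : Site →+ ℚ, ∀ u ∈ N, u ≠ v → l u < l v := by
  let lin : ℚ → ℚ → Site →+ ℚ := fun a b =>
    { toFun := fun z => a * z.1 + b * z.2
      map_zero' := by simp
      map_add' := fun x y => by
        simp only [Prod.fst_add, Prod.snd_add, Int.cast_add]
        ring }
  have hlin : ∀ a b z, lin a b z = a * z.1 + b * z.2 := fun _ _ _ => rfl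
  obtain ⟨-, l, hl, h⟩ := h
  cases l with
  | sloped m c =>
    simp only [RatLine.On, RatLine.Pos, RatLine.Neg] at hl h
    rcases h with h | h
    · exact ⟨lin m (-1), fun u hu hne => by rw [hlin, hlin]; linarith [h u hu hne]⟩
    · exact ⟨lin (-m) 1, fun u hu hne => by rw [hlin, hlin]; linarith [h u hu hne]⟩
  | vertical c =>
    simp only [RatLine.On, RatLine.Pos, RatLine.Neg] at hl h
    rcases h with h | h
    · exact ⟨lin (-1) 0, fun u hu hne => by rw [hlin, hlin]; linarith [h u hu hne]⟩
    · exact ⟨lin 1 0, fun u hu hne => by rw [hlin, hlin]; linarith [h u hu hne]⟩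

/-- A homomorphism to `ℚ` has the form `a * z.1 + b * z.2`, so its level line through `v` has
rational coefficients and is the slicing line. The sign of `b`, or that of `a` if `b = 0`, decides
on which side the other sites lie. -/
theorem sliceable_of_forall_lt {N : Finset Site} {v : Site} (hv : v ∈ N) {l : Site →+ ℚ}
    (h : ∀ u ∈ N, u ≠ v → l u < l v) : Sliceable N v := by
  have hl : ∀ z : Site, l z = l (1, 0) * z.1 + l (0, 1) * z.2 := by
    intro z
    have hz : z = z.1 • ((1, 0) : Site) + z.2 • ((0, 1) : Site) := by ext <;> simp
    conv_lhs => rw [hz, map_add, map_zsmul, map_zsmul]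
    simp [mul_comm]
  generalize l (1, 0) = a at hl
  generalize l (0, 1) = b at hl
  simp only [hl] at h
  refine ⟨hv, ?_⟩
  rcases lt_trichotomy b 0 with hb | rfl | hb
  · refine ⟨.sloped (-a / b) ((a * v.1 + b * v.2) / b), ?_, .inl fun u hu hne => ?_⟩
    · simp only [RatLine.On]
      field_simp [hb.ne]
      ring
    · simp only [RatLine.Pos]
      have := h u hu hne
      rw [gt_iff_lt, div_mul_eq_mul_div, ← add_div, div_lt_iff_of_neg hb]
      linarith
  · refine ⟨.vertical v.1, rfl, ?_⟩
    rcases le_or_gt a 0 with ha | ha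
    · refine .inl fun u hu hne => ?_
      simp only [RatLine.Pos]
      by_contra hc
      nlinarith [h u hu hne]
    · refine .inr fun u hu hne => ?_
      simp only [RatLine.Neg]
      by_contra hc
      nlinarith [h u hu hne]
  · refine ⟨.sloped (-a / b) ((a * v.1 + b * v.2) / b), ?_, .inr fun u hu hne => ?_⟩
    · simp only [RatLine.On]
      field_simp [hb.ne']
      ring
    · simp only [RatLine.Neg]
      have := h u hu hne
      rw [div_mul_eq_mul_div, ← add_div, lt_div_iff₀ hb]
      linarith

theorem globalMap_congr {A : Type*} {N : Finset Site} (f : (N → A) → A) {s s' : Site → A}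
    {x x' : Site} (h : ∀ u ∈ N, s (u + x) = s' (u + x')) :
    globalMap f s x = globalMap f s' x' :=
  congrArg f (funext fun u => h u.1 u.2)

/-- Positions are treated in order of increasing `l`, and the image at `x` is corrected through the
cell `v + x`. An earlier position `y` has `l y ≤ l x`; if it saw that cell, `u + y = v + x` with `l
u ≤ l v` would force `u = v` and `y = x`. So earlier values are never disturbed. -/
theorem exists_globalMap_eq_on {A : Type*} [Finite A] [Nonempty A] {N : Finset Site}
    {f : (N → A) → A} (hf : SlicePermutive f) (t : Site → A) (W : Finset Site) :
    ∃ s, ∀ x ∈ W, globalMap f s x = t x := by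
  obtain ⟨v, hv, hp⟩ := hf
  obtain ⟨l, hl⟩ := hv.exists_hom
  induction W using Finset.induction_on_max_value l with
  | empty => exact ⟨fun _ => Classical.arbitrary A, by simp⟩
  | insert x W hx hmax ih =>
    obtain ⟨s, hs⟩ := ih
    -- On a finite alphabet one-to-one is onto, so some symbol at `v + x` yields the prescribed
    -- value.
    obtain ⟨a, ha⟩ := Finite.surjective_of_injective (hp fun u => s (u.1 + x)) (t x)
    refine ⟨Function.update s (v.1 + x) a, fun y hy => ?_⟩
    rcases Finset.mem_insert.1 hy with rfl | hy
    · rw [← ha]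
      refine congrArg f (funext fun u => ?_)
      by_cases huv : u = v
      · simp [huv]
      · have : u.1 + y ≠ v.1 + y := fun e => huv (Subtype.ext (add_right_cancel e))
        simp [huv, this]
    · rw [← hs y hy]
      refine globalMap_congr f fun u hu => Function.update_of_ne (fun e => ?_) _ _
      have he : l u + l y = l v + l x := by rw [← map_add, e, map_add]
      by_cases huv : u = v
      · subst huv
        exact hx (add_left_cancel e ▸ hy)
      · linarith [hl u hu huv, hmax y hy]

/-- Compactness: the selection principle produces one configuration which on every finite set of
cells agrees with the solution belonging to some larger finite set. -/
theorem SlicePermutive.surjective {A : Type*} [Finite A] [Nonempty A] {N : Finset Site}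
    {f : (N → A) → A} (hf : SlicePermutive f) : Function.Surjective (globalMap f) := by
  intro t
  -- Solutions are indexed by finite sets of cells, because these are the sets on which the
  -- selection principle compares them. A position whose neighbourhood lies in `V` belongs to `V -
  -- v`.
  have key : ∀ V : Finset Site, ∃ s, ∀ x, (∀ u ∈ N, u + x ∈ V) → globalMap f s x = t x := by
    intro V
    obtain ⟨v, hv, -⟩ := id hf
    obtain ⟨s, hs⟩ := exists_globalMap_eq_on hf t (V.image fun z => z - v.1)
    refine ⟨s, fun x hx => hs x (Finset.mem_image.2 ⟨v.1 + x, hx v.1 v.2, by abel⟩)⟩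
  choose g hg using key
  obtain ⟨s, hs⟩ := Finset.rado_selection (β := fun _ : Site => A) g
  refine ⟨s, funext fun x => ?_⟩
  obtain ⟨V, hV, h⟩ := hs (N.image fun u => u + x)
  have hmem : ∀ u ∈ N, u + x ∈ N.image fun u => u + x := fun u hu => Finset.mem_image_of_mem _ hu
  rw [← hg V x fun u hu => hV (hmem u hu)]
  exact globalMap_congr f fun u hu => h _ (hmem u hu)

/-! ### Moore's theorem: erasable pairs exclude surjectivity -/

/-- The square `[-M, M]²`. -/
noncomputable def square (M : ℤ) : Finset Site := Finset.Icc (-M) M ×ˢ Finset.Icc (-M) M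

theorem mem_square {M : ℤ} {z : Site} :
    z ∈ square M ↔ (-M ≤ z.1 ∧ z.1 ≤ M) ∧ -M ≤ z.2 ∧ z.2 ≤ M := by
  simp [square]

theorem exists_subset_square (D : Finset Site) : ∃ R : ℕ, D ⊆ square R := by
  refine ⟨D.sup fun z => z.1.natAbs + z.2.natAbs, fun z hz => ?_⟩
  have := Finset.le_sup (f := fun z : Site => z.1.natAbs + z.2.natAbs) hz
  rw [mem_square]
  omega

/-- The index of the translate of `[-M, M]²` by a multiple of `2 M + 1` that contains a site. -/
def tileIndex (M : ℤ) (z : Site) : Site := ((z.1 + M) / (2 * M + 1), (z.2 + M) / (2 * M + 1))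

theorem sub_tileIndex_mem_square {M : ℤ} (hM : 0 ≤ M) (z : Site) :
    z - (2 * M + 1) • tileIndex M z ∈ square M := by
  have h1 := Int.emod_nonneg (z.1 + M) (b := 2 * M + 1) (by omega)
  have h2 := Int.emod_lt_of_pos (z.1 + M) (b := 2 * M + 1) (by omega)
  have h3 := Int.emod_nonneg (z.2 + M) (b := 2 * M + 1) (by omega)
  have h4 := Int.emod_lt_of_pos (z.2 + M) (b := 2 * M + 1) (by omega)
  have h5 := Int.mul_ediv_add_emod (z.1 + M) (2 * M + 1)
  have h6 := Int.mul_ediv_add_emod (z.2 + M) (2 * M + 1)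
  rw [mem_square]
  simp only [tileIndex, Prod.fst_sub, Prod.snd_sub, Prod.smul_fst, Prod.smul_snd, smul_eq_mul]
  constructor <;> constructor <;> linarith

theorem tileIndex_add {M : ℤ} {b : Site} (hb : b ∈ square M) (k : Site) :
    tileIndex M ((2 * M + 1) • k + b) = k := by
  rw [mem_square] at hb
  have key : ∀ p q : ℤ, -M ≤ q → q ≤ M → ((2 * M + 1) * p + q + M) / (2 * M + 1) = p := by
    intro p q h1 h2
    rw [add_assoc, Int.add_comm, Int.add_mul_ediv_left _ _ (by omega),
      Int.ediv_eq_zero_of_lt (by omega) (by omega), zero_add]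
  exact Prod.ext (key _ _ hb.1.1 hb.1.2) (key _ _ hb.2.1 hb.2.2)

/-- A block that occurs in one of two configurations with equal images can be avoided. -/
theorem exists_globalMap_eq_avoiding {A : Type*} {N : Finset Site} (f : (N → A) → A)
    {s s' : Site → A} (hne : s ≠ s') {R : ℕ} (hN : N ⊆ square R)
    (hD : ∀ z, s z ≠ s' z → z ∈ square R) (h : globalMap f s = globalMap f s') (t : Site → A) :
    ∃ t', globalMap f t' = globalMap f t ∧
      ∀ k : Site, ∃ b ∈ square (3 * R), t' ((2 * (3 * R : ℤ) + 1) • k + b) ≠ s' b := by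
  classical
  -- The difference set and `N` lie within distance `R` of the origin. A position that sees a
  -- changed cell of a tile is within `2 * R` of its centre, and everything it sees is within `3 *
  -- R`, hence in the same tile.
  set M : ℤ := 3 * R with hM
  have hM0 : 0 ≤ M := by positivity
  -- Every tile that shows the pattern of `s'` is overwritten by that of `s`. The image is
  -- unchanged, since `s` and `s'` have equal images.
  let bad : Site → Prop := fun k => ∀ b ∈ square M, t ((2 * M + 1) • k + b) = s' b
  let t' : Site → A := fun z =>
    if bad (tileIndex M z) then s (z - (2 * M + 1) • tileIndex M z) else t z
  have ht' : ∀ k, ∀ b ∈ square M, t' ((2 * M + 1) • k + b) =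
      if bad k then s b else t ((2 * M + 1) • k + b) := by
    intro k b hb
    simp only [t', tileIndex_add hb, add_sub_cancel_left]
  refine ⟨t', funext fun x => ?_, fun k => ?_⟩
  · by_cases hx : ∀ u ∈ N, t' (u + x) = t (u + x)
    · exact globalMap_congr f hx
    · push Not at hx
      obtain ⟨u, hu, hux⟩ := hx
      set k := tileIndex M (u + x) with hk
      have hb := sub_tileIndex_mem_square hM0 (u + x)
      rw [← hk] at hb
      have hz : u + x = (2 * M + 1) • k + (u + x - (2 * M + 1) • k) := by abel
      have hbad : bad k := by
        by_contra hn
        rw [hz, ht' _ _ hb, if_neg hn] at hux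
        exact hux rfl
      have hd : u + x - (2 * M + 1) • k ∈ square R := by
        refine hD _ fun e => hux ?_
        rw [hz, ht' _ _ hb, if_pos hbad, e, hbad _ hb]
      have hmem : ∀ w ∈ N, w + (x - (2 * M + 1) • k) ∈ square M := by
        intro w hw
        have h1 := mem_square.1 (hN hu)
        have h2 := mem_square.1 (hN hw)
        rw [mem_square] at hd ⊢
        simp only [Prod.fst_sub, Prod.snd_sub, Prod.fst_add, Prod.snd_add] at hd ⊢
        omega
      have e : ∀ w, w + x = (2 * M + 1) • k + (w + (x - (2 * M + 1) • k)) := fun w => by abel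
      calc globalMap f t' x = globalMap f s (x - (2 * M + 1) • k) :=
            globalMap_congr f fun w hw => by rw [e, ht' _ _ (hmem w hw), if_pos hbad]
        _ = globalMap f s' (x - (2 * M + 1) • k) := by rw [h]
        _ = globalMap f t x :=
            globalMap_congr f fun w hw => by rw [e, hbad _ (hmem w hw)]
  · by_cases hk : bad k
    · obtain ⟨b, hb⟩ := Function.ne_iff.1 hne
      have hbR := hD b hb
      have hbM : b ∈ square M := by
        rw [mem_square] at hbR ⊢
        omega
      exact ⟨b, hbM, by rwa [ht' k b hbM, if_pos hk]⟩
    · have hk' := hk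
      simp only [bad, not_forall] at hk'
      obtain ⟨b, hb, hbk⟩ := hk'
      exact ⟨b, hb, by rwa [ht' k b hb, if_neg hk]⟩

/-- Powers of `Q / (Q - 1) > 1` exceed any constant; in the counting below the constant pays for the
boundary of a large square. -/
theorem exists_mul_pred_pow_lt {Q : ℕ} (hQ : 2 ≤ Q) {K : ℕ} (hK : 1 ≤ K) :
    ∃ n, n ≠ 0 ∧ K * (Q - 1) ^ n < Q ^ n := by
  obtain ⟨q, rfl⟩ : ∃ q, Q = q + 2 := ⟨Q - 2, by omega⟩
  have hq : (0 : ℝ) < q + 1 := by positivity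
  obtain ⟨n, hn⟩ := pow_unbounded_of_one_lt (K : ℝ)
    ((one_lt_div hq).2 (by linarith : (q : ℝ) + 1 < q + 2))
  refine ⟨n, ?_, ?_⟩
  · rintro rfl
    have : (1 : ℝ) ≤ K := by exact_mod_cast hK
    simp only [pow_zero] at hn
    linarith
  · rw [div_pow, lt_div_iff₀ (by positivity)] at hn
    exact_mod_cast hn

/-- If the map were onto, every pattern on a large square would have a preimage in which no tile
shows the pattern of `s'`. A tile then has only `q ^ (m * m) - 1` possible contents. This
exponential loss in the area beats the loss at the boundary, which is only exponential in the side
length. -/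
theorem not_surjective_of_pair {A : Type*} [Finite A] {N : Finset Site} (f : (N → A) → A)
    {s s' : Site → A} (hne : s ≠ s') (hfin : {z | s z ≠ s' z}.Finite)
    (h : globalMap f s = globalMap f s') : ¬Function.Surjective (globalMap f) := by
  classical
  intro hsurj
  obtain ⟨R, hR⟩ := exists_subset_square (N ∪ hfin.toFinset)
  have hN : N ⊆ square R := Finset.subset_union_left.trans hR
  have hD : ∀ z, s z ≠ s' z → z ∈ square R := fun z hz =>
    hR (Finset.mem_union_right _ (hfin.mem_toFinset.2 hz))
  have := Fintype.ofFinite A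
  have hA : 2 ≤ Fintype.card A := by
    obtain ⟨z, hz⟩ := Function.ne_iff.1 hne
    exact Fintype.one_lt_card_iff.2 ⟨_, _, hz⟩
  set q := Fintype.card A with hq
  set m : ℕ := 6 * R + 1 with hm
  have hQ : 2 ≤ q ^ (m * m) :=
    hA.trans (Nat.le_self_pow (by rw [hm]; positivity) q)
  -- The boundary costs `(m * n) ^ 2 - (m * n - 2 * R) ^ 2 ≤ 4 * R * m * n` cells, that is, a factor
  -- `q ^ (4 * R * m)` for each of the `n` rows of tiles.
  obtain ⟨n, hn0, hn⟩ := exists_mul_pred_pow_lt hQ (K := q ^ (4 * R * m)) (Nat.one_le_pow _ _ (by omega))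
  have avoid := exists_globalMap_eq_avoiding f hne hN hD h
  have hMm : 2 * (3 * R : ℤ) + 1 = m := by rw [hm]; push_cast; ring
  rw [hMm] at avoid
  -- Widened by `R` at both ends, this interval is `[-3 * R, m * n - 3 * R)`, which is exactly the
  -- union of the one-dimensional tiles with indices `0, …, n - 1`.
  let I : Finset ℤ := Finset.Ico (-2 * R) (m * n - 4 * R)
  have hI : I.card = m * n - 2 * R := by
    simp only [I, Int.card_Ico]
    omega
  have pre : ∀ p : (I ×ˢ I : Finset Site) → A, ∃ t : Site → A, (∀ x, globalMap f t x.1 = p x) ∧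
      ∀ k : Site, (fun b : square (3 * R) => t ((m : ℤ) • k + b.1)) ≠ fun b => s' b.1 := by
    intro p
    -- The values outside the square are immaterial; `s` only serves to have some symbol there.
    obtain ⟨t, ht⟩ := hsurj fun x => if hx : x ∈ I ×ˢ I then p ⟨x, hx⟩ else s x
    obtain ⟨t', h1, h2⟩ := avoid t
    refine ⟨t', fun x => ?_, fun k => ?_⟩
    · rw [h1, ht]
      exact dif_pos x.2
    · obtain ⟨b, hb, hbk⟩ := h2 k
      exact fun e => hbk (congrFun e ⟨b, hb⟩)
  choose t ht htk using pre
  -- A pattern is sent to the contents of the `n * n` tiles in its chosen preimage. These tiles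
  -- contain every cell seen from the square, so they determine the pattern.
  let Φ : ((I ×ˢ I : Finset Site) → A) → Fin n × Fin n →
      {c : square (3 * R) → A // c ≠ fun b => s' b.1} := fun p k => ⟨_, htk p (k.1, k.2)⟩
  have hΦ : Function.Injective Φ := by
    intro p p' e
    funext x
    rw [← ht p, ← ht p']
    refine globalMap_congr f fun u hu => ?_
    set z := u + x.1 with hz
    have hu := mem_square.1 (hN hu)
    have hx := x.2
    simp only [I, Finset.mem_product, Finset.mem_Ico] at hx
    have hb := sub_tileIndex_mem_square (M := 3 * R) (by positivity) z
    have hk1 : z.1 = u.1 + x.1.1 := rfl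
    have hk2 : z.2 = u.2 + x.1.2 := rfl
    have hm0 : (0 : ℤ) < m := by omega
    have k1 : 0 ≤ (tileIndex (3 * R) z).1 := Int.ediv_nonneg (by omega) (by omega)
    have k2 : 0 ≤ (tileIndex (3 * R) z).2 := Int.ediv_nonneg (by omega) (by omega)
    have k3 : (tileIndex (3 * R) z).1 < n := Int.ediv_lt_of_lt_mul (by omega) (by
      rw [hMm, mul_comm (n : ℤ)]; omega)
    have k4 : (tileIndex (3 * R) z).2 < n := Int.ediv_lt_of_lt_mul (by omega) (by
      rw [hMm, mul_comm (n : ℤ)]; omega)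
    rw [hMm] at hb
    set k := tileIndex (3 * R) z
    have := congrFun (congrArg Subtype.val (congrFun e (⟨k.1.toNat, by omega⟩, ⟨k.2.toNat, by omega⟩)))
      ⟨_, hb⟩
    have hkk : (((k.1.toNat : ℕ) : ℤ), ((k.2.toNat : ℕ) : ℤ)) = k :=
      Prod.ext (Int.toNat_of_nonneg k1) (Int.toNat_of_nonneg k2)
    change t p ((m : ℤ) • (((k.1.toNat : ℕ) : ℤ), ((k.2.toNat : ℕ) : ℤ)) + _) =
      t p' ((m : ℤ) • (((k.1.toNat : ℕ) : ℤ), ((k.2.toNat : ℕ) : ℤ)) + _) at this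
    rwa [hkk, add_sub_cancel] at this
  have hcard := Fintype.card_le_of_injective Φ hΦ
  have hsq : (square (3 * R)).card = m * m := by
    simp only [square, Finset.card_product, Int.card_Icc]
    congr 1 <;> omega
  rw [Fintype.card_fun, Fintype.card_fun, Fintype.card_subtype_compl, Fintype.card_fun,
    Fintype.card_subtype_eq, Fintype.card_prod, Fintype.card_fin, Fintype.card_coe,
    Fintype.card_coe, hsq, Finset.card_product, hI, ← hq] at hcard
  have hmn : 2 * R ≤ m * n := by
    calc 2 * R ≤ m := by omega
      _ ≤ m * n := Nat.le_mul_of_pos_right _ (Nat.pos_of_ne_zero hn0)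
  have hexp : m * m * n * n ≤ 4 * R * m * n + (m * n - 2 * R) * (m * n - 2 * R) := by
    obtain ⟨d, hd⟩ := Nat.exists_eq_add_of_le hmn
    rw [hd, Nat.add_sub_cancel_left]
    calc m * m * n * n = (m * n) * (m * n) := by ring
      _ = (2 * R + d) * (2 * R + d) := by rw [hd]
      _ ≤ 4 * R * (2 * R + d) + d * d := by nlinarith
      _ = 4 * R * m * n + d * d := by rw [← hd]; ring
  -- The `n`-th power turns the estimate for one row of tiles into one for all `n * n` tiles.
  have hlt := Nat.pow_lt_pow_left hn hn0
  rw [mul_pow, ← pow_mul, ← pow_mul, ← pow_mul, ← pow_mul] at hlt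
  have hle := Nat.pow_le_pow_right (by omega : 0 < q) hexp
  rw [pow_add] at hle
  rw [← mul_assoc] at hlt
  exact absurd (hle.trans (Nat.mul_le_mul_left _ hcard)) (not_le.2 hlt)

/-! ### Tables indexed by Boolean assignments, with sets of rules as bit masks -/

/-- A decision tree over Boolean variables whose leaves are bit masks. The variable tested at the
root is variable `0`; `skip` passes to the next variable without testing. -/
inductive MaskTree where
  | leaf (n : ℕ) : MaskTree
  | node (l r : MaskTree) : MaskTree
  | skip (t : MaskTree) : MaskTree

namespace MaskTree

/-- Bit `i` of the mask selected by the assignment `σ`. -/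
def bit (i : ℕ) : MaskTree → (ℕ → Bool) → Bool
  | leaf n, _ => n.testBit i
  | node l r, σ => bif σ 0 then bit i r (fun j => σ (j + 1)) else bit i l (fun j => σ (j + 1))
  | skip t, σ => bit i t (fun j => σ (j + 1))

noncomputable def landLeaf (a : ℕ) (s : MaskTree) : MaskTree :=
  MaskTree.rec (fun b => leaf (Nat.land a b)) (fun _ _ hl hr => node hl hr) (fun _ h => skip h) s

/-- The recursor supplies `hl` and `hr`, the conjunctions with `l` and with `r` as functions of the
second tree; thus both trees are descended together. -/
noncomputable def landNode (l r : MaskTree) (hl hr : MaskTree → MaskTree) (s : MaskTree) :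
    MaskTree :=
  MaskTree.rec (fun b => node (landLeaf b l) (landLeaf b r))
    (fun sl sr _ _ => node (hl sl) (hr sr)) (fun s _ => node (hl s) (hr s)) s

noncomputable def landSkip (t : MaskTree) (h : MaskTree → MaskTree) (s : MaskTree) : MaskTree :=
  MaskTree.rec (fun b => skip (landLeaf b t)) (fun sl sr _ _ => node (h sl) (h sr))
    (fun s _ => skip (h s)) s

/-- Pointwise conjunction. The recursor is used directly, for speed of kernel reduction. -/
noncomputable def land (t : MaskTree) : MaskTree → MaskTree :=
  MaskTree.rec landLeaf landNode landSkip t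

noncomputable def lorLeaf (a : ℕ) (s : MaskTree) : MaskTree :=
  MaskTree.rec (fun b => leaf (Nat.lor a b)) (fun _ _ hl hr => node hl hr) (fun _ h => skip h) s

noncomputable def lorNode (l r : MaskTree) (hl hr : MaskTree → MaskTree) (s : MaskTree) :
    MaskTree :=
  MaskTree.rec (fun b => node (lorLeaf b l) (lorLeaf b r))
    (fun sl sr _ _ => node (hl sl) (hr sr)) (fun s _ => node (hl s) (hr s)) s

noncomputable def lorSkip (t : MaskTree) (h : MaskTree → MaskTree) (s : MaskTree) : MaskTree :=
  MaskTree.rec (fun b => skip (lorLeaf b t)) (fun sl sr _ _ => node (h sl) (h sr))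
    (fun s _ => skip (h s)) s

/-- Pointwise disjunction. -/
noncomputable def lor (t : MaskTree) : MaskTree → MaskTree :=
  MaskTree.rec lorLeaf lorNode lorSkip t

/-- The leftmost leaf. -/
noncomputable def val (t : MaskTree) : ℕ :=
  MaskTree.rec (fun n => n) (fun _ _ h _ => h) (fun _ h => h) t

/-- The subtree for a given value of the variable at the root. -/
noncomputable def sel (b : Bool) (t : MaskTree) : MaskTree :=
  MaskTree.rec leaf (fun l r _ _ => Bool.rec l r b) (fun t _ => t) t

noncomputable def get (t : MaskTree) (b0 b1 b2 b3 b4 : Bool) : ℕ :=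
  val (sel b4 (sel b3 (sel b2 (sel b1 (sel b0 t)))))

/-- Conjunction of all leaves. -/
noncomputable def allLand (t : MaskTree) : ℕ :=
  MaskTree.rec (fun n => n) (fun _ _ a b => Nat.land a b) (fun _ h => h) t

/-- Disjunction of all leaves. -/
noncomputable def allLor (t : MaskTree) : ℕ :=
  MaskTree.rec (fun n => n) (fun _ _ a b => Nat.lor a b) (fun _ h => h) t

variable {i : ℕ}

theorem bit_landLeaf (a : ℕ) (s : MaskTree) (σ : ℕ → Bool) :
    bit i (landLeaf a s) σ = (a.testBit i && bit i s σ) := by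
  induction s generalizing σ with
  | leaf b => exact Nat.testBit_and a b i
  | node l r hl hr =>
    have := hl fun j => σ (j + 1)
    have := hr fun j => σ (j + 1)
    simp only [landLeaf] at *
    cases h : σ 0 <;> simp_all [bit]
  | skip t h =>
    have := h fun j => σ (j + 1)
    simp only [landLeaf] at *
    simp_all [bit]

theorem bit_lorLeaf (a : ℕ) (s : MaskTree) (σ : ℕ → Bool) :
    bit i (lorLeaf a s) σ = (a.testBit i || bit i s σ) := by
  induction s generalizing σ with
  | leaf b => exact Nat.testBit_or a b i
  | node l r hl hr =>
    have := hl fun j => σ (j + 1)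
    have := hr fun j => σ (j + 1)
    simp only [lorLeaf] at *
    cases h : σ 0 <;> simp_all [bit]
  | skip t h =>
    have := h fun j => σ (j + 1)
    simp only [lorLeaf] at *
    simp_all [bit]

theorem bit_land (t s : MaskTree) (σ : ℕ → Bool) :
    bit i (land t s) σ = (bit i t σ && bit i s σ) := by
  induction t generalizing s σ with
  | leaf a => exact bit_landLeaf a s σ
  | node l r hl hr =>
    change bit i (landNode l r (land l) (land r) s) σ = _
    cases s <;> cases h : σ 0 <;> simp [landNode, bit, h, bit_landLeaf, hl, hr, Bool.and_comm]
  | skip t ht =>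
    change bit i (landSkip t (land t) s) σ = _
    cases s <;> cases h : σ 0 <;> simp [landSkip, bit, h, bit_landLeaf, ht, Bool.and_comm]

theorem bit_lor (t s : MaskTree) (σ : ℕ → Bool) :
    bit i (lor t s) σ = (bit i t σ || bit i s σ) := by
  induction t generalizing s σ with
  | leaf a => exact bit_lorLeaf a s σ
  | node l r hl hr =>
    change bit i (lorNode l r (lor l) (lor r) s) σ = _
    cases s <;> cases h : σ 0 <;> simp [lorNode, bit, h, bit_lorLeaf, hl, hr, Bool.or_comm]
  | skip t ht =>
    change bit i (lorSkip t (lor t) s) σ = _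
    cases s <;> cases h : σ 0 <;> simp [lorSkip, bit, h, bit_lorLeaf, ht, Bool.or_comm]

theorem testBit_val (t : MaskTree) : (val t).testBit i = bit i t (fun _ => false) := by
  induction t with
  | leaf n => rfl
  | node l r hl hr => exact hl
  | skip t h => exact h

/-- The tree has `leaf`s exactly at depth `d`, and no `skip`. -/
def Full : ℕ → MaskTree → Prop
  | 0, leaf _ => True
  | d + 1, node l r => Full d l ∧ Full d r
  | _, _ => False

theorem bit_of_allLor {d : ℕ} {t : MaskTree} (ht : Full d t) {σ : ℕ → Bool}
    (h : bit i t σ = true) : (allLor t).testBit i = true := by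
  induction t generalizing d σ with
  | leaf n => exact h
  | node l r hl hr =>
    cases d with
    | zero => exact ht.elim
    | succ d =>
      change (Nat.lor (allLor l) (allLor r)).testBit i = true
      rw [show Nat.lor (allLor l) (allLor r) = allLor l ||| allLor r from rfl, Nat.testBit_or,
        Bool.or_eq_true]
      cases h0 : σ 0 <;> simp only [bit, h0, cond_true, cond_false] at h
      · exact .inl (hl ht.1 h)
      · exact .inr (hr ht.2 h)
  | skip t h => cases d <;> exact ht.elim

theorem bit_of_allLand {d : ℕ} {t : MaskTree} (ht : Full d t) {σ : ℕ → Bool}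
    (h : bit i t σ = false) : (allLand t).testBit i = false := by
  induction t generalizing d σ with
  | leaf n => exact h
  | node l r hl hr =>
    cases d with
    | zero => exact ht.elim
    | succ d =>
      change (Nat.land (allLand l) (allLand r)).testBit i = false
      rw [show Nat.land (allLand l) (allLand r) = allLand l &&& allLand r from rfl,
        Nat.testBit_and]
      cases h0 : σ 0 <;> simp only [bit, h0, cond_true, cond_false] at h
      · rw [hl ht.1 h, Bool.false_and]
      · rw [hr ht.2 h, Bool.and_false]
  | skip t h => cases d <;> exact ht.elim

end MaskTree

open MaskTree

/-! ### Elimination of variables -/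

/-- The two halves of a conjunction of trees that test variable `0`. -/
inductive Pending where
  | none : Pending
  | some (l r : MaskTree) : Pending

noncomputable def Pending.add (l r : MaskTree) (a : Pending) : Pending :=
  Pending.rec (.some l r) (fun l' r' => .some (land l' l) (land r' r)) a

noncomputable def Pending.flush (L : List MaskTree) (a : Pending) : List MaskTree :=
  Pending.rec L (fun l r => lor l r :: L) a

def Pending.Holds (i : ℕ) (b : Bool) (σ : ℕ → Bool) : Pending → Prop
  | .none => True
  | .some l r => (bif b then bit i r σ else bit i l σ) = true

/-- A tree that does not test variable `0` is kept, with its variables renumbered. A tree that does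
is merged into the pending conjunction, which is stored as its restrictions to the two values of the
variable. -/
noncomputable def elimCons (t : MaskTree) (ih : Pending → List MaskTree → List MaskTree)
    (a : Pending) (L : List MaskTree) : List MaskTree :=
  MaskTree.rec (fun n => ih a (leaf n :: L)) (fun l r _ _ => ih (Pending.add l r a) L)
    (fun t _ => ih a (t :: L)) t

noncomputable def elimAux (L : List MaskTree) : Pending → List MaskTree → List MaskTree :=
  List.rec (fun a L => Pending.flush L a) (fun t _ ih => elimCons t ih) L

/-- Replace a list of trees by one expressing that some value of variable `0` satisfies all. -/
noncomputable def elimVar (L : List MaskTree) : List MaskTree := elimAux L .none []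

/-- Eliminate one variable for every entry of `o`. -/
noncomputable def elimVars (o : List ℕ) : List MaskTree → List MaskTree :=
  List.rec (fun L => L) (fun _ _ ih L => ih (elimVar L)) o

/-- Once all tested variables are eliminated the trees are leaves. Should variables be left, the
leftmost leaf is the value with all of them `false`, so the result remains sound. -/
noncomputable def landVals (L : List MaskTree) (z : ℕ) : ℕ :=
  List.rec z (fun t _ ih => Nat.land (val t) ih) L

/-- Only soundness is needed: a solution of the reduced list extends to variable `0`. The disjunct
of the flushed tree that holds tells which value `b` to use, and the trees in `R` do not involve
that variable. -/
theorem exists_of_elimAux {i : ℕ} {σ : ℕ → Bool} (L : List MaskTree) (a : Pending)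
    (R : List MaskTree) (h : ∀ t ∈ elimAux L a R, bit i t σ = true) :
    (∀ t ∈ R, bit i t σ = true) ∧ ∃ b : Bool, a.Holds i b σ ∧
      ∀ t ∈ L, bit i t (fun j => Nat.casesOn j b σ) = true := by
  induction L generalizing a R with
  | nil =>
    cases a with
    | none => exact ⟨h, false, trivial, by simp⟩
    | some l r =>
      have h1 : ∀ t ∈ lor l r :: R, bit i t σ = true := h
      refine ⟨fun t ht => h1 t (List.mem_cons_of_mem _ ht), ?_⟩
      have h2 := h1 _ List.mem_cons_self
      rw [bit_lor, Bool.or_eq_true] at h2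
      rcases h2 with h2 | h2
      · exact ⟨false, h2, by simp⟩
      · exact ⟨true, h2, by simp⟩
  | cons t L ih =>
    cases t with
    | leaf n =>
      obtain ⟨h1, b, h2, h3⟩ := ih a (leaf n :: R) h
      refine ⟨fun t ht => h1 t (List.mem_cons_of_mem _ ht), b, h2, ?_⟩
      simp only [List.mem_cons, forall_eq_or_imp]
      exact ⟨h1 (leaf n) List.mem_cons_self, h3⟩
    | skip t =>
      obtain ⟨h1, b, h2, h3⟩ := ih a (t :: R) h
      refine ⟨fun t ht => h1 t (List.mem_cons_of_mem _ ht), b, h2, ?_⟩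
      simp only [List.mem_cons, forall_eq_or_imp]
      exact ⟨h1 t List.mem_cons_self, h3⟩
    | node l r =>
      obtain ⟨h1, b, h2, h3⟩ := ih (Pending.add l r a) R h
      have h4 : a.Holds i b σ ∧ (bif b then bit i r σ else bit i l σ) = true := by
        cases a with
        | none => exact ⟨trivial, h2⟩
        | some l' r' =>
          have h2' : (bif b then bit i (land r' r) σ else bit i (land l' l) σ) = true := h2
          cases b <;> simpa [Pending.Holds, bit_land] using h2'
      refine ⟨h1, b, h4.1, ?_⟩
      simp only [List.mem_cons, forall_eq_or_imp]
      exact ⟨h4.2, h3⟩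

/-- The entries of `o` only count the rounds: variables are renumbered after each elimination, so
the next one is always number `0`. -/
theorem exists_of_elimVars {i : ℕ} (o : List ℕ) (L : List MaskTree) {σ : ℕ → Bool}
    (h : ∀ t ∈ elimVars o L, bit i t σ = true) : ∃ σ' : ℕ → Bool, ∀ t ∈ L, bit i t σ' = true := by
  induction o generalizing L with
  | nil => exact ⟨σ, h⟩
  | cons v o ih =>
    obtain ⟨σ', h'⟩ := ih (elimVar L) h
    obtain ⟨-, b, -, h3⟩ := exists_of_elimAux L .none [] h'
    exact ⟨_, h3⟩

theorem bit_of_landVals {i : ℕ} (L : List MaskTree) (z : ℕ)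
    (h : (landVals L z).testBit i = true) : ∀ t ∈ L, bit i t (fun _ => false) = true := by
  induction L with
  | nil => simp
  | cons t L ih =>
    have h' : (val t &&& landVals L z).testBit i = true := h
    rw [Nat.testBit_and, Bool.and_eq_true, testBit_val] at h'
    simp only [List.mem_cons, forall_eq_or_imp]
    exact ⟨h'.1, ih h'.2⟩

/-! ### Five-site rules over two symbols -/

/-- Five sites of the lattice, in a fixed order. -/
structure Stencil where
  (u0 u1 u2 u3 u4 : Site)

abbrev BoolRule := Bool → Bool → Bool → Bool → Bool → Bool

/-- Two configurations that differ in a finite nonempty set have the same image. -/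
def Erasable (S : Stencil) (r : BoolRule) : Prop :=
  ∃ s s' : Site → Bool, s ≠ s' ∧ {z | s z ≠ s' z}.Finite ∧
    ∀ y, r (s (y + S.u0)) (s (y + S.u1)) (s (y + S.u2)) (s (y + S.u3)) (s (y + S.u4)) =
      r (s' (y + S.u0)) (s' (y + S.u1)) (s' (y + S.u2)) (s' (y + S.u3)) (s' (y + S.u4))

/-- The rule after negation of its `j`-th argument. -/
def BoolRule.flip (r : BoolRule) (j : ℕ) : BoolRule := fun b0 b1 b2 b3 b4 =>
  r (Nat.beq j 0 ^^ b0) (Nat.beq j 1 ^^ b1) (Nat.beq j 2 ^^ b2) (Nat.beq j 3 ^^ b3)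
    (Nat.beq j 4 ^^ b4)

def BoolRule.DependsAt (r : BoolRule) (j : ℕ) : Prop :=
  ∃ b0 b1 b2 b3 b4, r b0 b1 b2 b3 b4 ≠ r.flip j b0 b1 b2 b3 b4

/-- The rule is not permutive in its `j`-th argument. -/
def BoolRule.FlatAt (r : BoolRule) (j : ℕ) : Prop :=
  ∃ b0 b1 b2 b3 b4, r b0 b1 b2 b3 b4 = r.flip j b0 b1 b2 b3 b4

/-- If the rule depends on its arguments in `D` and is not permutive in those in `P`, then it is
erasable. -/
def ErasableIf (S : Stencil) (D P : List ℕ) (r : BoolRule) : Prop :=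
  (∀ j ∈ D, r.DependsAt j) → (∀ j ∈ P, r.FlatAt j) → Erasable S r

/-! ### The rules that have an erasable pair with a given difference set -/

/-- Numerical codes of five sites: `(x, y)` has code `(x + 2) + 16 * (y + 2)`. -/
structure SiteCodes where
  (o0 o1 o2 o3 o4 : ℕ)

/-- A difference set `I`, the relevant cells `o` in the order of elimination, and the positions `ps`
whose neighbourhood may meet `I`. -/
structure Plan where
  (I o ps : List ℕ)

noncomputable def eqMask (ones a b : ℕ) : ℕ := Nat.xor ones (Nat.xor a b)

/-- The table of the masks of the rules whose values at `b` and at `b xor φ` agree. -/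
noncomputable def eqTree (ones : ℕ) (φ : List Bool) : MaskTree → MaskTree → MaskTree :=
  List.rec (fun t s => leaf (eqMask ones (val t) (val s)))
    (fun b _ ih t s => node (ih (sel false t) (sel b s)) (ih (sel true t) (sel (not b) s))) φ

/-- For each variable in the order of elimination: the argument of the five-variable table that it
is, or `pass` if the table does not involve it. -/
inductive Token where
  | pass | s0 | s1 | s2 | s3 | s4

noncomputable def buildToken (tk : Token) (ih : Bool → Bool → Bool → Bool → Bool → MaskTree)
    (b0 b1 b2 b3 b4 : Bool) : MaskTree :=
  Token.rec (skip (ih b0 b1 b2 b3 b4)) (node (ih false b1 b2 b3 b4) (ih true b1 b2 b3 b4))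
    (node (ih b0 false b2 b3 b4) (ih b0 true b2 b3 b4))
    (node (ih b0 b1 false b3 b4) (ih b0 b1 true b3 b4))
    (node (ih b0 b1 b2 false b4) (ih b0 b1 b2 true b4))
    (node (ih b0 b1 b2 b3 false) (ih b0 b1 b2 b3 true)) tk

/-- The table `T` with its variables placed as the tokens say. -/
noncomputable def build (T : MaskTree) (ts : List Token) :
    Bool → Bool → Bool → Bool → Bool → MaskTree :=
  List.rec (fun b0 b1 b2 b3 b4 => leaf (get T b0 b1 b2 b3 b4))
    (fun tk _ ih => buildToken tk ih) ts

/-- A `pass` with nothing after it is dropped, so that a tree ends in a leaf right after the last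
variable it tests. -/
noncomputable def consPass (ts : List Token) : List Token :=
  List.rec [] (fun t ts _ => .pass :: t :: ts) ts

noncomputable def consToken (c0 c1 c2 c3 c4 v : ℕ) (ts : List Token) : List Token :=
  Bool.rec (Bool.rec (Bool.rec (Bool.rec (Bool.rec (consPass ts) (.s4 :: ts) (Nat.beq v c4))
    (.s3 :: ts) (Nat.beq v c3)) (.s2 :: ts) (Nat.beq v c2)) (.s1 :: ts) (Nat.beq v c1))
    (.s0 :: ts) (Nat.beq v c0)

noncomputable def tokens (c0 c1 c2 c3 c4 : ℕ) (o : List ℕ) : List Token :=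
  List.rec [] (fun v _ ih => consToken c0 c1 c2 c3 c4 v ih) o

/-- The number with the bits in `I` set. -/
noncomputable def bitsOf (I : List ℕ) : ℕ :=
  List.rec 0 (fun i _ ih => Nat.lor (Nat.shiftLeft 1 i) ih) I

noncomputable def hasBit (m v : ℕ) : Bool := Nat.beq (Nat.land (Nat.shiftRight m v) 1) 1

/-- Case distinction that evaluates its argument. -/
noncomputable def withBool {α : Type} (f : Bool → α) (b : Bool) : α := Bool.rec (f false) (f true) b

noncomputable def cellsTree (ones : ℕ) (R : MaskTree) (I J : ℕ) (o : List ℕ) (c0 c1 c2 c3 c4 : ℕ) :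
    MaskTree :=
  withBool (fun f0 => withBool (fun f1 => withBool (fun f2 => withBool (fun f3 => withBool (fun f4 =>
    withBool (fun b0 => withBool (fun b1 => withBool (fun b2 => withBool (fun b3 => withBool (fun b4 =>
      build (eqTree ones [f0, f1, f2, f3, f4] R R) (tokens c0 c1 c2 c3 c4 o) b0 b1 b2 b3 b4)
    (hasBit J c4)) (hasBit J c3)) (hasBit J c2)) (hasBit J c1)) (hasBit J c0))
    (hasBit I c4)) (hasBit I c3)) (hasBit I c2)) (hasBit I c1)) (hasBit I c0)

noncomputable def positionTree (ones : ℕ) (R : MaskTree) (C : SiteCodes) (I J : ℕ) (o : List ℕ)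
    (p : ℕ) : MaskTree :=
  SiteCodes.rec (fun o0 o1 o2 o3 o4 => cellsTree ones R I J o (Nat.add p o0) (Nat.add p o1)
    (Nat.add p o2) (Nat.add p o3) (Nat.add p o4)) C

noncomputable def positionTrees (ones : ℕ) (R : MaskTree) (C : SiteCodes) (I J : ℕ) (o ps : List ℕ) :
    List MaskTree :=
  List.rec [] (fun p _ ih => positionTree ones R C I J o p :: ih) ps

noncomputable def isOdd (K : ℕ) : Bool := Nat.beq (Nat.land K 1) 1

/-- The entries of `o` at the places of the zero bits of `K`. -/
noncomputable def freeCells (o : List ℕ) : ℕ → List ℕ :=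
  List.rec (fun _ => []) (fun v _ ih K => withBool
    (fun b => Bool.rec (v :: ih (Nat.shiftRight K 1)) (ih (Nat.shiftRight K 1)) b) (isOdd K)) o

/-- The number with the bits set that are the entries of `o` at the places of the one bits
of `J`. -/
noncomputable def trueCells (o : List ℕ) : ℕ → ℕ :=
  List.rec (fun _ => 0) (fun v _ ih J => withBool
    (fun b => Bool.rec (ih (Nat.shiftRight J 1))
      (Nat.lor (Nat.shiftLeft 1 v) (ih (Nat.shiftRight J 1))) b) (isOdd J)) o

/-- The mask of the rules for which the plan yields an erasable pair in which the cells of `o` at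
the places in `J` hold `true`, the other cells at the places in `K` hold `false`, and the remaining
cells of `o` are arbitrary. -/
noncomputable def planMask (ones : ℕ) (R : MaskTree) (C : SiteCodes) (pl : Plan) (K J : ℕ) : ℕ :=
  Plan.rec (fun I o ps => landVals (elimVars (freeCells o K)
    (positionTrees ones R C (bitsOf I) (trueCells o J) (freeCells o K) ps)) ones) pl

/-- `R` represents, in bit `i`, the rule `r`. -/
def Represents (R : MaskTree) (i : ℕ) (r : BoolRule) : Prop :=
  ∀ b0 b1 b2 b3 b4, (get R b0 b1 b2 b3 b4).testBit i = r b0 b1 b2 b3 b4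

theorem sel_eqTree (ones : ℕ) (b c : Bool) (φ : List Bool) (t s : MaskTree) :
    sel c (eqTree ones (b :: φ) t s) = eqTree ones φ (sel c t) (sel (b ^^ c) s) := by
  cases b <;> cases c <;> rfl

theorem get_eqTree (ones : ℕ) (R : MaskTree) (f0 f1 f2 f3 f4 b0 b1 b2 b3 b4 : Bool) :
    get (eqTree ones [f0, f1, f2, f3, f4] R R) b0 b1 b2 b3 b4 =
      eqMask ones (get R b0 b1 b2 b3 b4)
        (get R (f0 ^^ b0) (f1 ^^ b1) (f2 ^^ b2) (f3 ^^ b3) (f4 ^^ b4)) := by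
  simp only [MaskTree.get, sel_eqTree]
  rfl

theorem bit_eqTree_cons (ones : ℕ) (b : Bool) (φ : List Bool) (t s : MaskTree) (i : ℕ)
    (σ : ℕ → Bool) : bit i (eqTree ones (b :: φ) t s) σ =
      bit i (eqTree ones φ (sel (σ 0) t) (sel (b ^^ σ 0) s)) fun j => σ (j + 1) := by
  change (bif σ 0 then _ else _) = _
  cases h : σ 0 <;> cases b <;> rfl

theorem full_eqTree (ones : ℕ) (φ : List Bool) (t s : MaskTree) :
    Full φ.length (eqTree ones φ t s) := by
  induction φ generalizing t s with
  | nil => trivial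
  | cons b φ ih => exact ⟨ih _ _, ih _ _⟩

theorem testBit_eqMask {ones a b i : ℕ} (h : ones.testBit i = true) :
    (eqMask ones a b).testBit i = (a.testBit i == b.testBit i) := by
  change (ones ^^^ (a ^^^ b)).testBit i = _
  rw [Nat.testBit_xor, Nat.testBit_xor, h]
  cases a.testBit i <;> cases b.testBit i <;> rfl

theorem bit_eqTree {ones i : ℕ} (h : ones.testBit i = true) {R : MaskTree} {r : BoolRule}
    (hR : Represents R i r) (f0 f1 f2 f3 f4 b0 b1 b2 b3 b4 : Bool) :
    ∃ σ : ℕ → Bool, bit i (eqTree ones [f0, f1, f2, f3, f4] R R) σ =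
      (r b0 b1 b2 b3 b4 == r (f0 ^^ b0) (f1 ^^ b1) (f2 ^^ b2) (f3 ^^ b3) (f4 ^^ b4)) := by
  refine ⟨fun j => [b0, b1, b2, b3, b4].getD j false, ?_⟩
  simp only [bit_eqTree_cons]
  rw [← hR, ← hR, ← testBit_eqMask h]
  rfl

/-- The value of the cell with code `c`, initially `b`, when `σ` assigns values to the cells of
`o`. -/
def cellVal : List ℕ → (ℕ → Bool) → Bool → ℕ → Bool
  | [], _, b, _ => b
  | v :: o, σ, b, c => cellVal o (fun j => σ (j + 1)) (bif Nat.beq v c then σ 0 else b) c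

theorem bit_build_consPass (T : MaskTree) (ts : List Token) (b0 b1 b2 b3 b4 : Bool) (i : ℕ)
    (σ : ℕ → Bool) : bit i (build T (consPass ts) b0 b1 b2 b3 b4) σ =
      bit i (build T ts b0 b1 b2 b3 b4) fun j => σ (j + 1) := by
  cases ts <;> rfl

/-- Since the five codes are distinct, a cell fills at most one argument of the table. The induction
carries in `b0, …, b4` the values already assigned; an argument whose cell never occurs in `o` keeps
its initial constant. -/
theorem bit_build (T : MaskTree) (i : ℕ) {c0 c1 c2 c3 c4 : ℕ} (hc : [c0, c1, c2, c3, c4].Nodup)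
    (o : List ℕ) (σ : ℕ → Bool) (b0 b1 b2 b3 b4 : Bool) :
    bit i (build T (tokens c0 c1 c2 c3 c4 o) b0 b1 b2 b3 b4) σ =
      (get T (cellVal o σ b0 c0) (cellVal o σ b1 c1) (cellVal o σ b2 c2) (cellVal o σ b3 c3)
        (cellVal o σ b4 c4)).testBit i := by
  induction o generalizing σ b0 b1 b2 b3 b4 with
  | nil => rfl
  | cons v o ih =>
    change bit i (build T (consToken c0 c1 c2 c3 c4 v (tokens c0 c1 c2 c3 c4 o)) b0 b1 b2 b3 b4) σ
      = _
    have beq_false : ∀ {a b : ℕ}, a ≠ b → Nat.beq a b = false := fun {a b} hab =>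
      Bool.eq_false_iff.2 fun h => hab (Nat.eq_of_beq_eq_true h)
    have beq_self : ∀ a : ℕ, Nat.beq a a = true := fun a => by simp
    simp only [List.nodup_cons, List.mem_cons, not_or, List.not_mem_nil, not_false_eq_true,
      List.nodup_nil, and_true] at hc
    obtain ⟨⟨h01, h02, h03, h04⟩, ⟨h12, h13, h14⟩, ⟨h23, h24⟩, h34⟩ := hc
    simp only [cellVal]
    by_cases e0 : v = c0
    · subst e0
      simp only [consToken, beq_self, beq_false h01, beq_false h02, beq_false h03, beq_false h04,
        cond_true, cond_false, ← ih]
      cases h : σ 0 <;> simp [build, buildToken, bit, h]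
    by_cases e1 : v = c1
    · subst e1
      simp only [consToken, beq_self, beq_false e0, beq_false h12, beq_false h13, beq_false h14,
        cond_true, cond_false, ← ih]
      cases h : σ 0 <;> simp [build, buildToken, bit, h]
    by_cases e2 : v = c2
    · subst e2
      simp only [consToken, beq_self, beq_false e0, beq_false e1, beq_false h23, beq_false h24,
        cond_true, cond_false, ← ih]
      cases h : σ 0 <;> simp [build, buildToken, bit, h]
    by_cases e3 : v = c3
    · subst e3
      simp only [consToken, beq_self, beq_false e0, beq_false e1, beq_false e2, beq_false h34,
        cond_true, cond_false, ← ih]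
      cases h : σ 0 <;> simp [build, buildToken, bit, h]
    by_cases e4 : v = c4
    · subst e4
      simp only [consToken, beq_self, beq_false e0, beq_false e1, beq_false e2, beq_false e3,
        cond_true, cond_false, ← ih]
      cases h : σ 0 <;> simp [build, buildToken, bit, h]
    simp only [consToken, beq_false e0, beq_false e1, beq_false e2, beq_false e3, beq_false e4,
      cond_false, ← ih, bit_build_consPass]

theorem withBool_eq {α : Type} (f : Bool → α) (b : Bool) : withBool f b = f b := by
  cases b <;> rfl

theorem hasBit_eq (m v : ℕ) : hasBit m v = m.testBit v := by
  have : hasBit m v = Nat.beq ((m >>> v) &&& 1) 1 := rfl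
  rw [this, Nat.testBit, Nat.and_comm 1]
  rcases Nat.mod_two_eq_zero_or_one (m >>> v) with h | h <;> rw [Nat.and_one_is_mod, h] <;> rfl

theorem testBit_bitsOf {v : ℕ} {I : List ℕ} : (bitsOf I).testBit v = true ↔ v ∈ I := by
  induction I with
  | nil => simp [bitsOf]
  | cons i I ih =>
    have : bitsOf (i :: I) = 1 <<< i ||| bitsOf I := rfl
    rw [this, Nat.testBit_or, Bool.or_eq_true, ih, Nat.one_shiftLeft, Nat.testBit_two_pow,
      decide_eq_true_iff, List.mem_cons, eq_comm]

theorem mem_positionTrees (ones : ℕ) (R : MaskTree) (C : SiteCodes) (I J : ℕ) (o : List ℕ)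
    {ps : List ℕ} {p : ℕ} (h : p ∈ ps) :
    positionTree ones R C I J o p ∈ positionTrees ones R C I J o ps := by
  induction ps with
  | nil => simp at h
  | cons q ps ih =>
    change _ ∈ positionTree ones R C I J o q :: positionTrees ones R C I J o ps
    rcases List.mem_cons.1 h with rfl | h
    · exact List.mem_cons_self
    · exact List.mem_cons_of_mem _ (ih h)

/-- Code of a site, as an integer. -/
def siteCode (z : Site) : ℤ := z.1 + 16 * z.2

/-- The site is near the origin and has code `o - 34`. -/
def SiteCodes.Fits (o : ℕ) (u : Site) : Prop := siteCode u + 34 = o ∧ -2 ≤ u.1 ∧ u.1 ≤ 2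

instance (o : ℕ) (u : Site) : Decidable (SiteCodes.Fits o u) := by
  unfold SiteCodes.Fits; infer_instance

structure SiteCodes.FitsAll (C : SiteCodes) (S : Stencil) : Prop where
  h0 : Fits C.o0 S.u0
  h1 : Fits C.o1 S.u1
  h2 : Fits C.o2 S.u2
  h3 : Fits C.o3 S.u3
  h4 : Fits C.o4 S.u4
  nodup : [C.o0, C.o1, C.o2, C.o3, C.o4].Nodup

/-- The plan has a nonempty difference set, well inside the strip where codes are faithful, and
lists all positions whose neighbourhood meets it. -/
def Plan.Ok (pl : Plan) (C : SiteCodes) : Prop :=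
  pl.I ≠ [] ∧ ∀ i ∈ pl.I, 4 ≤ i % 16 ∧ i % 16 < 12 ∧
    ∀ o ∈ [C.o0, C.o1, C.o2, C.o3, C.o4], o ≤ i ∧ i - o ∈ pl.ps

instance (pl : Plan) (C : SiteCodes) : Decidable (pl.Ok C) := by
  unfold Plan.Ok; infer_instance

/-- The sites of the strip `0 ≤ x < 16` with codes in `I`. -/
def codedSet (I : List ℕ) : Set Site :=
  {z | 0 ≤ z.1 ∧ z.1 < 16 ∧ ∃ i ∈ I, siteCode z = (i : ℕ)}

theorem finite_codedSet (I : List ℕ) : (codedSet I).Finite := by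
  refine (I.toFinset.finite_toSet.image fun i : ℕ => (((i % 16 : ℕ) : ℤ), ((i / 16 : ℕ) : ℤ))).subset
    fun z ⟨h0, h1, i, hi, h⟩ => ⟨i, by simpa using hi, ?_⟩
  unfold siteCode at h
  ext <;> simp only <;> omega

/-- Codes determine sites only within 16 consecutive columns. Two sites of one neighbourhood are at
most 4 columns apart and difference cells lie in columns 4 to 11, so a position that meets the
difference set sees columns 0 to 15 only. -/
theorem mem_codedSet_of_fits {I : List ℕ} {C : SiteCodes} {pl : Plan} (hpl : pl.Ok C)
    (hI : pl.I = I) {o o' p : ℕ} {u u' y : Site} (hu : SiteCodes.Fits o u)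
    (hu' : SiteCodes.Fits o' u') (hx : y + u ∈ codedSet I) (hp : siteCode y = (p : ℤ) + 34) :
    y + u' ∈ codedSet I ↔ p + o' ∈ I := by
  subst hI
  obtain ⟨h0, h1, i, hi, h⟩ := hx
  obtain ⟨h2, h3, -⟩ := hpl.2 i hi
  obtain ⟨e, a1, a2⟩ := hu
  obtain ⟨e', a1', a2'⟩ := hu'
  simp only [siteCode, Prod.fst_add, Prod.snd_add] at *
  constructor
  · rintro ⟨-, -, j, hj, hj'⟩
    simp only [siteCode, Prod.fst_add, Prod.snd_add] at hj'
    have : p + o' = j := by omega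
    rwa [this]
  · intro hm
    refine ⟨?_, ?_, p + o', hm, ?_⟩ <;>
      simp only [siteCode, Prod.fst_add, Prod.snd_add] <;> push_cast <;> omega

theorem cells_eq_of_bit {ones i : ℕ} (hi : ones.testBit i = true) {R : MaskTree} {r : BoolRule}
    (hR : Represents R i r) {C : SiteCodes} {S : Stencil} (hC : C.FitsAll S) {I J : ℕ} {o : List ℕ}
    {p : ℕ} {σ : ℕ → Bool} (h : bit i (positionTree ones R C I J o p) σ = true) :
    let v := fun c => cellVal o σ (J.testBit c) c
    let w := fun c => I.testBit c ^^ v c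
    r (v (p + C.o0)) (v (p + C.o1)) (v (p + C.o2)) (v (p + C.o3)) (v (p + C.o4)) =
      r (w (p + C.o0)) (w (p + C.o1)) (w (p + C.o2)) (w (p + C.o3)) (w (p + C.o4)) := by
  obtain ⟨o0, o1, o2, o3, o4⟩ := C
  have hn : [p + o0, p + o1, p + o2, p + o3, p + o4].Nodup :=
    (List.nodup_map_iff (f := fun x => p + x) (fun _ _ h => Nat.add_left_cancel h)).2 hC.nodup
  have h' : bit i (cellsTree ones R I J o (p + o0) (p + o1) (p + o2) (p + o3) (p + o4)) σ =
    true := h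
  simp only [cellsTree, withBool_eq, hasBit_eq] at h'
  rw [bit_build _ _ hn, get_eqTree, testBit_eqMask hi, hR, hR, beq_iff_eq] at h'
  exact h'

/-- A set bit means that after elimination all constraints are satisfiable; running the elimination
backwards gives values of the free cells. The constraint at a position says that the rule does not
notice the change on the difference set. Positions that do not meet this set are unaffected in any
case. -/
theorem erasable_of_planMask {ones i : ℕ} (hi : ones.testBit i = true) {R : MaskTree}
    {r : BoolRule} (hR : Represents R i r) {C : SiteCodes} {S : Stencil} (hC : C.FitsAll S)
    {pl : Plan} (hpl : pl.Ok C) {K J : ℕ}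
    (h : (planMask ones R C pl K J).testBit i = true) :
    Erasable S r := by
  obtain ⟨I, o', ps⟩ := pl
  set o := freeCells o' K with ho
  obtain ⟨σ, hσ⟩ := exists_of_elimVars o
    (positionTrees ones R C (bitsOf I) (trueCells o' J) o ps) (bit_of_landVals _ _ h)
  set v : ℕ → Bool := fun c => cellVal o σ ((trueCells o' J).testBit c) c with hv
  classical
  -- The first configuration depends on a site only through its code, so it may repeat far away. The
  -- second one differs from it only at the sites of the strip coded by `I`, which makes the
  -- difference finite.
  let s : Site → Bool := fun z => v (siteCode z).toNat
  let s' : Site → Bool := fun z => decide (z ∈ codedSet I) ^^ s z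
  have hdiff : {z | s z ≠ s' z} = codedSet I := by
    ext z
    by_cases hz : z ∈ codedSet I <;> simp [s', hz]
  refine ⟨s, s', ?_, hdiff ▸ finite_codedSet I, fun y => ?_⟩
  · intro hss
    obtain ⟨j, hj⟩ := List.exists_mem_of_ne_nil _ hpl.1
    have : ((((j % 16 : ℕ) : ℤ), ((j / 16 : ℕ) : ℤ)) : Site) ∈ codedSet I := by
      refine ⟨by simp only; omega, by simp only; omega, j, hj, ?_⟩
      simp only [siteCode]; omega
    rw [← hdiff] at this
    exact this (congrFun hss _)
  · by_cases hy : ∃ u ∈ [S.u0, S.u1, S.u2, S.u3, S.u4], y + u ∈ codedSet I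
    · have key : ∃ o u, SiteCodes.Fits o u ∧ o ∈ [C.o0, C.o1, C.o2, C.o3, C.o4] ∧
          y + u ∈ codedSet I := by
        obtain ⟨u, hu, hyu⟩ := hy
        simp only [List.mem_cons, List.not_mem_nil, or_false] at hu
        rcases hu with rfl | rfl | rfl | rfl | rfl
        exacts [⟨_, _, hC.h0, by simp, hyu⟩, ⟨_, _, hC.h1, by simp, hyu⟩,
          ⟨_, _, hC.h2, by simp, hyu⟩, ⟨_, _, hC.h3, by simp, hyu⟩, ⟨_, _, hC.h4, by simp, hyu⟩]
      obtain ⟨q, u, hqu, hq, hyu⟩ := key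
      obtain ⟨-, -, j, hj, hju⟩ := id hyu
      obtain ⟨hle, hps⟩ := (hpl.2 j hj).2.2 q hq
      -- Offsets are coded with `34 = 2 + 16 * 2` added. With the position `y` coded as `siteCode y
      -- - 34`, adding the codes of position and offset gives the code of the cell.
      obtain ⟨p, hp⟩ : ∃ p, p = j - q := ⟨_, rfl⟩
      have hyp : siteCode y = (p : ℤ) + 34 := by
        have := hqu.1
        simp only [siteCode, Prod.fst_add, Prod.snd_add] at *
        omega
      have hbit := hσ _ (mem_positionTrees ones R C (bitsOf I) (trueCells o' J) o (hp ▸ hps))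
      have hcell : ∀ {o' u'}, SiteCodes.Fits o' u' → s (y + u') = v (p + o') ∧
          s' (y + u') = ((bitsOf I).testBit (p + o') ^^ v (p + o')) := by
        intro o' u' hu'
        have e : s (y + u') = v (p + o') := by
          have h1 := hu'.1
          have : (siteCode (y + u')).toNat = p + o' := by
            simp only [siteCode, Prod.fst_add, Prod.snd_add] at *
            omega
          simp only [s, this]
        refine ⟨e, ?_⟩
        simp only [s', e]
        congr 1
        rw [Bool.eq_iff_iff, decide_eq_true_iff, testBit_bitsOf]
        exact mem_codedSet_of_fits hpl rfl hqu hu' hyu hyp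
      rw [(hcell hC.h0).1, (hcell hC.h1).1, (hcell hC.h2).1, (hcell hC.h3).1, (hcell hC.h4).1,
        (hcell hC.h0).2, (hcell hC.h1).2, (hcell hC.h2).2, (hcell hC.h3).2, (hcell hC.h4).2]
      exact cells_eq_of_bit hi hR hC hbit
    · have : ∀ u ∈ [S.u0, S.u1, S.u2, S.u3, S.u4], s' (y + u) = s (y + u) := fun u hu => by
        have : y + u ∉ codedSet I := fun h => hy ⟨u, hu, h⟩
        simp [s', this]
      simp only [List.mem_cons, List.not_mem_nil, or_false, forall_eq_or_imp, forall_eq] at this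
      simp only [this]

/-! ### Families of rules -/

/-- How a value of a rule is given in a family: it is `false`, it is free, or it is the same as, or
the negation of, the value given `d + 1` entries before. -/
inductive Entry where
  | zero | free | same (d : ℕ) | neg (d : ℕ)

def Entry.Holds (acc : List Bool) (v : Bool) : Entry → Prop
  | zero => v = false
  | free => True
  | same d => v = acc.getD d false
  | neg d => v = !acc.getD d false

/-- The list of values `vs`, continuing the values `acc` (latest first), belongs to the family. -/
def Member : List Entry → List Bool → List Bool → Prop
  | [], _, vs => vs = []
  | _ :: _, _, [] => False
  | e :: es, acc, v :: vs => e.Holds acc v ∧ Member es (v :: acc) vs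

def freeVals : List Entry → List Bool → List Bool
  | .free :: es, v :: vs => v :: freeVals es vs
  | _ :: es, _ :: vs => freeVals es vs
  | _, _ => []

/-- The mask of the numbers below `2 ^ 2 ^ k` with bit `m` set. -/
noncomputable def varMask (m k : ℕ) : ℕ :=
  Nat.rec 0 (fun j ih => Bool.rec (Nat.lor ih (Nat.shiftLeft ih (2 ^ j)))
    (Nat.shiftLeft (2 ^ 2 ^ j - 1) (2 ^ j)) (Nat.beq j m)) k

/-- The counter `v` is the number of free entries met so far. The free entry number `v` gets the
mask of those rule numbers whose binary digit `v` is one; masks are accumulated latest first. -/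
noncomputable def entryMasks (k ones : ℕ) (es : List Entry) : List ℕ → ℕ → List ℕ :=
  List.rec (fun acc _ => acc)
    (fun e _ ih acc v => Entry.rec (ih (0 :: acc) v) (ih (varMask v k :: acc) (v + 1))
      (fun d => ih (acc.getD d 0 :: acc) v) (fun d => ih (Nat.xor ones (acc.getD d 0) :: acc) v) e)
    es

noncomputable def numFree (es : List Entry) : ℕ :=
  List.rec 0 (fun e _ ih => Entry.rec ih (ih + 1) (fun _ => ih) (fun _ => ih) e) es

/-- The masks come latest first, so the value with number `x` stands at place `31 - x`; therefore
the `false` branch takes the odd index. -/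
noncomputable def fullTree (M : List ℕ) (d : ℕ) : ℕ → MaskTree :=
  Nat.rec (fun n => leaf (M.getD n 0)) (fun _ ih n => node (ih (2 * n + 1)) (ih (2 * n))) d

noncomputable def familyTree (k ones : ℕ) (es : List Entry) : MaskTree :=
  fullTree (entryMasks k ones es [] 0) 5 0

def BoolRule.values (r : BoolRule) : List Bool :=
  (List.range 32).map fun x =>
    r (x.testBit 4) (x.testBit 3) (x.testBit 2) (x.testBit 1) (x.testBit 0)

theorem varMask_succ (m k : ℕ) : varMask m (k + 1) =
    if k = m then (2 ^ 2 ^ k - 1) <<< (2 ^ k) else varMask m k ||| varMask m k <<< (2 ^ k) := by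
  have : varMask m (k + 1) = Bool.rec (Nat.lor (varMask m k) (Nat.shiftLeft (varMask m k) (2 ^ k)))
    (Nat.shiftLeft (2 ^ 2 ^ k - 1) (2 ^ k)) (Nat.beq k m) := rfl
  rw [this]
  split_ifs with h
  · subst h
    rw [show Nat.beq k k = true by simp]
    rfl
  · rw [show Nat.beq k m = false from Bool.eq_false_iff.2 fun e => h (Nat.eq_of_beq_eq_true e)]
    rfl

theorem varMask_lt (m k : ℕ) : varMask m k < 2 ^ 2 ^ k := by
  induction k with
  | zero => simp [varMask]
  | succ k ih =>
    have e : 2 ^ (k + 1) = 2 ^ k + 2 ^ k := by ring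
    rw [varMask_succ, e]
    split_ifs
    · rw [Nat.shiftLeft_eq, pow_add]
      have : 0 < 2 ^ 2 ^ k := by positivity
      gcongr
      omega
    · refine Nat.or_lt_two_pow (ih.trans_le (Nat.pow_le_pow_right (by norm_num) (Nat.le_add_right _ _))) ?_
      rw [Nat.shiftLeft_eq, pow_add]
      gcongr

/-- Digit `k` of `i` decides between the lower and the upper half of the `2 ^ (k + 1)` places. For
`k = m` exactly the upper half is filled; for later `k` the two halves are copies of each other. -/
theorem testBit_varMask {m k i : ℕ} (hm : m < k) (hi : i < 2 ^ k) :
    (varMask m k).testBit i = i.testBit m := by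
  induction k generalizing i with
  | zero => omega
  | succ k ih =>
    have e : 2 ^ (k + 1) = 2 ^ k + 2 ^ k := by ring
    rw [varMask_succ]
    rcases lt_or_ge i (2 ^ k) with h | h
    · split_ifs with hk
      · subst hk
        rw [Nat.testBit_shiftLeft, Nat.testBit_lt_two_pow h]
        simp [h]
      · rw [Nat.testBit_or, ih (by omega) h, Nat.testBit_shiftLeft]
        simp [h]
    · obtain ⟨j, rfl⟩ := Nat.exists_eq_add_of_le h
      split_ifs with hk
      · subst hk
        rw [Nat.testBit_shiftLeft, Nat.testBit_two_pow_sub_one, Nat.testBit_two_pow_add_eq,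
          Nat.testBit_lt_two_pow (show j < 2 ^ k by omega)]
        simp; omega
      · rw [Nat.testBit_or, Nat.testBit_shiftLeft, Nat.testBit_two_pow_add_gt (by omega),
          Nat.add_sub_cancel_left, ih (by omega) (show j < 2 ^ k by omega),
          Nat.testBit_lt_two_pow ((varMask_lt m k).trans_le
            (Nat.pow_le_pow_right (by norm_num) h))]
        simp

theorem testBit_getD_cons {i m : ℕ} {b : Bool} {acc : List ℕ} {accB : List Bool}
    (hacc : ∀ n, (acc.getD n 0).testBit i = accB.getD n false) (h : m.testBit i = b) (n : ℕ) :
    ((m :: acc).getD n 0).testBit i = (b :: accB).getD n false := by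
  cases n with
  | zero => exact h
  | succ n => exact hacc n

/-- Invariant of the accumulation: bit `i` of the masks in `acc` spells the values in `accB`, and
the digits of `i` from place `v` on spell the free values still to come. -/
theorem testBit_entryMasks {k ones i : ℕ} (hi : i < 2 ^ k) (ho : ones.testBit i = true)
    (es : List Entry) (vs : List Bool) (acc : List ℕ) (accB : List Bool) (v : ℕ)
    (hm : Member es accB vs) (hacc : ∀ n, (acc.getD n 0).testBit i = accB.getD n false)
    (hfree : ∀ j, v + j < k → i.testBit (v + j) = (freeVals es vs).getD j false)
    (hk : v + numFree es ≤ k) (n : ℕ) :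
    ((entryMasks k ones es acc v).getD n 0).testBit i =
      (vs.reverse ++ accB).getD n false := by
  induction es generalizing vs acc accB v with
  | nil =>
    rw [show vs = [] from hm]
    exact hacc n
  | cons e es ih =>
    cases vs with
    | nil => exact hm.elim
    | cons b vs =>
      obtain ⟨hb, hm⟩ := hm
      rw [List.reverse_cons, List.append_assoc, List.singleton_append]
      cases e with
      | zero =>
        have hb : b = false := hb
        exact ih vs (0 :: acc) (b :: accB) v hm (testBit_getD_cons hacc (by simp [hb])) hfree hk
      | free =>
        have hk' : v + (numFree es + 1) ≤ k := hk
        refine ih vs (varMask v k :: acc) (b :: accB) (v + 1) hm (testBit_getD_cons hacc ?_)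
          (fun j hj => ?_) (by omega)
        · rw [testBit_varMask (by omega) hi]
          exact hfree 0 (by omega)
        · have := hfree (j + 1) (by omega)
          rwa [show v + 1 + j = v + (j + 1) by omega]
      | same d =>
        have hb : b = accB.getD d false := hb
        exact ih vs (acc.getD d 0 :: acc) (b :: accB) v hm
          (testBit_getD_cons hacc (by rw [hacc, hb])) hfree hk
      | neg d =>
        have hb : b = !accB.getD d false := hb
        refine ih vs (Nat.xor ones (acc.getD d 0) :: acc) (b :: accB) v hm
          (testBit_getD_cons hacc ?_) hfree hk
        change (ones ^^^ acc.getD d 0).testBit i = b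
        rw [Nat.testBit_xor, ho, hacc, hb, Bool.true_xor]

/-- The number of a rule in its family is the number whose binary digits are the free values of the
rule. -/
theorem exists_represents {k : ℕ} {es : List Entry} {r : BoolRule} (hm : Member es [] r.values)
    (hk : numFree es ≤ k) : ∃ i, (2 ^ 2 ^ k - 1).testBit i = true ∧
      Represents (familyTree k (2 ^ 2 ^ k - 1) es) i r := by
  let i := Nat.ofBits fun j : Fin k => (freeVals es r.values).getD j false
  have hi : i < 2 ^ k := Nat.ofBits_lt_two_pow _
  have ho : (2 ^ 2 ^ k - 1).testBit i = true := by
    rw [Nat.testBit_two_pow_sub_one, decide_eq_true hi]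
  refine ⟨i, ho, ?_⟩
  have key := testBit_entryMasks hi ho es r.values [] [] 0 hm (fun n => by simp)
    (fun j hj => by
      rw [Nat.zero_add] at hj ⊢
      exact Nat.testBit_ofBits_lt _ _ hj) (by omega)
  have hv : r.values.reverse ++ [] = (List.range 32).reverse.map fun x =>
      r (x.testBit 4) (x.testBit 3) (x.testBit 2) (x.testBit 1) (x.testBit 0) := by
    simp [BoolRule.values]
  rw [hv] at key
  intro b0 b1 b2 b3 b4
  cases b0 <;> cases b1 <;> cases b2 <;> cases b3 <;> cases b4 <;> exact key _

/-! ### The check -/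

/-- The indicator list of `j`. -/
noncomputable def siteBits (j : ℕ) : List Bool :=
  [Nat.beq j 0, Nat.beq j 1, Nat.beq j 2, Nat.beq j 3, Nat.beq j 4]

/-- The mask of the rules that depend on the arguments in `D` and are not permutive in those
in `P`. -/
noncomputable def candidates (ones : ℕ) (R : MaskTree) (D P : List ℕ) : ℕ :=
  List.rec (List.rec ones
    (fun j _ ih => Nat.land ih (Nat.xor ones (allLand (eqTree ones (siteBits j) R R)))) D)
    (fun j _ ih => Nat.land ih (allLor (eqTree ones (siteBits j) R R))) P

noncomputable def pickMask (ones : ℕ) (R : MaskTree) (C : SiteCodes) (K J : ℕ) (o : Option Plan) :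
    ℕ :=
  Option.rec 0 (fun pl => planMask ones R C pl K J) o

/-- An index of a plan, with the two numbers that say which cells are kept constant. -/
structure Hint where
  (n K J : ℕ)

noncomputable def hintMask (ones : ℕ) (R : MaskTree) (C : SiteCodes) (plans : List Plan) (h : Hint) :
    ℕ :=
  Hint.rec (fun n K J => pickMask ones R C K J plans[n]?) h

/-- The candidates for which none of the hints works. -/
noncomputable def survivors (ones : ℕ) (R : MaskTree) (C : SiteCodes) (D P : List ℕ)
    (plans : List Plan) (hs : List Hint) : ℕ :=
  List.rec (candidates ones R D P)
    (fun h _ ih => Nat.land ih (Nat.xor ones (hintMask ones R C plans h))) hs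

/-- All rules of a family are erasable, by the hints `hs`, unless some argument
in `D` is irrelevant or some argument in `P` is permutive. -/
noncomputable def checkFamily (k : ℕ) (C : SiteCodes) (D P : List ℕ) (plans : List Plan)
    (es : List Entry) (hs : List Hint) : Bool :=
  (Nat.ble (numFree es) k).and
    (Nat.beq (survivors (2 ^ 2 ^ k - 1) (familyTree k (2 ^ 2 ^ k - 1) es) C D P plans hs) 0)

def Covered (S : Stencil) (D P : List ℕ) (es : List Entry) : Prop :=
  ∀ r : BoolRule, Member es [] r.values → ErasableIf S D P r

/-- For the table comparing the values before and after negation of argument `j`, dependence means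
that the conjunction of the leaves fails, and lack of permutivity that their disjunction holds. -/
theorem testBit_candidates {ones i : ℕ} (ho : ones.testBit i = true) {R : MaskTree}
    {r : BoolRule} (hR : Represents R i r) {D P : List ℕ} (hD : ∀ j ∈ D, r.DependsAt j)
    (hP : ∀ j ∈ P, r.FlatAt j) : (candidates ones R D P).testBit i = true := by
  induction P with
  | nil =>
    clear hP
    induction D with
    | nil => exact ho
    | cons j D ih =>
      change (candidates ones R D [] &&& (ones ^^^ allLand (eqTree ones (siteBits j) R R))).testBit i
        = true
      rw [Nat.testBit_and, Nat.testBit_xor, ih fun j hj => hD j (List.mem_cons_of_mem _ hj), ho,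
        Bool.true_and, Bool.true_xor]
      obtain ⟨b0, b1, b2, b3, b4, h⟩ := hD j List.mem_cons_self
      obtain ⟨σ, hσ⟩ := bit_eqTree ho hR (Nat.beq j 0) (Nat.beq j 1) (Nat.beq j 2) (Nat.beq j 3)
        (Nat.beq j 4) b0 b1 b2 b3 b4
      rw [bit_of_allLand (full_eqTree _ _ _ _) (σ := σ)]
      · rfl
      · rw [siteBits, hσ]
        exact beq_false_of_ne h
  | cons j P ih =>
    change (candidates ones R D P &&& allLor (eqTree ones (siteBits j) R R)).testBit i = true
    rw [Nat.testBit_and, ih fun j hj => hP j (List.mem_cons_of_mem _ hj), Bool.true_and]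
    obtain ⟨b0, b1, b2, b3, b4, h⟩ := hP j List.mem_cons_self
    obtain ⟨σ, hσ⟩ := bit_eqTree ho hR (Nat.beq j 0) (Nat.beq j 1) (Nat.beq j 2) (Nat.beq j 3)
      (Nat.beq j 4) b0 b1 b2 b3 b4
    refine bit_of_allLor (full_eqTree _ _ _ _) (σ := σ) ?_
    rw [siteBits, hσ]
    exact beq_iff_eq.2 h

theorem erasable_of_testBit_survivors {ones i : ℕ} (ho : ones.testBit i = true) {R : MaskTree}
    {r : BoolRule} (hR : Represents R i r) {C : SiteCodes} {S : Stencil} (hC : C.FitsAll S)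
    {D P : List ℕ} {plans : List Plan} (hpl : ∀ pl ∈ plans, pl.Ok C)
    (hD : ∀ j ∈ D, r.DependsAt j) (hP : ∀ j ∈ P, r.FlatAt j) (hs : List Hint)
    (h : (survivors ones R C D P plans hs).testBit i = false) : Erasable S r := by
  induction hs with
  | nil => exact absurd h (by rw [show survivors ones R C D P plans [] = candidates ones R D P
      from rfl, testBit_candidates ho hR hD hP]; decide)
  | cons q hs ih =>
    by_cases h' : (survivors ones R C D P plans hs).testBit i = false
    · exact ih h'
    · change (survivors ones R C D P plans hs &&&
        (ones ^^^ hintMask ones R C plans q)).testBit i = false at h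
      rw [Nat.testBit_and, Bool.eq_true_of_not_eq_false h', Bool.true_and, Nat.testBit_xor, ho,
        Bool.true_xor, Bool.not_eq_false'] at h
      obtain ⟨n, K, J⟩ := q
      change (pickMask ones R C K J plans[n]?).testBit i = true at h
      cases hq : plans[n]? with
      | none =>
        rw [hq] at h
        exact absurd h (by simp [pickMask])
      | some pl =>
        rw [hq] at h
        exact erasable_of_planMask ho hR hC (hpl pl (List.mem_of_getElem? hq)) h

theorem covered_of_checkFamily {k : ℕ} {C : SiteCodes} {S : Stencil} (hC : C.FitsAll S)
    {D P : List ℕ} {plans : List Plan} (hpl : ∀ pl ∈ plans, pl.Ok C) {es : List Entry}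
    {hs : List Hint} (h : checkFamily k C D P plans es hs = true) : Covered S D P es := by
  intro r hr hD hP
  obtain ⟨h1, h2⟩ := (Bool.and_eq_true _ _).mp h
  obtain ⟨i, ho, hR⟩ := exists_represents hr (Nat.le_of_ble_eq_true h1)
  refine erasable_of_testBit_survivors ho hR hC hpl hD hP hs ?_
  rw [Nat.eq_of_beq_eq_true h2, Nat.zero_testBit]

theorem Member.refine {es : List Entry} {acc vs : List Bool} (h : Member es acc vs) (n d : ℕ)
    (hn : es[n]? = some .free) :
    Member (es.set n (.same d)) acc vs ∨ Member (es.set n (.neg d)) acc vs := by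
  induction es generalizing acc vs n with
  | nil => simp at hn
  | cons e es ih =>
    cases vs with
    | nil => exact h.elim
    | cons v vs =>
      cases n with
      | zero =>
        rcases Bool.eq_or_eq_not v (acc.getD d false) with hv | hv
        · exact .inl ⟨hv, h.2⟩
        · exact .inr ⟨hv, h.2⟩
      | succ n =>
        rcases ih h.2 n (by simpa using hn) with h' | h'
        · exact .inl ⟨h.1, h'⟩
        · exact .inr ⟨h.1, h'⟩

/-- Over two symbols a free value equals a given earlier value or its negation. Each such split
saves one free value and so halves the length of the masks. -/
theorem Covered.of_refine {S : Stencil} {D P : List ℕ} {es : List Entry} (n d : ℕ)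
    (hn : es[n]? = some .free) (h : Covered S D P (es.set n (.same d)))
    (h' : Covered S D P (es.set n (.neg d))) : Covered S D P es := fun r hr =>
  (hr.refine n d hn).elim (h r) (h' r)

/-! ### Certificates for the 2×2 block -/

set_option maxRecDepth 100000

/-- Arguments 1 to 4 are the east, west, north and south arms of a cross centred at the odd site `(1
+ p - q, p + q)`, in the coordinates `(p, q)` of the even sites `(p - q, p + q)`; they form a 2×2
square. Argument 0 is a dummy, placed at a site distinct from the others. -/
def blockStencil : Stencil := ⟨(0, 1), (1, -1), (0, 0), (1, 0), (0, -1)⟩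

def blockCodes : SiteCodes := ⟨50, 19, 34, 35, 18⟩

theorem blockCodes_fitsAll : blockCodes.FitsAll blockStencil := by
  constructor <;> decide

/-- Difference sets are placed around the cell with code `85 = 5 + 16 * 5`, the site `(5, 5)`. The
order of the cells only affects the size of the intermediate trees. -/
def blockPlans : List Plan := [
  ⟨[85], [53, 54, 116, 117, 102, 68, 70, 86, 84, 100, 101, 85, 69], [50, 66, 35, 51, 67]⟩, ⟨[85,
  101], [53, 54, 132, 68, 118, 133, 102, 70, 86, 117, 101, 116, 69, 85, 84, 100], [50, 66, 82, 35,
  51, 67, 83]⟩, ⟨[85, 86], [55, 117, 53, 103, 118, 116, 68, 84, 100, 87, 71, 102, 86, 54, 70, 101,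
  85, 69], [50, 66, 35, 51, 67, 36, 52, 68]⟩, ⟨[85, 101, 86, 102], [55, 53, 133, 134, 119, 68,
  132, 103, 116, 118, 100, 84, 54, 71, 70, 87, 86, 102, 69, 101, 117, 85], [50, 66, 82, 35, 51,
  67, 83, 36, 52, 68, 84]⟩, ⟨[101, 86, 102], [69, 55, 54, 132, 133, 119, 134, 84, 103, 100, 116,
  71, 87, 70, 118, 102, 86, 85, 117, 101], [66, 82, 51, 67, 83, 36, 52, 68, 84]⟩, ⟨[85, 101, 102],
  [134, 119, 132, 54, 53, 133, 68, 71, 103, 87, 84, 116, 100, 118, 102, 117, 101, 86, 85, 70, 69],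
  [50, 66, 82, 35, 51, 67, 83, 52, 68, 84]⟩, ⟨[85, 101, 86], [53, 103, 133, 55, 132, 68, 116, 54,
  100, 84, 118, 71, 70, 87, 86, 102, 101, 85, 117, 69], [50, 66, 82, 35, 51, 67, 83, 36, 52, 68]⟩,
  ⟨[85, 86, 102], [53, 116, 55, 68, 119, 134, 133, 84, 100, 103, 54, 117, 87, 118, 102, 71, 70,
  86, 101, 85, 69], [50, 66, 35, 51, 67, 83, 36, 52, 68, 84]⟩]

theorem blockPlans_ok : ∀ pl ∈ blockPlans, pl.Ok blockCodes := by
  decide +kernel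

abbrev blockCovered : List Entry → Prop :=
  Covered blockStencil [] [1, 2, 3, 4]

theorem blockCovered_of_check {es : List Entry} {hs : List Hint}
    (h : checkFamily 15 blockCodes [] [1, 2, 3, 4] blockPlans es hs = true) :
    blockCovered es :=
  covered_of_checkFamily blockCodes_fitsAll blockPlans_ok h

/-- All rules with `r 0 0 = 0` that ignore the dummy argument: the second half of the table repeats
the first. -/
def blockFamily : List Entry :=
  .zero :: List.replicate 15 .free ++ List.replicate 16 (.same 15)

/-- On the block all four sites are extremal, and lack of permutivity at each of them is enough for
erasability, without any hypothesis of dependence. -/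
theorem blockCovered_blockFamily : blockCovered blockFamily :=
  blockCovered_of_check (hs := [
    ⟨0, 2063, 2048⟩, ⟨1, 13351, 4097⟩, ⟨2, 77879, 4102⟩, ⟨1, 13351, 8197⟩, ⟨2, 77879, 77857⟩, ⟨1,
    46639, 38414⟩, ⟨3, 2625615, 2625546⟩, ⟨4, 622815, 32967⟩, ⟨1, 30391, 12417⟩, ⟨5, 934077,
    540852⟩, ⟨6, 214173, 132097⟩, ⟨7, 803943, 16453⟩, ⟨3, 2764879, 655431⟩, ⟨5, 2097151, 2036188⟩])
    (by decide +kernel)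

/-! ### Certificates for the corner -/

def cornerStencil : Stencil := ⟨(0, 0), (1, 0), (2, 0), (0, 1), (0, 2)⟩

def cornerCodes : SiteCodes := ⟨34, 35, 36, 50, 66⟩

theorem cornerCodes_fitsAll : cornerCodes.FitsAll cornerStencil := by
  constructor <;> decide

def cornerPlans : List Plan := [
  ⟨[85], [115, 83, 99, 116, 100, 84, 53, 55, 54, 71, 70, 69, 87, 117, 86, 85, 101], [49, 50, 19,
  35, 51]⟩, ⟨[85, 86], [99, 83, 115, 117, 100, 116, 84, 56, 53, 88, 118, 72, 87, 54, 55, 102, 71,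
  101, 69, 70, 85, 86], [49, 50, 19, 35, 51, 20, 36, 52]⟩, ⟨[101, 86, 102], [99, 115, 131, 84, 88,
  72, 56, 55, 54, 69, 133, 132, 104, 134, 103, 118, 87, 117, 71, 70, 116, 100, 101, 85, 86, 102],
  [65, 50, 66, 35, 51, 67, 20, 36, 52, 68]⟩, ⟨[85, 101], [103, 133, 53, 55, 54, 83, 70, 71, 69,
  87, 132, 131, 117, 99, 115, 84, 100, 116, 86, 102, 85, 101], [49, 65, 50, 66, 19, 35, 51, 67]⟩,
  ⟨[101, 102, 87, 103], [135, 105, 57, 55, 56, 116, 132, 133, 89, 69, 131, 99, 115, 100, 73, 134,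
  104, 119, 118, 88, 72, 117, 85, 70, 103, 86, 102, 101, 71, 87], [65, 66, 35, 51, 67, 36, 52, 68,
  21, 37, 53, 69]⟩, ⟨[117, 102, 118, 87], [56, 57, 55, 100, 70, 150, 120, 149, 73, 148, 104, 147,
  115, 131, 85, 89, 134, 132, 116, 72, 71, 133, 88, 117, 101, 118, 119, 87, 86, 102, 103], [81,
  66, 82, 51, 67, 83, 36, 52, 68, 84, 21, 37, 53]⟩, ⟨[85, 117], [54, 55, 53, 149, 119, 102, 103,
  71, 70, 69, 147, 131, 83, 99, 148, 132, 87, 118, 133, 100, 115, 84, 116, 86, 117, 101, 85], [49,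
  81, 50, 82, 19, 35, 51, 67, 83]⟩, ⟨[85, 86, 118], [88, 149, 133, 150, 120, 104, 103, 134, 53,
  83, 115, 99, 72, 119, 132, 148, 100, 56, 84, 116, 54, 55, 69, 70, 71, 101, 85, 87, 86, 118, 117,
  102], [49, 50, 82, 19, 35, 51, 83, 20, 36, 52, 68, 84]⟩, ⟨[101, 102, 87], [57, 55, 56, 133, 131,
  115, 99, 134, 104, 69, 119, 89, 132, 116, 100, 73, 118, 88, 117, 72, 85, 70, 103, 86, 71, 87,
  101, 102], [65, 66, 35, 51, 67, 36, 52, 68, 21, 37, 53]⟩, ⟨[117, 102, 87, 103], [149, 57, 55,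
  56, 70, 147, 115, 131, 134, 135, 105, 148, 85, 89, 73, 100, 104, 132, 116, 72, 71, 133, 88, 86,
  87, 119, 103, 101, 117, 118, 102], [81, 66, 82, 51, 67, 83, 36, 52, 68, 21, 37, 53, 69]⟩, ⟨[85,
  86, 102], [72, 134, 104, 53, 115, 83, 99, 88, 132, 133, 56, 118, 84, 100, 116, 103, 117, 87, 54,
  55, 69, 70, 71, 102, 85, 101, 86], [49, 50, 66, 19, 35, 51, 67, 20, 36, 52, 68]⟩, ⟨[117, 118,
  103, 88], [115, 131, 147, 116, 132, 148, 85, 101, 117, 133, 149, 86, 102, 118, 134, 150, 71, 87,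
  103, 119, 135, 56, 72, 88, 104, 120, 57, 73, 89, 105, 58, 74, 90], [81, 82, 51, 67, 83, 52, 68,
  84, 37, 53, 69, 22, 38, 54]⟩, ⟨[117, 86, 118], [132, 148, 54, 56, 55, 71, 72, 70, 120, 150, 104,
  147, 131, 115, 88, 100, 84, 149, 134, 116, 119, 133, 103, 85, 101, 117, 87, 118, 102, 86], [81,
  50, 82, 51, 67, 83, 20, 36, 52, 68, 84]⟩, ⟨[117, 86, 102, 118], [147, 131, 115, 56, 55, 54, 84,
  148, 72, 71, 70, 149, 88, 120, 150, 104, 134, 119, 133, 103, 100, 87, 85, 86, 101, 102, 132,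
  118, 117, 116], [81, 50, 66, 82, 51, 67, 83, 20, 36, 52, 68, 84]⟩, ⟨[85, 101, 86, 102], [134,
  104, 56, 53, 88, 131, 72, 132, 133, 83, 103, 118, 55, 54, 69, 115, 99, 70, 71, 84, 116, 100,
  117, 87, 86, 85, 102, 101], [49, 65, 50, 66, 19, 35, 51, 67, 20, 36, 52, 68]⟩, ⟨[117, 118, 87,
  103], [89, 57, 56, 55, 115, 147, 131, 135, 105, 73, 72, 71, 150, 120, 85, 148, 132, 116, 149,
  104, 134, 88, 133, 101, 86, 119, 102, 87, 103, 117, 118], [81, 82, 51, 67, 83, 52, 68, 84, 21,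
  37, 53, 69]⟩, ⟨[117, 118, 87, 119], [89, 147, 115, 131, 105, 121, 151, 150, 149, 73, 72, 85, 55,
  57, 56, 71, 132, 148, 116, 135, 120, 134, 104, 101, 88, 86, 102, 133, 119, 118, 117, 87, 103],
  [81, 82, 51, 67, 83, 52, 68, 84, 21, 37, 53, 69, 85]⟩, ⟨[117, 118, 87, 103, 119], [55, 56, 57,
  150, 147, 131, 115, 132, 148, 116, 72, 73, 71, 121, 151, 105, 89, 85, 149, 135, 120, 104, 134,
  101, 88, 86, 87, 102, 103, 119, 133, 117, 118], [81, 82, 51, 67, 83, 52, 68, 84, 21, 37, 53, 69,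
  85]⟩, ⟨[117, 118, 87], [132, 148, 72, 73, 131, 115, 147, 116, 57, 55, 56, 71, 120, 150, 85, 149,
  104, 89, 134, 86, 133, 101, 102, 119, 88, 103, 87, 118, 117], [81, 82, 51, 67, 83, 52, 68, 84,
  21, 37, 53]⟩, ⟨[117, 86, 102], [104, 134, 115, 131, 147, 71, 72, 148, 119, 149, 56, 55, 54, 70,
  88, 84, 103, 133, 100, 87, 132, 85, 118, 101, 117, 116, 86, 102], [81, 50, 66, 82, 51, 67, 83,
  20, 36, 52, 68]⟩, ⟨[117, 86, 102, 118, 87], [147, 115, 131, 84, 89, 104, 149, 73, 57, 54, 148,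
  150, 120, 134, 56, 55, 70, 72, 71, 132, 85, 133, 88, 100, 116, 117, 101, 86, 87, 118, 103, 119,
  102], [81, 50, 66, 82, 51, 67, 83, 20, 36, 52, 68, 84, 21, 37, 53]⟩, ⟨[133, 118, 87, 103], [131,
  147, 163, 116, 132, 148, 164, 85, 101, 117, 133, 149, 165, 86, 102, 118, 134, 150, 55, 71, 87,
  103, 119, 135, 56, 72, 88, 104, 120, 57, 73, 89, 105], [97, 82, 98, 51, 67, 83, 99, 52, 68, 84,
  21, 37, 53, 69]⟩, ⟨[85, 87], [73, 72, 54, 53, 116, 100, 102, 118, 115, 99, 83, 84, 57, 56, 89,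
  119, 70, 88, 103, 117, 55, 69, 71, 101, 87, 86, 85], [49, 50, 19, 35, 51, 52, 21, 37, 53]⟩,
  ⟨[85, 101, 102], [88, 132, 83, 55, 53, 54, 134, 104, 133, 72, 131, 69, 118, 99, 115, 103, 117,
  87, 70, 71, 84, 100, 116, 102, 101, 86, 85], [49, 65, 50, 66, 19, 35, 51, 67, 36, 52, 68]⟩,
  ⟨[117, 87, 103], [148, 132, 149, 85, 56, 57, 55, 135, 105, 131, 115, 147, 116, 73, 72, 71, 134,
  89, 104, 88, 133, 101, 86, 119, 102, 117, 118, 103, 87], [81, 82, 51, 67, 83, 52, 68, 21, 37,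
  53, 69]⟩]

theorem cornerPlans_ok : ∀ pl ∈ cornerPlans, pl.Ok cornerCodes := by
  decide +kernel

/-- The extremal sites of the corner are its vertex and the ends of its two legs, arguments 0, 2 and
4. -/
abbrev cornerCovered : List Entry → Prop :=
  Covered cornerStencil [0, 1, 2, 3, 4] [0, 2, 4]

theorem cornerCovered_of_check {es : List Entry} {hs : List Hint}
    (h : checkFamily 20 cornerCodes [0, 1, 2, 3, 4] [0, 2, 4] cornerPlans es hs = true) :
    cornerCovered es :=
  covered_of_checkFamily cornerCodes_fitsAll cornerPlans_ok h

/-- `r c 0 0 d e ≠ r c 1 0 d e` -/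
def cornerFamilyBoth : List Entry := [
  .zero, .free, .free, .free, .free, .free, .free, .free, .neg 7, .neg 7, .neg 7, .neg 7, .free,
  .free, .free, .free, .free, .free, .free, .free, .free, .free, .free, .free, .neg 7, .neg 7,
  .neg 7, .neg 7, .free, .free, .free, .free]

/-- The family has 23 free values. The splits compare entries 1, 2 and 4 with entry 0, which is
`false`, so they simply fix these three values. -/
theorem cornerCovered_cornerFamilyBoth : cornerCovered cornerFamilyBoth :=
  .of_refine 1 0 rfl (.of_refine 2 1 rfl (.of_refine 4 3 rfl (cornerCovered_of_check (hs := [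
    ⟨0, 52679, 50432⟩, ⟨1, 4157825, 2097153⟩, ⟨2, 51119055, 33554432⟩, ⟨1, 4156391, 544⟩, ⟨0,
    126135, 93328⟩, ⟨1, 4059015, 8448⟩, ⟨3, 4095998, 1971808⟩, ⟨1, 3670015, 47857⟩])
    (by decide +kernel))
  (cornerCovered_of_check (hs := [
    ⟨0, 52674, 50434⟩, ⟨1, 4154292, 2097664⟩, ⟨0, 114818, 114816⟩, ⟨1, 3424560, 2097152⟩, ⟨2,
    57617392, 23200640⟩, ⟨3, 4083678, 3034624⟩, ⟨4, 869286718, 25165850⟩, ⟨3, 4194303, 1882274⟩,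
    ⟨1, 4194303, 88032⟩, ⟨2, 67108863, 17997446⟩]) (by decide +kernel)))
  (.of_refine 4 3 rfl (cornerCovered_of_check (hs := [
    ⟨0, 49479, 49408⟩, ⟨2, 46138248, 33554432⟩, ⟨1, 4120967, 163840⟩, ⟨3, 4024508, 786560⟩, ⟨2,
    46338543, 4256⟩, ⟨1, 3754782, 1640976⟩, ⟨3, 3959540, 1835716⟩, ⟨1, 3931095, 1704149⟩, ⟨5,
    1059765503, 536903745⟩, ⟨6, 133660591, 48461868⟩, ⟨7, 4227858431, 2587386130⟩, ⟨1, 4194303,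
    3357240⟩, ⟨1, 4194303, 2980036⟩, ⟨5, 1003026559, 134797337⟩, ⟨8, 268304383, 20037433⟩, ⟨9,
    2147483647, 721681269⟩]) (by decide +kernel))
  (cornerCovered_of_check (hs := [
    ⟨0, 49474, 49154⟩, ⟨2, 46599104, 33554432⟩, ⟨1, 3334577, 1212417⟩, ⟨0, 58242, 17280⟩, ⟨4,
    784351830, 134234114⟩, ⟨3, 4039446, 885250⟩, ⟨1, 3767217, 2165248⟩, ⟨2, 54657506, 37879842⟩,
    ⟨1, 3729208, 3671552⟩, ⟨3, 4157181, 3108561⟩, ⟨8, 263502695, 67143940⟩, ⟨10, 134216929,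
    50901025⟩, ⟨4, 746865528, 537150312⟩, ⟨8, 264207207, 119868260⟩, ⟨1, 4194303, 196329⟩, ⟨8,
    268435455, 106744895⟩, ⟨4, 432294782, 16793870⟩, ⟨5, 1591468031, 80762714⟩, ⟨4, 1073741823,
    338615943⟩, ⟨9, 2147483647, 807630390⟩, ⟨11, 8589934591, 7599627107⟩]) (by decide +kernel))))
  (.of_refine 2 1 rfl (.of_refine 4 3 rfl (cornerCovered_of_check (hs := [
    ⟨0, 50311, 49280⟩, ⟨0, 115983, 115712⟩, ⟨1, 3385606, 2105600⟩, ⟨2, 63456388, 46661760⟩, ⟨12,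
    971749376, 134348800⟩, ⟨3, 3992994, 2883968⟩, ⟨1, 3964935, 3964928⟩, ⟨2, 59445437, 9048192⟩,
    ⟨3, 1993706, 1966346⟩, ⟨1, 4059135, 1065184⟩, ⟨0, 120671, 18000⟩, ⟨13, 947523413, 134218752⟩,
    ⟨3, 4063229, 818449⟩, ⟨12, 803995004, 44668236⟩, ⟨1, 4194303, 2067169⟩, ⟨2, 67108863,
    10256596⟩, ⟨14, 268435455, 264399210⟩]) (by decide +kernel))
  (cornerCovered_of_check (hs := [
    ⟨0, 50305, 50305⟩, ⟨0, 50433, 49152⟩, ⟨1, 3351408, 2106112⟩, ⟨2, 63447170, 42467458⟩, ⟨1,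
    3231920, 2117760⟩, ⟨12, 1064833043, 33558528⟩, ⟨3, 1977282, 1976576⟩, ⟨1, 4112529, 4096017⟩,
    ⟨0, 58116, 25348⟩, ⟨2, 65477617, 14816128⟩, ⟨15, 1877597698, 1874905090⟩, ⟨16, 3837919744,
    536871424⟩, ⟨17, 771757440, 536875008⟩, ⟨1, 4194303, 1229700⟩, ⟨18, 525295887, 201474308⟩, ⟨4,
    534497279, 465667453⟩, ⟨16, 4159930327, 1682056658⟩, ⟨17, 1865940927, 220552476⟩])
    (by decide +kernel)))
  (.of_refine 4 3 rfl (cornerCovered_of_check (hs := [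
    ⟨0, 49287, 16512⟩, ⟨2, 37814409, 37748736⟩, ⟨0, 60815, 18441⟩, ⟨3, 3958944, 786560⟩, ⟨1,
    4176151, 3047440⟩, ⟨13, 156238407, 512⟩, ⟨1, 3949575, 3948544⟩, ⟨3, 4124410, 2884122⟩, ⟨2,
    47260859, 43058217⟩, ⟨6, 134217727, 93230652⟩, ⟨19, 267909119, 166814921⟩, ⟨20, 4294967295,
    1644211799⟩, ⟨9, 2147483647, 1775968426⟩, ⟨21, 8589934591, 8465915567⟩]) (by decide +kernel))
  (cornerCovered_of_check (hs := [
    ⟨0, 49794, 49794⟩, ⟨0, 50434, 49152⟩, ⟨2, 54528000, 20971520⟩, ⟨1, 3936289, 2883585⟩, ⟨15,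
    1904854018, 1342177282⟩, ⟨3, 4189808, 4163088⟩, ⟨17, 2348810368, 2147483648⟩, ⟨0, 65527,
    60821⟩, ⟨1, 4021424, 2971776⟩, ⟨3, 4189167, 2982415⟩, ⟨12, 785195471, 617349579⟩, ⟨2,
    66928630, 15214610⟩, ⟨17, 2225285516, 2214668300⟩, ⟨3, 4186063, 4120392⟩, ⟨1, 4194303,
    1422475⟩, ⟨19, 234342255, 14763014⟩, ⟨8, 201326583, 149046802⟩, ⟨18, 502005759, 501222800⟩,
    ⟨9, 2147483647, 942236355⟩, ⟨17, 4294967295, 2075640326⟩, ⟨5, 2147483647, 1481312434⟩])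
    (by decide +kernel))))

/-- `r c 1 0 d e ≠ r c 1 1 d e` and `r 0 0 0 d e ≠ r 0 1 0 d e` -/
def cornerFamilyLeft : List Entry := [
  .zero, .free, .free, .free, .free, .free, .free, .free, .neg 7, .neg 7, .neg 7, .neg 7, .neg 3,
  .neg 3, .neg 3, .neg 3, .free, .free, .free, .free, .free, .free, .free, .free, .free, .free,
  .free, .free, .neg 3, .neg 3, .neg 3, .neg 3]

theorem cornerCovered_cornerFamilyLeft : cornerCovered cornerFamilyLeft :=
  cornerCovered_of_check (hs := [
    ⟨0, 53922, 17024⟩, ⟨1, 3231858, 2⟩, ⟨2, 65095810, 54528000⟩, ⟨0, 63403, 20480⟩, ⟨1, 3230688,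
    2179840⟩, ⟨12, 718929971, 704643074⟩, ⟨2, 65087618, 16785408⟩, ⟨17, 2755660416, 2218788992⟩,
    ⟨22, 124414981, 124256257⟩, ⟨2, 65485771, 50337801⟩, ⟨18, 518743723, 369238568⟩, ⟨3, 2092793,
    786520⟩, ⟨8, 261650689, 160432128⟩, ⟨16, 3564374801, 2418017024⟩, ⟨4, 763371622, 150994950⟩,
    ⟨17, 1715995520, 1074266368⟩, ⟨1, 4029950, 3171716⟩, ⟨18, 387921103, 68157511⟩, ⟨8, 250311199,
    35729925⟩, ⟨0, 65535, 64580⟩, ⟨4, 108442492, 69636656⟩, ⟨15, 1481085060, 1342177280⟩, ⟨16,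
    919034708, 570628948⟩, ⟨23, 134217078, 38099028⟩, ⟨17, 2938105819, 2283110465⟩, ⟨2, 67108863,
    35154125⟩, ⟨24, 527431679, 258392622⟩, ⟨17, 4294967295, 1592472941⟩, ⟨5, 2080366591,
    173036860⟩, ⟨11, 8589934591, 7599627107⟩]) (by decide +kernel)

/-- `r c 0 0 d e ≠ r c 0 1 d e` and `r 1 0 0 d e ≠ r 1 1 0 d e` -/
def cornerFamilyRight : List Entry := [
  .zero, .free, .free, .free, .neg 3, .neg 3, .neg 3, .neg 3, .free, .free, .free, .free, .free,
  .free, .free, .free, .free, .free, .free, .free, .neg 3, .neg 3, .neg 3, .neg 3, .neg 7, .neg 7,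
  .neg 7, .neg 7, .free, .free, .free, .free]

theorem cornerCovered_cornerFamilyRight : cornerCovered cornerFamilyRight :=
  cornerCovered_of_check (hs := [
    ⟨0, 50338, 17570⟩, ⟨1, 3230450, 2097216⟩, ⟨0, 52004, 49440⟩, ⟨2, 48240818, 44040338⟩, ⟨15,
    1879155712, 805348352⟩, ⟨0, 121835, 84770⟩, ⟨12, 952772951, 415893776⟩, ⟨3, 4038832, 2990256⟩,
    ⟨1, 3736426, 3211880⟩, ⟨4, 1010835814, 134226016⟩, ⟨18, 527266991, 325936257⟩, ⟨3, 4189436,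
    4186216⟩, ⟨2, 27470658, 10682370⟩, ⟨1, 3337208, 2288600⟩, ⟨16, 4064763077, 2990951552⟩, ⟨8,
    263748559, 137919371⟩, ⟨17, 1375734560, 33556992⟩, ⟨1, 3140603, 1018433⟩, ⟨18, 510654127,
    342385803⟩, ⟨3, 4189949, 2090568⟩, ⟨8, 268204783, 215507597⟩, ⟨14, 260011006, 153763878⟩, ⟨4,
    952015484, 672661580⟩, ⟨1, 4194303, 188241⟩, ⟨15, 2046294011, 553107523⟩, ⟨4, 1073545215,
    634937466⟩, ⟨16, 4158865399, 2778926608⟩, ⟨5, 2147483647, 1529850098⟩, ⟨11, 8589934591,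
    5597529596⟩]) (by decide +kernel)

/-! ### Certificates for the tee -/

def teeStencil : Stencil := ⟨(0, 0), (1, 0), (-1, 0), (0, 1), (0, 2)⟩

def teeCodes : SiteCodes := ⟨34, 35, 33, 50, 66⟩

theorem teeCodes_fitsAll : teeCodes.FitsAll teeStencil := by
  constructor <;> decide

def teePlans : List Plan := [
  ⟨[85, 86], [52, 55, 88, 119, 103, 71, 83, 116, 100, 68, 117, 118, 84, 87, 102, 101, 54, 53, 85,
  86, 70, 69], [50, 19, 35, 51, 20, 36, 52, 53]⟩, ⟨[85, 101, 86, 102], [68, 134, 135, 104, 55,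
  132, 99, 88, 52, 83, 133, 71, 116, 119, 53, 54, 87, 103, 118, 84, 117, 100, 70, 69, 86, 101,
  102, 85], [50, 66, 19, 35, 51, 67, 20, 36, 52, 68, 53, 69]⟩, ⟨[101, 86, 102], [68, 84, 71, 135,
  104, 116, 99, 132, 88, 53, 54, 55, 133, 134, 100, 117, 119, 87, 118, 103, 69, 70, 85, 101, 86,
  102], [66, 35, 51, 67, 20, 36, 52, 68, 53, 69]⟩, ⟨[85, 101, 102], [119, 104, 135, 99, 132, 54,
  53, 52, 134, 68, 103, 83, 71, 87, 133, 118, 116, 100, 117, 84, 70, 69, 85, 102, 86, 101], [50,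
  66, 19, 35, 51, 67, 36, 52, 68, 69]⟩, ⟨[117, 86, 102, 118, 119], [55, 53, 54, 84, 100, 136, 152,
  121, 151, 149, 120, 148, 132, 115, 69, 71, 70, 88, 104, 116, 150, 135, 133, 85, 134, 87, 86,
  103, 119, 102, 101, 117, 118], [82, 51, 67, 83, 20, 36, 52, 68, 84, 53, 69, 85, 86]⟩, ⟨[85, 101,
  117, 118], [87, 150, 149, 53, 54, 52, 135, 120, 151, 83, 70, 68, 69, 115, 148, 103, 119, 99,
  134, 132, 84, 133, 86, 85, 118, 102, 117, 100, 116, 101], [50, 66, 82, 19, 35, 51, 67, 83, 52,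
  68, 84, 85]⟩, ⟨[117, 86, 102, 118], [84, 53, 55, 54, 100, 115, 148, 132, 120, 151, 88, 150, 149,
  71, 69, 70, 116, 104, 135, 133, 85, 134, 87, 86, 101, 117, 102, 118, 103, 119], [82, 51, 67, 83,
  20, 36, 52, 68, 84, 53, 69, 85]⟩, ⟨[85, 117, 118], [70, 68, 148, 115, 132, 150, 151, 135, 120,
  52, 53, 54, 69, 103, 119, 149, 87, 83, 134, 133, 84, 86, 100, 118, 102, 85, 101, 117, 116], [50,
  82, 19, 35, 51, 67, 83, 52, 68, 84, 85]⟩, ⟨[85], [68, 70, 53, 52, 54, 69, 83, 100, 116, 118, 87,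
  102, 117, 86, 84, 85, 101], [50, 19, 35, 51, 52]⟩, ⟨[85, 101], [134, 103, 83, 133, 52, 53, 54,
  132, 99, 68, 70, 69, 87, 118, 116, 84, 117, 100, 102, 86, 85, 101], [50, 66, 19, 35, 51, 67, 52,
  68]⟩, ⟨[85, 86, 102], [133, 88, 104, 135, 134, 52, 68, 71, 55, 116, 83, 119, 87, 118, 103, 54,
  53, 100, 84, 117, 70, 69, 102, 86, 85, 101], [50, 19, 35, 51, 67, 20, 36, 52, 68, 53, 69]⟩,
  ⟨[101, 117, 86, 102], [135, 104, 55, 53, 54, 149, 71, 99, 148, 115, 68, 150, 84, 88, 132, 116,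
  69, 70, 100, 133, 134, 87, 103, 119, 118, 102, 86, 85, 101, 117], [66, 82, 35, 51, 67, 83, 20,
  36, 52, 68, 84, 53, 69]⟩, ⟨[101, 117, 86, 118], [135, 120, 151, 88, 149, 53, 54, 55, 148, 115,
  150, 71, 99, 84, 68, 132, 100, 116, 133, 69, 70, 87, 134, 103, 119, 118, 102, 85, 101, 86, 117],
  [66, 82, 35, 51, 67, 83, 20, 36, 52, 68, 84, 53, 85]⟩, ⟨[117, 102, 118, 87, 119], [121, 152,
  136, 55, 56, 54, 115, 132, 148, 150, 72, 149, 100, 84, 89, 116, 69, 151, 133, 70, 71, 85, 134,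
  135, 88, 104, 120, 119, 103, 86, 87, 118, 102, 101, 117], [82, 51, 67, 83, 36, 52, 68, 84, 21,
  37, 53, 69, 85, 54, 86]⟩, ⟨[117, 86, 102], [88, 69, 71, 104, 135, 115, 132, 148, 55, 53, 54, 70,
  150, 84, 149, 100, 116, 133, 87, 134, 85, 86, 118, 117, 101, 102, 119, 103], [82, 51, 67, 83,
  20, 36, 52, 68, 84, 53, 69]⟩, ⟨[85, 87], [118, 102, 55, 56, 117, 120, 89, 104, 116, 83, 100, 52,
  53, 68, 119, 88, 72, 84, 101, 71, 69, 85, 70, 54, 86, 87, 103], [50, 19, 35, 51, 52, 21, 37, 53,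
  54]⟩, ⟨[101, 86, 102, 103], [54, 53, 55, 120, 136, 105, 133, 84, 135, 68, 134, 72, 88, 116, 99,
  132, 100, 104, 119, 117, 71, 118, 69, 70, 101, 85, 103, 87, 102, 86], [66, 35, 51, 67, 20, 36,
  52, 68, 37, 53, 69, 70]⟩, ⟨[101, 117, 86, 102, 119], [148, 115, 121, 136, 152, 151, 99, 53, 54,
  55, 120, 104, 84, 150, 88, 68, 149, 71, 135, 132, 69, 70, 116, 133, 100, 87, 134, 103, 119, 118,
  117, 85, 101, 86, 102], [66, 82, 35, 51, 67, 83, 20, 36, 52, 68, 84, 53, 69, 85, 86]⟩, ⟨[101,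
  117, 86, 118, 103, 119], [68, 115, 148, 151, 121, 152, 150, 88, 99, 54, 53, 55, 105, 149, 72,
  84, 132, 136, 104, 135, 120, 100, 133, 116, 69, 134, 71, 70, 85, 87, 86, 103, 119, 102, 118,
  117, 101], [66, 82, 35, 51, 67, 83, 20, 36, 52, 68, 84, 37, 53, 69, 85, 70, 86]⟩, ⟨[85, 117,
  102, 118], [149, 53, 54, 52, 132, 115, 148, 151, 120, 83, 68, 87, 104, 71, 150, 135, 103, 134,
  119, 70, 69, 133, 84, 100, 116, 117, 101, 118, 86, 85, 102], [50, 82, 19, 35, 51, 67, 83, 36,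
  52, 68, 84, 69, 85]⟩, ⟨[101, 117, 86, 102, 103, 119], [150, 88, 53, 55, 54, 68, 115, 148, 105,
  149, 151, 72, 121, 152, 99, 84, 132, 136, 120, 116, 100, 133, 104, 135, 134, 69, 71, 70, 87, 85,
  86, 101, 117, 119, 102, 118, 103], [66, 82, 35, 51, 67, 83, 20, 36, 52, 68, 84, 37, 53, 69, 85,
  70, 86]⟩, ⟨[117, 86, 118], [148, 132, 115, 100, 120, 151, 135, 88, 84, 55, 54, 53, 71, 69, 70,
  149, 116, 150, 133, 87, 134, 103, 85, 101, 117, 119, 118, 102, 86], [82, 51, 67, 83, 20, 36, 52,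
  68, 84, 53, 85]⟩, ⟨[117, 86, 118, 119], [121, 152, 136, 71, 69, 88, 84, 53, 54, 55, 70, 100,
  150, 151, 148, 132, 115, 104, 149, 116, 120, 135, 133, 134, 87, 85, 86, 103, 119, 102, 118, 101,
  117], [82, 51, 67, 83, 20, 36, 52, 68, 84, 53, 69, 85, 86]⟩, ⟨[85, 118, 119], [70, 68, 83, 100,
  152, 136, 121, 133, 149, 53, 54, 52, 69, 150, 88, 104, 151, 120, 135, 116, 84, 87, 117, 86, 134,
  119, 103, 102, 118, 101, 85], [50, 19, 35, 51, 83, 52, 68, 84, 53, 69, 85, 86]⟩, ⟨[117, 86, 102,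
  119], [152, 121, 136, 151, 149, 115, 132, 148, 84, 116, 55, 54, 53, 150, 104, 71, 69, 70, 120,
  88, 100, 133, 135, 87, 134, 85, 86, 117, 101, 119, 118, 102, 103], [82, 51, 67, 83, 20, 36, 52,
  68, 84, 53, 69, 85, 86]⟩, ⟨[101, 117, 118, 87, 103, 119], [151, 115, 148, 121, 152, 105, 56, 55,
  54, 150, 149, 84, 89, 99, 72, 68, 69, 71, 132, 70, 136, 100, 133, 116, 135, 134, 88, 117, 101,
  85, 86, 87, 118, 102, 104, 119, 103, 120], [66, 82, 35, 51, 67, 83, 52, 68, 84, 21, 37, 53, 69,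
  85, 54, 70, 86]⟩, ⟨[101, 86, 102, 118], [53, 54, 55, 68, 120, 151, 149, 99, 132, 84, 150, 104,
  71, 88, 135, 100, 116, 133, 69, 70, 87, 134, 103, 119, 118, 117, 101, 86, 85, 102], [66, 35, 51,
  67, 83, 20, 36, 52, 68, 84, 53, 69, 85]⟩, ⟨[85, 101, 102, 118], [52, 54, 53, 132, 99, 87, 83,
  150, 151, 120, 149, 68, 104, 71, 135, 70, 69, 119, 103, 134, 84, 133, 100, 116, 117, 118, 102,
  86, 85, 101], [50, 66, 19, 35, 51, 67, 83, 36, 52, 68, 84, 69, 85]⟩, ⟨[85, 101, 86], [132, 99,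
  52, 55, 119, 88, 133, 134, 68, 83, 71, 116, 54, 53, 87, 103, 118, 84, 117, 100, 70, 69, 101,
  102, 86, 85], [50, 66, 19, 35, 51, 67, 20, 36, 52, 68, 53]⟩, ⟨[85, 101, 117, 102], [83, 99, 52,
  54, 53, 150, 135, 104, 68, 87, 115, 148, 71, 149, 132, 70, 69, 119, 103, 134, 133, 84, 100, 116,
  117, 101, 86, 118, 85, 102], [50, 66, 82, 19, 35, 51, 67, 83, 36, 52, 68, 84, 69]⟩, ⟨[117, 86,
  102, 103, 119], [69, 54, 53, 55, 152, 121, 115, 132, 148, 88, 72, 100, 84, 150, 151, 149, 105,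
  116, 133, 136, 104, 71, 70, 135, 120, 85, 134, 101, 117, 118, 102, 103, 86, 119, 87], [82, 51,
  67, 83, 20, 36, 52, 68, 84, 37, 53, 69, 85, 70, 86]⟩, ⟨[101, 86, 102, 119], [132, 99, 116, 152,
  121, 136, 53, 54, 55, 150, 88, 71, 84, 133, 68, 104, 151, 100, 120, 135, 69, 70, 134, 87, 119,
  118, 103, 86, 85, 117, 102, 101], [66, 35, 51, 67, 20, 36, 52, 68, 84, 53, 69, 85, 86]⟩, ⟨[117,
  102, 87, 103], [105, 136, 84, 149, 148, 115, 132, 116, 55, 54, 56, 100, 150, 135, 69, 72, 89,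
  120, 133, 70, 71, 104, 88, 85, 134, 119, 103, 86, 87, 101, 102, 118, 117], [82, 51, 67, 83, 36,
  52, 68, 84, 21, 37, 53, 69, 54, 70]⟩, ⟨[85, 101, 118], [151, 135, 120, 83, 132, 99, 54, 52, 53,
  149, 87, 68, 70, 69, 103, 150, 119, 134, 86, 133, 84, 85, 117, 102, 118, 101, 116, 100], [50,
  66, 19, 35, 51, 67, 83, 52, 68, 84, 85]⟩, ⟨[85, 118], [70, 68, 52, 53, 54, 69, 150, 151, 135,
  120, 83, 100, 119, 87, 103, 149, 133, 134, 116, 84, 86, 118, 102, 117, 101, 85], [50, 19, 35,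
  51, 83, 52, 68, 84, 85]⟩, ⟨[117, 86, 102, 87, 103, 119], [121, 152, 150, 84, 69, 148, 115, 132,
  149, 72, 105, 116, 100, 151, 53, 56, 89, 133, 136, 55, 54, 70, 71, 88, 85, 134, 135, 117, 101,
  118, 102, 87, 86, 103, 120, 119, 104], [82, 51, 67, 83, 20, 36, 52, 68, 84, 21, 37, 53, 69, 85,
  54, 70, 86]⟩, ⟨[85, 101, 117, 86, 102, 119], [52, 136, 152, 121, 99, 83, 148, 115, 150, 151, 55,
  68, 149, 120, 88, 104, 71, 132, 135, 54, 53, 70, 69, 134, 133, 87, 84, 100, 116, 117, 101, 85,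
  86, 118, 102, 119, 103], [50, 66, 82, 19, 35, 51, 67, 83, 20, 36, 52, 68, 84, 53, 69, 85, 86]⟩]

theorem teePlans_ok : ∀ pl ∈ teePlans, pl.Ok teeCodes := by
  decide +kernel

/-- The extremal sites are the ends of the two arms and of the stem, arguments 1, 2 and 4; the
centre lies between the arms and cannot be sliced. -/
abbrev teeCovered : List Entry → Prop :=
  Covered teeStencil [0, 1, 2, 3, 4] [1, 2, 4]

theorem teeCovered_of_check {es : List Entry} {hs : List Hint}
    (h : checkFamily 20 teeCodes [0, 1, 2, 3, 4] [1, 2, 4] teePlans es hs = true) :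
    teeCovered es :=
  covered_of_checkFamily teeCodes_fitsAll teePlans_ok h

/-- `r 0 e w d f ≠ r 1 e w d f` -/
def teeFamilyCentre : List Entry := [
  .zero, .free, .free, .free, .free, .free, .free, .free, .free, .free, .free, .free, .free,
  .free, .free, .free, .neg 15, .neg 15, .neg 15, .neg 15, .neg 15, .neg 15, .neg 15, .neg 15,
  .neg 15, .neg 15, .neg 15, .neg 15, .neg 15, .neg 15, .neg 15, .neg 15]

theorem teeCovered_teeFamilyCentre : teeCovered teeFamilyCentre :=
  teeCovered_of_check (hs := [
    ⟨0, 786432, 524288⟩, ⟨1, 251658240, 83886080⟩, ⟨2, 58868760, 41943048⟩, ⟨3, 46728256,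
    4719616⟩, ⟨1, 251727916, 201392140⟩, ⟨4, 872940548, 336068612⟩, ⟨5, 260402187, 142958602⟩, ⟨6,
    521106185, 167789064⟩, ⟨7, 536870911, 311317930⟩]) (by decide +kernel)

/-- `r 0 0 w d f ≠ r 0 1 w d f` -/
def teeFamilyArm : List Entry := [
  .zero, .free, .free, .free, .free, .free, .free, .free, .neg 7, .neg 7, .neg 7, .neg 7, .neg 7,
  .neg 7, .neg 7, .neg 7, .free, .free, .free, .free, .free, .free, .free, .free, .free, .free,
  .free, .free, .free, .free, .free, .free]

theorem teeCovered_teeFamilyArm : teeCovered teeFamilyArm :=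
  .of_refine 1 0 rfl (.of_refine 2 1 rfl (.of_refine 4 3 rfl (teeCovered_of_check (hs := [
    ⟨8, 50238, 49154⟩, ⟨0, 4183615, 267296⟩, ⟨8, 118436, 115876⟩, ⟨0, 2995999, 791810⟩, ⟨2,
    58122047, 17095977⟩, ⟨0, 4183935, 2807587⟩, ⟨9, 4194043, 2606738⟩]) (by decide +kernel))
  (teeCovered_of_check (hs := [
    ⟨8, 50194, 50194⟩, ⟨0, 4141603, 798754⟩, ⟨8, 128319, 57344⟩, ⟨0, 4193895, 266274⟩, ⟨8, 128831,
    62231⟩]) (by decide +kernel)))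
  (.of_refine 4 3 rfl (teeCovered_of_check (hs := [
    ⟨8, 51224, 16384⟩, ⟨2, 25905432, 8407296⟩, ⟨0, 2086007, 577552⟩, ⟨2, 25186064, 25182208⟩, ⟨8,
    125663, 125122⟩, ⟨0, 4194111, 317446⟩, ⟨8, 131066, 63856⟩, ⟨10, 67100158, 46422496⟩, ⟨0,
    4177663, 3838631⟩, ⟨8, 126710, 93942⟩, ⟨9, 4110199, 1213252⟩, ⟨2, 30072605, 17319180⟩, ⟨11,
    1054850751, 839286786⟩, ⟨0, 4194047, 62098⟩, ⟨12, 2120169471, 1683161353⟩, ⟨9, 4194303,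
    3656972⟩, ⟨0, 4194303, 1381263⟩, ⟨13, 4042257085, 2415964704⟩, ⟨14, 268173311, 27517122⟩])
    (by decide +kernel))
  (teeCovered_of_check (hs := [
    ⟨8, 50208, 16416⟩, ⟨8, 59582, 57360⟩, ⟨0, 987139, 790528⟩, ⟨8, 50206, 17426⟩, ⟨2, 59526657,
    59260928⟩, ⟨3, 14323936, 9043968⟩, ⟨0, 4193919, 316464⟩, ⟨8, 63647, 26753⟩, ⟨15, 66829215,
    12223260⟩, ⟨2, 65461769, 48648200⟩, ⟨3, 40893178, 7325722⟩, ⟨16, 260905607, 76087296⟩, ⟨0,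
    2097151, 315822⟩, ⟨17, 3655578542, 1231225388⟩, ⟨2, 67108827, 15069194⟩, ⟨18, 3639926396,
    150243428⟩, ⟨8, 131071, 96466⟩, ⟨19, 1599564015, 1330972905⟩, ⟨3, 24084477, 19557576⟩, ⟨20,
    3455885110, 3388738068⟩, ⟨9, 4194303, 3585989⟩, ⟨2, 67108863, 25084257⟩, ⟨16, 534731751,
    93257926⟩, ⟨12, 1602190846, 1131875722⟩, ⟨17, 4227203054, 2069914660⟩, ⟨18, 4294967277,
    3367439396⟩]) (by decide +kernel))))
  (.of_refine 2 1 rfl (.of_refine 4 3 rfl (teeCovered_of_check (hs := [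
    ⟨8, 49670, 16388⟩, ⟨8, 58160, 25392⟩, ⟨0, 1839132, 1576960⟩, ⟨8, 118034, 50194⟩, ⟨2, 32199448,
    31473680⟩, ⟨8, 116528, 115488⟩, ⟨21, 464360664, 268502032⟩, ⟨8, 54854, 16902⟩, ⟨9, 2031299,
    1236610⟩, ⟨0, 4193900, 463872⟩, ⟨2, 65100056, 14698752⟩, ⟨21, 358723832, 21037088⟩, ⟨9,
    3403743, 3385805⟩, ⟨8, 131071, 116122⟩, ⟨2, 66050046, 7329386⟩, ⟨1, 100663295, 100406495⟩,
    ⟨14, 201064447, 25409938⟩]) (by decide +kernel))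
  (teeCovered_of_check (hs := [
    ⟨8, 50182, 50182⟩, ⟨8, 58674, 57632⟩, ⟨0, 1043552, 991264⟩, ⟨8, 50193, 49152⟩, ⟨22,
    1814691840, 67633152⟩, ⟨9, 4098689, 2001537⟩, ⟨15, 132627903, 40087558⟩, ⟨8, 49761, 49249⟩,
    ⟨2, 63601696, 63592480⟩, ⟨0, 3939603, 3413266⟩, ⟨8, 127577, 24592⟩, ⟨4, 1922028056, 905744⟩,
    ⟨9, 3670013, 3644364⟩, ⟨23, 2146435071, 1047451335⟩, ⟨24, 2830352381, 10650437⟩, ⟨4,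
    870307467, 592171656⟩]) (by decide +kernel)))
  (.of_refine 4 3 rfl (teeCovered_of_check (hs := [
    ⟨8, 50208, 17440⟩, ⟨8, 52390, 49156⟩, ⟨2, 25905436, 16400⟩, ⟨9, 3337890, 2278562⟩, ⟨6,
    109250048, 67174400⟩, ⟨8, 59474, 59472⟩, ⟨0, 3939967, 3413538⟩, ⟨14, 200490079, 18940936⟩, ⟨9,
    2012999, 1217538⟩, ⟨6, 949683985, 134283520⟩, ⟨8, 131063, 60389⟩, ⟨2, 29285644, 4119816⟩, ⟨14,
    129094167, 10551301⟩, ⟨4, 3561637585, 336199681⟩, ⟨6, 327907097, 33624072⟩, ⟨8, 131071,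
    20811⟩, ⟨14, 268173055, 65250451⟩, ⟨25, 4294967295, 838294661⟩]) (by decide +kernel))
  (teeCovered_of_check (hs := [
    ⟨8, 50182, 17414⟩, ⟨8, 50464, 49440⟩, ⟨2, 59394048, 17448960⟩, ⟨4, 143409177, 524289⟩, ⟨8,
    58130, 57344⟩, ⟨4, 872939520, 805830656⟩, ⟨24, 2887027472, 2283047440⟩, ⟨0, 4144747, 3944994⟩,
    ⟨4, 3825861120, 604504064⟩, ⟨9, 3602147, 2552002⟩, ⟨0, 3939891, 3415090⟩, ⟨24, 2887354148,
    67142144⟩, ⟨0, 4194299, 1244266⟩, ⟨4, 2018378524, 541851652⟩, ⟨8, 131071, 52571⟩, ⟨3,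
    67108863, 10394747⟩, ⟨9, 4194303, 1545432⟩, ⟨5, 1073741823, 1060856456⟩, ⟨14, 268435423,
    149395520⟩, ⟨4, 4293918591, 3175847732⟩]) (by decide +kernel))))

/-- `r c e w 0 0 ≠ r c e w 1 0` -/
def teeFamilyBoth : List Entry := [
  .zero, .free, .neg 1, .free, .free, .free, .neg 1, .free, .free, .free, .neg 1, .free, .free,
  .free, .neg 1, .free, .free, .free, .neg 1, .free, .free, .free, .neg 1, .free, .free, .free,
  .neg 1, .free, .free, .free, .neg 1, .free]

/-- Entries 1, 4 and 8 are compared with entry 0, which is `false`, and thereby fixed; entry 2 is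
already determined by entry 0. This leaves 20 free values. -/
theorem teeCovered_teeFamilyBoth : teeCovered teeFamilyBoth :=
  .of_refine 1 0 rfl (.of_refine 4 3 rfl (.of_refine 8 7 rfl (teeCovered_of_check (hs := [
    ⟨8, 101532, 100352⟩, ⟨9, 3682678, 3145728⟩, ⟨2, 53055481, 33587200⟩, ⟨0, 1032671, 835840⟩, ⟨9,
    3762687, 2623496⟩, ⟨3, 61673727, 0⟩, ⟨9, 4147711, 592032⟩, ⟨1, 186513358, 134218754⟩, ⟨9,
    3174911, 2113768⟩, ⟨1, 266338303, 222982⟩, ⟨2, 67108863, 112149⟩]) (by decide +kernel))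
  (teeCovered_of_check (hs := [
    ⟨8, 101148, 67840⟩, ⟨2, 25363736, 8388608⟩, ⟨8, 104350, 67200⟩, ⟨9, 3289202, 2228224⟩, ⟨2,
    25627777, 128⟩, ⟨9, 3617915, 66560⟩, ⟨0, 2084669, 314624⟩, ⟨8, 116734, 83566⟩, ⟨11, 886586431,
    268435492⟩, ⟨10, 57655231, 50596503⟩, ⟨0, 4194303, 3857199⟩, ⟨8, 131071, 122964⟩, ⟨26,
    880176119, 71330147⟩]) (by decide +kernel)))
  (.of_refine 8 7 rfl (teeCovered_of_check (hs := [
    ⟨8, 99292, 98944⟩, ⟨3, 13174864, 4194304⟩, ⟨8, 105181, 65544⟩, ⟨9, 3301877, 2105345⟩, ⟨8,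
    130940, 126308⟩, ⟨3, 29473272, 0⟩, ⟨9, 3752438, 524290⟩, ⟨0, 4194295, 3531556⟩, ⟨27,
    854074589, 537395329⟩, ⟨0, 4182011, 315160⟩, ⟨28, 60292095, 8539088⟩, ⟨9, 4194303, 994706⟩,
    ⟨3, 67108859, 52766352⟩, ⟨29, 897515135, 272901216⟩]) (by decide +kernel))
  (teeCovered_of_check (hs := [
    ⟨8, 99100, 66304⟩, ⟨8, 101788, 101504⟩, ⟨3, 46141664, 46137344⟩, ⟨0, 1032339, 311424⟩, ⟨9,
    3934272, 1837056⟩, ⟨0, 1032203, 835592⟩, ⟨8, 126109, 90112⟩, ⟨2, 58723843, 25165824⟩, ⟨3,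
    13340916, 4853764⟩, ⟨8, 130941, 75081⟩, ⟨30, 3498060938, 1342177280⟩, ⟨9, 4177791, 107265⟩,
    ⟨2, 66584539, 9832408⟩, ⟨17, 1417777676, 67108864⟩, ⟨16, 705470359, 536907025⟩, ⟨0, 4186107,
    843378⟩, ⟨20, 2158005810, 2157970450⟩, ⟨2, 67108863, 24825538⟩, ⟨31, 3747610605, 3491066633⟩,
    ⟨32, 4294967231, 4239073317⟩]) (by decide +kernel))))
  (.of_refine 4 3 rfl (.of_refine 8 7 rfl (teeCovered_of_check (hs := [
    ⟨8, 100548, 100356⟩, ⟨9, 3243904, 2097152⟩, ⟨8, 126916, 67584⟩, ⟨9, 3438083, 1064960⟩, ⟨2,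
    59966972, 41943072⟩, ⟨1, 218643181, 67108864⟩, ⟨3, 31182687, 21004289⟩, ⟨9, 4061605, 329729⟩,
    ⟨5, 680226247, 545259591⟩, ⟨2, 66566140, 40285736⟩]) (by decide +kernel))
  (teeCovered_of_check (hs := [
    ⟨8, 101896, 67592⟩, ⟨9, 3153410, 2097152⟩, ⟨2, 50954268, 16777216⟩, ⟨8, 107437, 74660⟩, ⟨9,
    3505699, 84481⟩, ⟨8, 122573, 83460⟩, ⟨2, 65077524, 39911424⟩, ⟨8, 114557, 67856⟩, ⟨6,
    147210048, 8394816⟩, ⟨14, 246050847, 2637824⟩, ⟨9, 3538859, 1419521⟩, ⟨8, 131062, 125536⟩, ⟨6,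
    353257489, 18432⟩, ⟨9, 4194303, 2328721⟩, ⟨0, 4194303, 3792226⟩, ⟨9, 4194303, 2296540⟩, ⟨10,
    67108863, 40160049⟩, ⟨14, 268431839, 94630025⟩, ⟨30, 3219127609, 855827736⟩, ⟨6, 1073709055,
    481249497⟩]) (by decide +kernel)))
  (.of_refine 8 7 rfl (teeCovered_of_check (hs := [
    ⟨8, 98760, 98312⟩, ⟨3, 46148104, 33554432⟩, ⟨9, 3295104, 2097152⟩, ⟨8, 117005, 84228⟩, ⟨3,
    63283740, 41943044⟩, ⟨9, 4122141, 4071961⟩, ⟨8, 124382, 66706⟩, ⟨5, 747261445, 536870916⟩,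
    ⟨33, 254417960, 50855936⟩, ⟨0, 4059122, 3532336⟩, ⟨9, 3276167, 71810⟩, ⟨9, 3399574, 3330194⟩,
    ⟨5, 639544582, 2308⟩, ⟨8, 131071, 110725⟩, ⟨3, 67108863, 19349917⟩, ⟨28, 67108863, 62539230⟩,
    ⟨1, 268435455, 34064833⟩, ⟨33, 268394171, 25255481⟩, ⟨5, 1052704355, 815696417⟩, ⟨17,
    1072684539, 592169459⟩]) (by decide +kernel))
  (teeCovered_of_check (hs := [
    ⟨8, 99080, 99080⟩, ⟨8, 101508, 101508⟩, ⟨3, 46170624, 4194304⟩, ⟨2, 58720260, 25165824⟩, ⟨8,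
    104584, 65536⟩, ⟨9, 3303041, 2252929⟩, ⟨0, 1035400, 1033352⟩, ⟨24, 4113662280, 2701131784⟩,
    ⟨4, 2821111816, 2147516416⟩, ⟨24, 3174662152, 2818572288⟩, ⟨9, 3669931, 39682⟩, ⟨4,
    3896953432, 134367304⟩, ⟨8, 131007, 97188⟩, ⟨24, 2702824412, 2684371600⟩, ⟨9, 4194303,
    4181727⟩]) (by decide +kernel))))

/-- `r c e w 1 0 ≠ r c e w 1 1` and `r 0 e w 0 0 ≠ r 0 e w 1 0` -/
def teeFamilyLeft : List Entry := [
  .zero, .free, .neg 1, .neg 0, .free, .free, .neg 1, .neg 0, .free, .free, .neg 1, .neg 0, .free,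
  .free, .neg 1, .neg 0, .free, .free, .free, .neg 0, .free, .free, .free, .neg 0, .free, .free,
  .free, .neg 0, .free, .free, .free, .neg 0]

theorem teeCovered_teeFamilyLeft : teeCovered teeFamilyLeft :=
  teeCovered_of_check (hs := [
    ⟨8, 103076, 70144⟩, ⟨9, 3239424, 1536⟩, ⟨8, 119588, 114688⟩, ⟨9, 4124329, 3073192⟩, ⟨0,
    3665683, 322560⟩, ⟨3, 61342352, 8912912⟩, ⟨2, 31524868, 25165824⟩, ⟨4, 2499903488,
    2147483648⟩, ⟨3, 62598872, 1052232⟩, ⟨9, 3375023, 2188076⟩, ⟨2, 65243454, 8585502⟩, ⟨9,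
    3403457, 188992⟩, ⟨33, 265928506, 42567424⟩, ⟨14, 78432342, 77873158⟩, ⟨3, 65866397, 4⟩, ⟨24,
    3154247688, 469762056⟩, ⟨5, 513441345, 446309888⟩, ⟨0, 4194201, 51849⟩, ⟨9, 4128427, 2279081⟩,
    ⟨6, 126277520, 8655360⟩, ⟨0, 4194287, 316552⟩, ⟨33, 128695610, 109248808⟩, ⟨8, 114687,
    110872⟩, ⟨10, 67107982, 63199374⟩, ⟨4, 1409667880, 1342439688⟩, ⟨1, 264847087, 167847106⟩,
    ⟨28, 67108687, 63458374⟩, ⟨9, 3342223, 2126858⟩, ⟨0, 4194299, 915832⟩, ⟨14, 264240413,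
    126473241⟩, ⟨34, 66059752, 23432320⟩, ⟨6, 756477857, 689309985⟩, ⟨8, 131071, 83602⟩, ⟨33,
    267386748, 267109688⟩, ⟨5, 494599777, 492462113⟩, ⟨2, 66183167, 8487647⟩, ⟨15, 134217727,
    98921866⟩, ⟨33, 268107705, 143659409⟩, ⟨5, 1047527039, 370132015⟩, ⟨35, 938475199, 831319078⟩,
    ⟨6, 973010871, 818026261⟩, ⟨36, 4277663732, 1578366900⟩, ⟨4, 3714569016, 2483290128⟩])
    (by decide +kernel)

/-- `r c e w 0 0 ≠ r c e w 0 1` and `r 1 e w 0 0 ≠ r 1 e w 1 0` -/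
def teeFamilyRight : List Entry := [
  .zero, .neg 0, .free, .free, .free, .neg 0, .free, .free, .free, .neg 0, .free, .free, .free,
  .neg 0, .free, .free, .free, .neg 0, .neg 1, .free, .free, .neg 0, .neg 1, .free, .free, .neg 0,
  .neg 1, .free, .free, .neg 0, .neg 1, .free]

theorem teeCovered_teeFamilyRight : teeCovered teeFamilyRight :=
  teeCovered_of_check (hs := [
    ⟨8, 100644, 100644⟩, ⟨9, 3690153, 2099713⟩, ⟨9, 3370529, 85505⟩, ⟨8, 123696, 65568⟩, ⟨0,
    4178227, 3391795⟩, ⟨4, 1409368064, 65536⟩, ⟨2, 49368078, 14682118⟩, ⟨3, 66137817, 31466121⟩,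
    ⟨9, 4124297, 2027137⟩, ⟨8, 116479, 67254⟩, ⟨9, 3755657, 1575560⟩, ⟨3, 33236688, 27271808⟩,
    ⟨14, 261192711, 101738503⟩, ⟨33, 262781754, 203431978⟩, ⟨24, 2080604184, 134348824⟩, ⟨6,
    125986688, 42092416⟩, ⟨0, 4178116, 3915972⟩, ⟨5, 478739459, 8441857⟩, ⟨9, 3358607, 198669⟩,
    ⟨24, 2888007832, 2149777536⟩, ⟨2, 57225622, 23670912⟩, ⟨8, 131071, 82431⟩, ⟨3, 32486326,
    28254356⟩, ⟨6, 720037760, 145287040⟩, ⟨0, 4193019, 4178467⟩, ⟨4, 1747178296, 1210274360⟩, ⟨9,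
    4194303, 1933252⟩, ⟨33, 221249337, 86307848⟩, ⟨14, 251395167, 243325011⟩, ⟨5, 976158307,
    706927171⟩, ⟨6, 1073741823, 505585600⟩]) (by decide +kernel)

/-! ### Certificates for the cross -/

def crossStencil : Stencil := ⟨(0, 0), (1, 0), (-1, 0), (0, 1), (0, -1)⟩

def crossCodes : SiteCodes := ⟨34, 35, 33, 50, 18⟩

theorem crossCodes_fitsAll : crossCodes.FitsAll crossStencil := by
  constructor <;> decide

def crossPlans : List Plan := [
  ⟨[85], [53, 83, 87, 117, 68, 102, 70, 100, 101, 69, 86, 85, 84], [50, 35, 51, 67, 52]⟩, ⟨[85,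
  86], [83, 53, 117, 54, 118, 88, 103, 100, 71, 84, 87, 86, 101, 102, 85, 70, 68, 69], [50, 35,
  51, 67, 36, 52, 68, 53]⟩, ⟨[85, 101], [53, 103, 133, 87, 99, 83, 70, 118, 116, 117, 69, 102, 86,
  101, 84, 68, 85, 100], [50, 66, 35, 51, 67, 83, 52, 68]⟩, ⟨[101, 86, 102, 118, 103], [99, 54,
  105, 150, 71, 116, 120, 134, 70, 104, 100, 69, 86, 117, 133, 88, 103, 87, 84, 135, 85, 119, 102,
  118, 101], [66, 51, 67, 83, 36, 52, 68, 84, 100, 53, 69, 85, 70]⟩, ⟨[85, 86, 102], [54, 88, 134,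
  104, 53, 83, 119, 68, 71, 84, 118, 100, 85, 101, 102, 117, 87, 70, 69, 103, 86], [50, 35, 51,
  67, 36, 52, 68, 84, 53, 69]⟩, ⟨[85, 101, 86], [99, 54, 53, 133, 88, 83, 71, 116, 68, 117, 87,
  70, 69, 100, 85, 84, 86, 101, 103, 118, 102], [50, 66, 35, 51, 67, 83, 36, 52, 68, 53]⟩, ⟨[101,
  86, 102], [88, 54, 133, 134, 104, 99, 116, 71, 119, 70, 100, 117, 69, 87, 84, 85, 102, 101, 118,
  86, 103], [66, 51, 67, 83, 36, 52, 68, 84, 53, 69]⟩, ⟨[85, 101, 102], [83, 99, 134, 53, 133,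
  104, 116, 119, 68, 103, 69, 84, 87, 118, 70, 86, 85, 117, 102, 100, 101], [50, 66, 35, 51, 67,
  83, 52, 68, 84, 69]⟩, ⟨[101, 86, 102, 103], [105, 133, 135, 134, 99, 54, 116, 120, 71, 104, 119,
  100, 70, 84, 101, 85, 69, 86, 103, 88, 118, 102, 117, 87], [66, 51, 67, 83, 36, 52, 68, 84, 53,
  69, 85, 70]⟩, ⟨[85, 86, 102, 87], [83, 134, 53, 55, 54, 89, 72, 68, 118, 88, 84, 69, 119, 100,
  85, 117, 101, 102, 87, 70, 71, 104, 103, 86], [50, 35, 51, 67, 36, 52, 68, 84, 37, 53, 69, 54]⟩,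
  ⟨[85, 101, 102, 118], [104, 53, 99, 150, 120, 83, 68, 135, 134, 69, 84, 119, 70, 133, 85, 100,
  117, 87, 116, 102, 118, 103, 86, 101], [50, 66, 35, 51, 67, 83, 52, 68, 84, 100, 69, 85]⟩,
  ⟨[101, 117, 86, 102], [115, 99, 104, 88, 54, 149, 132, 71, 133, 116, 119, 70, 69, 100, 86, 84,
  101, 85, 134, 102, 118, 87, 103, 117], [66, 82, 51, 67, 83, 99, 36, 52, 68, 84, 53, 69]⟩, ⟨[101,
  86, 102, 118], [150, 104, 54, 88, 99, 120, 71, 135, 134, 119, 84, 70, 133, 100, 118, 117, 101,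
  116, 103, 102, 85, 69, 87, 86], [66, 51, 67, 83, 36, 52, 68, 84, 100, 53, 69, 85]⟩, ⟨[85, 101,
  117, 102], [53, 149, 104, 83, 115, 99, 132, 68, 103, 69, 133, 116, 70, 85, 134, 117, 100, 84,
  87, 102, 101, 118, 86, 119], [50, 66, 82, 35, 51, 67, 83, 99, 52, 68, 84, 69]⟩, ⟨[85, 102],
  [134, 53, 104, 83, 68, 119, 69, 84, 100, 85, 70, 118, 103, 102, 101, 87, 117, 86], [50, 35, 51,
  67, 52, 68, 84, 69]⟩, ⟨[85, 101, 86, 102], [53, 134, 83, 104, 133, 88, 99, 54, 116, 71, 68, 119,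
  103, 87, 102, 117, 118, 86, 101, 84, 70, 85, 69, 100], [50, 66, 35, 51, 67, 83, 36, 52, 68, 84,
  53, 69]⟩, ⟨[101, 86, 102, 87], [133, 99, 134, 55, 54, 89, 72, 116, 88, 100, 117, 71, 104, 87,
  70, 69, 118, 101, 119, 84, 103, 85, 86, 102], [66, 51, 67, 83, 36, 52, 68, 84, 37, 53, 69, 54]⟩,
  ⟨[85, 87], [55, 119, 89, 117, 53, 83, 72, 100, 101, 84, 68, 69, 85, 102, 70, 104, 71, 103, 86,
  87, 88], [50, 35, 51, 67, 52, 37, 53, 69, 54]⟩, ⟨[101, 102, 87, 103], [69, 99, 55, 133, 105, 89,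
  134, 135, 72, 120, 84, 71, 116, 100, 101, 117, 118, 70, 88, 85, 86, 102, 87, 104, 119, 103],
  [66, 51, 67, 83, 52, 68, 84, 37, 53, 69, 85, 54, 70]⟩, ⟨[85, 101, 117, 86], [115, 119, 149, 83,
  53, 54, 88, 99, 68, 132, 71, 87, 133, 116, 134, 117, 103, 100, 118, 102, 70, 69, 84, 86, 101,
  85], [50, 66, 82, 35, 51, 67, 83, 99, 36, 52, 68, 84, 53]⟩, ⟨[85, 101, 86, 118, 103, 119], [83,
  99, 68, 84, 100, 116, 53, 69, 85, 101, 117, 133, 54, 70, 86, 102, 118, 134, 150, 71, 87, 103,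
  119, 135, 151, 88, 104, 120, 136, 105, 121], [50, 66, 35, 51, 67, 83, 36, 52, 68, 84, 100, 53,
  69, 85, 101, 70, 86]⟩, ⟨[101, 117, 86, 118, 87, 103], [99, 115, 84, 100, 116, 132, 69, 85, 101,
  117, 133, 149, 54, 70, 86, 102, 118, 134, 150, 55, 71, 87, 103, 119, 135, 72, 88, 104, 120, 89,
  105], [66, 82, 51, 67, 83, 99, 36, 52, 68, 84, 100, 37, 53, 69, 85, 54, 70]⟩, ⟨[117, 86, 102],
  [115, 88, 84, 104, 149, 54, 132, 69, 70, 116, 133, 134, 100, 117, 119, 118, 101, 102, 85, 86,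
  87, 103, 71], [82, 51, 67, 83, 99, 36, 52, 68, 84, 53, 69]⟩, ⟨[85, 102, 118], [53, 150, 104,
  116, 120, 83, 135, 68, 134, 133, 118, 69, 84, 70, 85, 100, 86, 101, 117, 87, 102, 103, 119],
  [50, 35, 51, 67, 83, 52, 68, 84, 100, 69, 85]⟩, ⟨[85, 86, 103], [54, 53, 135, 83, 105, 117, 120,
  100, 84, 119, 104, 68, 85, 69, 70, 71, 88, 87, 103, 118, 102, 86, 101], [50, 35, 51, 67, 36, 52,
  68, 53, 69, 85, 70]⟩, ⟨[101, 86], [99, 88, 54, 133, 71, 116, 70, 87, 117, 100, 69, 103, 86, 84,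
  102, 118, 85, 101], [66, 51, 67, 83, 36, 52, 68, 53]⟩, ⟨[117, 86, 102, 118, 103], [54, 150, 149,
  105, 115, 84, 132, 69, 120, 70, 116, 133, 100, 104, 71, 117, 134, 86, 103, 87, 88, 135, 119,
  102, 85, 118, 101], [82, 51, 67, 83, 99, 36, 52, 68, 84, 100, 53, 69, 85, 70]⟩, ⟨[101, 86, 87],
  [55, 99, 54, 133, 89, 119, 116, 72, 117, 100, 84, 104, 88, 101, 118, 69, 103, 71, 102, 87, 86,
  70, 85], [66, 51, 67, 83, 36, 52, 68, 37, 53, 69, 54]⟩, ⟨[101, 117, 86], [119, 88, 115, 99, 149,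
  54, 132, 71, 133, 87, 70, 69, 116, 134, 100, 117, 103, 86, 101, 85, 118, 102, 84], [66, 82, 51,
  67, 83, 99, 36, 52, 68, 84, 53]⟩, ⟨[85, 117], [87, 115, 53, 83, 149, 119, 132, 70, 133, 116,
  134, 118, 117, 100, 69, 86, 102, 84, 68, 85, 101], [50, 82, 35, 51, 67, 83, 99, 52, 84]⟩, ⟨[101,
  102, 87], [69, 55, 133, 89, 134, 99, 84, 72, 71, 88, 104, 116, 70, 87, 103, 119, 118, 86, 100,
  101, 102, 117, 85], [66, 51, 67, 83, 52, 68, 84, 37, 53, 69, 54]⟩, ⟨[85, 117, 102], [149, 104,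
  83, 53, 115, 68, 132, 116, 133, 103, 69, 84, 70, 134, 117, 100, 85, 86, 87, 118, 119, 102, 101],
  [50, 82, 35, 51, 67, 83, 99, 52, 68, 84, 69]⟩, ⟨[85, 102, 103], [134, 105, 53, 135, 71, 83, 120,
  68, 69, 84, 70, 100, 85, 104, 101, 117, 102, 119, 118, 103, 87, 88, 86], [50, 35, 51, 67, 52,
  68, 84, 53, 69, 85, 70]⟩, ⟨[101, 117, 86, 102, 118, 103], [115, 99, 105, 150, 54, 149, 132, 120,
  70, 84, 104, 71, 133, 134, 117, 87, 88, 103, 100, 116, 69, 118, 85, 135, 119, 86, 102, 101],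
  [66, 82, 51, 67, 83, 99, 36, 52, 68, 84, 100, 53, 69, 85, 70]⟩, ⟨[101, 86, 118, 87, 119], [151,
  121, 55, 54, 89, 99, 150, 72, 136, 116, 120, 135, 88, 69, 134, 119, 100, 71, 70, 86, 104, 103,
  87, 84, 117, 101, 133, 118, 102, 85], [66, 51, 67, 83, 36, 52, 68, 84, 100, 37, 53, 69, 85, 101,
  54, 86]⟩, ⟨[85, 117, 86, 118], [88, 150, 149, 120, 83, 53, 54, 115, 71, 135, 68, 132, 87, 116,
  84, 119, 69, 70, 86, 85, 133, 134, 102, 101, 117, 118, 103, 100], [50, 82, 35, 51, 67, 83, 99,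
  36, 52, 68, 84, 100, 53, 85]⟩, ⟨[85, 101, 102, 118, 103], [105, 99, 71, 150, 53, 83, 68, 88,
  133, 69, 104, 84, 134, 120, 100, 103, 85, 70, 135, 118, 119, 87, 116, 101, 102, 117, 86], [50,
  66, 35, 51, 67, 83, 52, 68, 84, 100, 53, 69, 85, 70]⟩, ⟨[85, 86, 102, 118, 103], [53, 83, 54,
  105, 150, 116, 133, 68, 88, 84, 134, 69, 70, 104, 100, 85, 135, 118, 103, 119, 120, 87, 71, 102,
  117, 86, 101], [50, 35, 51, 67, 83, 36, 52, 68, 84, 100, 53, 69, 85, 70]⟩, ⟨[85, 101, 117, 102,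
  103], [71, 149, 99, 83, 53, 115, 105, 135, 120, 132, 68, 104, 133, 69, 88, 103, 116, 70, 119,
  85, 86, 87, 102, 134, 84, 100, 117, 101, 118], [50, 66, 82, 35, 51, 67, 83, 99, 52, 68, 84, 53,
  69, 85, 70]⟩, ⟨[85, 102, 87], [53, 89, 83, 55, 134, 68, 72, 69, 84, 100, 85, 88, 71, 118, 104,
  87, 70, 119, 101, 103, 102, 86, 117], [50, 35, 51, 67, 52, 68, 84, 37, 53, 69, 54]⟩, ⟨[117, 86,
  102, 103], [54, 149, 135, 115, 84, 105, 132, 69, 120, 70, 116, 133, 104, 134, 100, 117, 71, 119,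
  88, 87, 85, 118, 103, 102, 101, 86], [82, 51, 67, 83, 99, 36, 52, 68, 84, 53, 69, 85, 70]⟩,
  ⟨[101, 86, 102, 118, 119], [151, 99, 150, 54, 88, 121, 71, 136, 120, 100, 135, 70, 84, 104, 134,
  119, 133, 118, 116, 117, 101, 86, 85, 103, 69, 102, 87], [66, 51, 67, 83, 36, 52, 68, 84, 100,
  53, 69, 85, 101, 86]⟩, ⟨[101, 86, 103], [99, 133, 105, 135, 54, 116, 120, 117, 100, 104, 119,
  88, 70, 84, 103, 85, 69, 102, 118, 71, 87, 101, 86], [66, 51, 67, 83, 36, 52, 68, 53, 69, 85,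
  70]⟩, ⟨[85, 101, 117], [115, 99, 119, 149, 83, 53, 87, 103, 134, 70, 132, 68, 69, 86, 85, 133,
  117, 102, 118, 84, 100, 101, 116], [50, 66, 82, 35, 51, 67, 83, 99, 52, 68, 84]⟩, ⟨[101, 86,
  118], [99, 54, 150, 120, 88, 135, 71, 70, 87, 100, 69, 134, 119, 133, 118, 117, 116, 103, 102,
  84, 101, 86, 85], [66, 51, 67, 83, 36, 52, 68, 84, 100, 53, 85]⟩, ⟨[101, 86, 118, 103], [54,
  105, 150, 99, 134, 116, 70, 120, 100, 104, 69, 88, 117, 133, 103, 118, 135, 119, 71, 84, 87,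
  102, 85, 101, 86], [66, 51, 67, 83, 36, 52, 68, 84, 100, 53, 69, 85, 70]⟩, ⟨[85, 117, 102, 103],
  [135, 149, 53, 105, 83, 115, 71, 120, 132, 68, 116, 133, 88, 104, 84, 69, 70, 85, 103, 134, 119,
  118, 87, 86, 102, 117, 100, 101], [50, 82, 35, 51, 67, 83, 99, 52, 68, 84, 53, 69, 85, 70]⟩,
  ⟨[101, 102, 87, 119], [133, 99, 55, 121, 69, 89, 151, 72, 136, 84, 120, 135, 71, 88, 134, 100,
  116, 70, 119, 101, 104, 87, 118, 103, 85, 102, 86, 117], [66, 51, 67, 83, 52, 68, 84, 37, 53,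
  69, 85, 101, 54, 86]⟩, ⟨[85, 101, 102, 118, 119], [151, 121, 83, 150, 53, 99, 136, 68, 120, 69,
  135, 84, 134, 119, 104, 103, 133, 118, 70, 86, 116, 87, 85, 101, 102, 100, 117], [50, 66, 35,
  51, 67, 83, 52, 68, 84, 100, 69, 85, 101, 86]⟩, ⟨[117, 86, 102, 87], [84, 115, 89, 55, 149, 54,
  69, 72, 132, 88, 133, 116, 100, 117, 134, 118, 104, 101, 71, 119, 103, 102, 70, 85, 86, 87],
  [82, 51, 67, 83, 99, 36, 52, 68, 84, 37, 53, 69, 54]⟩, ⟨[85, 102, 118, 119], [150, 83, 53, 116,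
  151, 121, 133, 68, 136, 84, 69, 120, 70, 100, 85, 86, 104, 101, 103, 135, 87, 119, 134, 102,
  117, 118], [50, 35, 51, 67, 83, 52, 68, 84, 100, 69, 85, 101, 86]⟩, ⟨[85, 101, 118], [53, 87,
  120, 99, 150, 83, 70, 135, 68, 134, 119, 69, 84, 103, 100, 85, 133, 118, 117, 101, 102, 86,
  116], [50, 66, 35, 51, 67, 83, 52, 68, 84, 100, 85]⟩, ⟨[101, 86, 102, 118, 87], [54, 99, 120,
  89, 150, 55, 135, 72, 84, 88, 134, 71, 100, 133, 118, 104, 87, 70, 101, 116, 117, 85, 69, 86,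
  102, 119, 103], [66, 51, 67, 83, 36, 52, 68, 84, 100, 37, 53, 69, 85, 54]⟩, ⟨[85, 102, 118, 87],
  [83, 89, 120, 116, 150, 55, 53, 135, 68, 72, 71, 88, 84, 69, 134, 104, 87, 100, 133, 118, 70,
  85, 101, 117, 103, 86, 119, 102], [50, 35, 51, 67, 83, 52, 68, 84, 100, 37, 53, 69, 85, 54]⟩,
  ⟨[85, 101, 117, 118], [150, 120, 53, 149, 99, 115, 83, 87, 135, 132, 68, 119, 69, 70, 85, 84,
  103, 100, 134, 102, 86, 133, 117, 101, 116, 118], [50, 66, 82, 35, 51, 67, 83, 99, 52, 68, 84,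
  100, 85]⟩, ⟨[85, 102, 118, 103], [116, 71, 53, 83, 105, 150, 133, 68, 88, 84, 69, 100, 134, 70,
  85, 104, 117, 120, 135, 87, 119, 101, 118, 86, 102, 103], [50, 35, 51, 67, 83, 52, 68, 84, 100,
  53, 69, 85, 70]⟩, ⟨[85, 86, 102, 103], [54, 134, 53, 83, 135, 105, 120, 68, 84, 69, 104, 119,
  100, 88, 85, 70, 71, 87, 117, 118, 103, 101, 86, 102], [50, 35, 51, 67, 36, 52, 68, 84, 53, 69,
  85, 70]⟩, ⟨[101, 86, 118, 119, 88, 104], [99, 84, 100, 116, 69, 85, 101, 117, 133, 54, 70, 86,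
  102, 118, 134, 150, 71, 87, 103, 119, 135, 151, 56, 72, 88, 104, 120, 136, 73, 89, 105, 121, 90,
  106], [66, 51, 67, 83, 36, 52, 68, 84, 100, 53, 69, 85, 101, 38, 54, 70, 86, 55, 71]⟩, ⟨[101,
  102, 118, 87, 103, 104], [99, 84, 100, 116, 69, 85, 101, 117, 133, 70, 86, 102, 118, 134, 150,
  55, 71, 87, 103, 119, 135, 72, 88, 104, 120, 136, 89, 105, 121, 106], [66, 51, 67, 83, 52, 68,
  84, 100, 37, 53, 69, 85, 54, 70, 86, 71]⟩, ⟨[101, 86, 102, 118, 103, 120], [99, 84, 100, 116,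
  69, 85, 101, 117, 133, 54, 70, 86, 102, 118, 134, 150, 71, 87, 103, 119, 135, 88, 104, 120, 136,
  152, 105, 121, 137, 122], [66, 51, 67, 83, 36, 52, 68, 84, 100, 53, 69, 85, 70, 86, 102, 87]⟩,
  ⟨[101, 117, 86, 87, 119, 104], [99, 115, 84, 100, 116, 132, 69, 85, 101, 117, 133, 149, 54, 70,
  86, 102, 118, 134, 55, 71, 87, 103, 119, 135, 151, 72, 88, 104, 120, 136, 89, 105, 121, 106],
  [66, 82, 51, 67, 83, 99, 36, 52, 68, 84, 37, 53, 69, 85, 101, 54, 70, 86, 71]⟩, ⟨[85, 101, 87],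
  [99, 133, 83, 55, 89, 53, 119, 72, 68, 116, 71, 88, 104, 87, 117, 103, 69, 86, 70, 85, 100, 102,
  101, 84, 118], [50, 66, 35, 51, 67, 83, 52, 68, 37, 53, 69, 54]⟩, ⟨[117, 102, 118, 87], [150,
  115, 120, 89, 55, 149, 72, 132, 135, 88, 71, 116, 70, 87, 104, 86, 85, 133, 100, 101, 103, 134,
  102, 117, 119, 118], [82, 67, 83, 99, 52, 68, 84, 100, 37, 53, 69, 85, 54]⟩, ⟨[85, 102, 119],
  [151, 53, 83, 121, 68, 136, 69, 84, 70, 135, 120, 134, 119, 104, 118, 103, 100, 85, 87, 101, 86,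
  102, 117], [50, 35, 51, 67, 52, 68, 84, 69, 85, 101, 86]⟩, ⟨[85, 101, 86, 102, 118, 103], [83,
  150, 53, 99, 105, 54, 68, 104, 133, 71, 120, 134, 84, 100, 85, 70, 69, 86, 101, 117, 116, 88,
  87, 135, 103, 102, 118, 119], [50, 66, 35, 51, 67, 83, 36, 52, 68, 84, 100, 53, 69, 85, 70]⟩,
  ⟨[117, 102, 87], [89, 115, 149, 55, 132, 72, 133, 116, 100, 71, 88, 104, 134, 117, 101, 118,
  119, 103, 86, 102, 85, 70, 87], [82, 67, 83, 99, 52, 68, 84, 37, 53, 69, 54]⟩, ⟨[101, 117, 86,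
  102, 87], [89, 99, 54, 149, 55, 115, 72, 132, 133, 116, 88, 71, 100, 70, 87, 104, 134, 117, 103,
  86, 69, 102, 85, 101, 84, 118, 119], [66, 82, 51, 67, 83, 99, 36, 52, 68, 84, 37, 53, 69, 54]⟩,
  ⟨[101, 86, 102, 103, 119], [151, 99, 105, 121, 133, 54, 136, 116, 69, 135, 120, 100, 70, 104,
  134, 119, 88, 103, 87, 86, 71, 85, 118, 102, 101, 84, 117], [66, 51, 67, 83, 36, 52, 68, 84, 53,
  69, 85, 101, 70, 86]⟩, ⟨[85, 86, 102, 118], [53, 88, 54, 150, 83, 104, 116, 120, 133, 71, 68,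
  84, 134, 135, 119, 118, 103, 100, 101, 69, 117, 70, 86, 87, 102, 85], [50, 35, 51, 67, 83, 36,
  52, 68, 84, 100, 53, 69, 85]⟩, ⟨[85, 117, 102, 118, 119], [115, 150, 121, 53, 151, 149, 83, 136,
  132, 68, 69, 84, 70, 120, 85, 135, 116, 104, 119, 86, 103, 102, 87, 100, 133, 101, 117, 118,
  134], [50, 82, 35, 51, 67, 83, 99, 52, 68, 84, 100, 69, 85, 101, 86]⟩, ⟨[101, 102, 118, 87],
  [150, 55, 69, 89, 99, 120, 72, 135, 84, 71, 88, 100, 70, 134, 104, 87, 119, 103, 86, 102, 85,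
  133, 117, 118, 101, 116], [66, 51, 67, 83, 52, 68, 84, 100, 37, 53, 69, 85, 54]⟩, ⟨[101, 86,
  102, 119], [99, 151, 88, 133, 121, 54, 71, 116, 136, 135, 120, 100, 70, 104, 134, 119, 87, 84,
  69, 117, 85, 102, 101, 103, 86, 118], [66, 51, 67, 83, 36, 52, 68, 84, 53, 69, 85, 101, 86]⟩,
  ⟨[101, 86, 102, 118, 87, 103], [99, 105, 54, 150, 89, 55, 72, 120, 134, 84, 100, 133, 71, 70,
  87, 116, 117, 101, 102, 85, 86, 69, 88, 135, 119, 104, 118, 103], [66, 51, 67, 83, 36, 52, 68,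
  84, 100, 37, 53, 69, 85, 54, 70]⟩]

theorem crossPlans_ok : ∀ pl ∈ crossPlans, pl.Ok crossCodes := by
  decide +kernel

abbrev crossCovered : List Entry → Prop :=
  Covered crossStencil [0, 1, 2, 3, 4] [1, 2, 3, 4]

theorem crossCovered_of_check {es : List Entry} {hs : List Hint}
    (h : checkFamily 20 crossCodes [0, 1, 2, 3, 4] [1, 2, 3, 4] crossPlans es hs = true) :
    crossCovered es :=
  covered_of_checkFamily crossCodes_fitsAll crossPlans_ok h

/-- The rules `r` with `r 0 a = r 1 a` for those `a` of odd weight that are given by the bits of `m`,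
with `r 0 a ≠ r 1 a` for the other `a` of weight different from `2`, and with `r 0 0 = 0`. -/
def crossFamily (m : ℕ) : List Entry :=
  .zero :: List.replicate 15 .free ++ (List.range 16).map fun a =>
    if a ∈ [3, 5, 6, 9, 10, 12] then .free else if m.testBit a then .same 15 else .neg 15

/-- Entries `a` and `16 + a` belong to the arm pattern `a` with centre `0` and `1`. Comparing entry
19 with entry 3 splits by whether the centre is irrelevant at the pattern 3, which has weight 2;
this brings 21 free values down to 20. -/
theorem crossCovered_crossFamily_0 : crossCovered (crossFamily 0) := .of_refine 19 15 rfl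
  (crossCovered_of_check (hs := [
    ⟨0, 7936, 2816⟩, ⟨0, 8176, 7408⟩, ⟨0, 2240, 2048⟩, ⟨1, 260577, 258496⟩, ⟨1, 227584, 16384⟩,
    ⟨2, 110848, 77824⟩, ⟨1, 96513, 82176⟩, ⟨14, 113600, 35136⟩, ⟨2, 196554, 188674⟩, ⟨0, 2160,
    64⟩, ⟨1, 258516, 28864⟩, ⟨3, 13893712, 9699392⟩, ⟨22, 3911200, 2827296⟩, ⟨4, 977297, 928128⟩,
    ⟨23, 8027138, 2770944⟩, ⟨6, 751632, 213008⟩, ⟨24, 5756680, 4657672⟩, ⟨2, 258873, 65561⟩, ⟨5,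
    1992943, 1329228⟩, ⟨7, 1702060, 563340⟩, ⟨2, 109002, 106762⟩, ⟨4, 2075226, 1116186⟩, ⟨5,
    1996985, 278537⟩, ⟨2, 262143, 73408⟩, ⟨6, 2054677, 410113⟩, ⟨3, 16246881, 2588768⟩, ⟨0, 8191,
    4691⟩, ⟨9, 15050754, 6365186⟩, ⟨7, 782556, 241884⟩, ⟨12, 16160506, 8520706⟩, ⟨2, 262143,
    190274⟩, ⟨25, 262142, 212340⟩, ⟨1, 262143, 166222⟩, ⟨0, 8191, 4532⟩, ⟨6, 2095534, 1763726⟩,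
    ⟨13, 12024063, 11806723⟩, ⟨8, 11396434, 2908224⟩, ⟨2, 262143, 8727⟩, ⟨5, 2079095, 407618⟩, ⟨7,
    2095999, 1454094⟩, ⟨4, 1245147, 150537⟩, ⟨9, 15317087, 6891610⟩, ⟨12, 15914223, 13812741⟩, ⟨8,
    16772607, 16395496⟩, ⟨13, 16710271, 12886067⟩, ⟨10, 16777215, 16747895⟩, ⟨16, 16758271,
    8918433⟩, ⟨4, 2097151, 1718671⟩, ⟨13, 16777183, 15141313⟩]) (by decide +kernel))
  (crossCovered_of_check (hs := [
    ⟨0, 2096, 2096⟩, ⟨0, 2096, 2048⟩, ⟨1, 96512, 14336⟩, ⟨2, 79872, 0⟩, ⟨1, 96512, 84224⟩, ⟨2,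
    113088, 6336⟩, ⟨0, 2864, 2336⟩, ⟨2, 110848, 45312⟩, ⟨1, 26624, 2048⟩, ⟨3, 13697024, 12582912⟩,
    ⟨4, 1856640, 1315968⟩, ⟨5, 1202176, 137216⟩, ⟨6, 1027216, 830592⟩, ⟨7, 1387648, 1114112⟩, ⟨6,
    1779776, 1703936⟩, ⟨4, 1400960, 0⟩, ⟨6, 731200, 598016⟩, ⟨7, 1386624, 1319040⟩, ⟨5, 258048,
    40960⟩, ⟨3, 13697024, 13697024⟩, ⟨1, 97134, 80674⟩, ⟨8, 14958592, 12845056⟩, ⟨5, 1272039,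
    1138816⟩, ⟨9, 10289152, 327680⟩, ⟨2, 260602, 14586⟩, ⟨10, 8933366, 8931494⟩, ⟨11, 12405722,
    802816⟩, ⟨12, 13369376, 4718624⟩, ⟨0, 2999, 2704⟩, ⟨13, 7512064, 1056768⟩, ⟨7, 2022488,
    171032⟩, ⟨9, 14354644, 9963712⟩, ⟨6, 764096, 165952⟩, ⟨8, 6586372, 2392064⟩, ⟨0, 8191, 3813⟩,
    ⟨2, 260603, 213274⟩, ⟨1, 196223, 27183⟩, ⟨11, 12278783, 3676628⟩, ⟨4, 784827, 102714⟩, ⟨12,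
    904810, 885314⟩, ⟨13, 3868920, 723192⟩, ⟨14, 262143, 18853⟩, ⟨13, 6520316, 6311940⟩, ⟨12,
    16735998, 4542148⟩, ⟨15, 7848044, 1114152⟩, ⟨4, 1963903, 874307⟩, ⟨12, 16370615, 2162834⟩, ⟨7,
    1302775, 114787⟩, ⟨16, 15659007, 9046673⟩, ⟨6, 1568543, 1256968⟩, ⟨17, 2097151, 359489⟩, ⟨15,
    15692023, 14962774⟩, ⟨3, 32947151, 25296972⟩, ⟨8, 10929887, 148637⟩, ⟨5, 1691639, 1638707⟩,
    ⟨18, 58720255, 6424279⟩, ⟨16, 13103103, 12146⟩, ⟨3, 33011690, 27559810⟩, ⟨7, 1966071,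
    1585030⟩, ⟨4, 2031615, 63790⟩, ⟨13, 8063224, 7932128⟩, ⟨9, 14584029, 1212437⟩, ⟨9, 8387582,
    6260948⟩, ⟨12, 5341738, 32776⟩, ⟨19, 65011639, 39731104⟩, ⟨13, 16461818, 14159626⟩, ⟨5,
    2097151, 631187⟩, ⟨6, 2097151, 1969865⟩, ⟨8, 14479078, 5263042⟩, ⟨8, 16777215, 4539677⟩, ⟨9,
    16460766, 11674382⟩, ⟨9, 16646141, 8999148⟩, ⟨3, 15900674, 7479296⟩, ⟨3, 28518272, 8456064⟩,
    ⟨20, 2147483647, 100818700⟩, ⟨21, 2147483647, 406906563⟩, ⟨21, 2147483647, 1134789388⟩, ⟨20,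
    2147483647, 1634312240⟩, ⟨20, 2147483647, 2039226672⟩, ⟨21, 2147483647, 1742459148⟩, ⟨21,
    2147483647, 415591795⟩, ⟨20, 2147483647, 106044623⟩, ⟨20, 2147483647, 2040330227⟩, ⟨21,
    2147483647, 2126364659⟩, ⟨21, 2147483647, 1738218927⟩, ⟨20, 2147483647, 1594253007⟩])
    (by decide +kernel))

theorem crossCovered_crossFamily_16384 : crossCovered (crossFamily 16384) := .of_refine 19 15 rfl
  (crossCovered_of_check (hs := [
    ⟨0, 7936, 768⟩, ⟨0, 7936, 7424⟩, ⟨2, 206528, 131264⟩, ⟨0, 8024, 7176⟩, ⟨1, 84416, 82368⟩, ⟨2,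
    260549, 65541⟩, ⟨2, 127428, 86404⟩, ⟨0, 3008, 640⟩, ⟨2, 128837, 22277⟩, ⟨1, 150212, 18628⟩,
    ⟨2, 219556, 153988⟩, ⟨2, 242116, 41412⟩, ⟨1, 153792, 6336⟩, ⟨2, 196603, 182024⟩, ⟨1, 212446,
    196886⟩, ⟨14, 196350, 23110⟩, ⟨23, 4184927, 3852870⟩, ⟨2, 260079, 37253⟩, ⟨0, 8191, 4521⟩, ⟨1,
    196604, 25756⟩, ⟨5, 1407497, 1318920⟩, ⟨14, 262143, 97109⟩, ⟨4, 1556302, 108614⟩, ⟨9, 7337746,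
    6811666⟩, ⟨28, 7844223, 6533200⟩]) (by decide +kernel))
  (crossCovered_of_check (hs := [
    ⟨0, 7936, 5376⟩, ⟨0, 3008, 2752⟩, ⟨0, 6240, 6176⟩, ⟨0, 8080, 1552⟩, ⟨2, 110848, 33024⟩, ⟨0,
    8114, 1408⟩, ⟨1, 24064, 22528⟩, ⟨25, 187072, 49280⟩, ⟨14, 123840, 90240⟩, ⟨2, 106944, 73920⟩,
    ⟨1, 248256, 2240⟩, ⟨24, 1562496, 1361792⟩, ⟨6, 643392, 594240⟩, ⟨14, 222176, 90752⟩, ⟨1,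
    260544, 229632⟩, ⟨2, 252160, 252160⟩, ⟨3, 5160960, 540672⟩, ⟨1, 92228, 10244⟩, ⟨14, 258928,
    254480⟩, ⟨0, 8191, 6675⟩, ⟨5, 2052495, 676233⟩, ⟨0, 8191, 3489⟩, ⟨7, 1431572, 311316⟩, ⟨4,
    1882112, 1347584⟩, ⟨25, 252652, 53896⟩, ⟨1, 260554, 231680⟩, ⟨25, 221051, 87058⟩, ⟨8,
    16625870, 2162688⟩, ⟨2, 110976, 65920⟩, ⟨5, 1665024, 1591296⟩, ⟨8, 6651904, 4554752⟩, ⟨4,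
    1036875, 622659⟩, ⟨7, 2021505, 2017409⟩, ⟨0, 8191, 4372⟩, ⟨2, 245630, 147040⟩, ⟨1, 262015,
    76925⟩, ⟨9, 15063049, 4298753⟩, ⟨6, 2094109, 1872904⟩, ⟨14, 261623, 144519⟩, ⟨14, 262143,
    246418⟩, ⟨12, 13997818, 5608178⟩, ⟨1, 262143, 25566⟩, ⟨0, 8191, 3556⟩, ⟨7, 1943607, 829492⟩,
    ⟨0, 8191, 6776⟩, ⟨2, 130287, 103590⟩, ⟨13, 12286842, 227394⟩, ⟨3, 25157323, 22501067⟩, ⟨12,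
    16761087, 3162131⟩, ⟨13, 11270175, 159766⟩, ⟨25, 262143, 67247⟩, ⟨9, 14564750, 5650438⟩, ⟨7,
    1391639, 1319938⟩, ⟨14, 262143, 114120⟩, ⟨25, 262143, 181180⟩, ⟨12, 13336991, 4817169⟩, ⟨23,
    8388607, 5355274⟩, ⟨6, 1834943, 1686577⟩, ⟨4, 1963871, 1876319⟩, ⟨8, 16704382, 11846494⟩, ⟨26,
    117440511, 15462014⟩, ⟨12, 12189423, 10566153⟩, ⟨3, 8319290, 8319000⟩, ⟨27, 8388575, 3980106⟩,
    ⟨13, 16777215, 13228286⟩, ⟨12, 16646143, 7722546⟩]) (by decide +kernel))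

theorem crossCovered_crossFamily_24576 : crossCovered (crossFamily 24576) := .of_refine 19 15 rfl
  (crossCovered_of_check (hs := [
    ⟨0, 7936, 768⟩, ⟨0, 7368, 7368⟩, ⟨0, 7360, 7168⟩, ⟨1, 84032, 81984⟩, ⟨2, 227333, 65541⟩, ⟨0,
    8169, 5800⟩, ⟨0, 4049, 3409⟩, ⟨1, 2066, 2066⟩, ⟨35, 218365952, 218365952⟩]) (by decide +kernel))
  (crossCovered_of_check (hs := [
    ⟨0, 7936, 7424⟩, ⟨0, 7936, 7680⟩, ⟨1, 24320, 4096⟩, ⟨14, 163520, 153216⟩, ⟨2, 129345, 33089⟩,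
    ⟨0, 7392, 4288⟩, ⟨25, 218048, 217728⟩, ⟨0, 3030, 2640⟩, ⟨14, 123472, 90624⟩, ⟨1, 96704,
    82176⟩, ⟨0, 8150, 3524⟩, ⟨0, 8054, 4400⟩, ⟨25, 217408, 212992⟩, ⟨14, 142608, 132112⟩, ⟨1,
    248256, 2240⟩, ⟨25, 258549, 184736⟩, ⟨14, 127968, 127616⟩, ⟨25, 224090, 66136⟩, ⟨3, 24395857,
    4210705⟩, ⟨2, 261893, 261892⟩, ⟨1, 260577, 2081⟩, ⟨0, 8150, 1552⟩, ⟨25, 131021, 62857⟩, ⟨1,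
    162120, 143624⟩, ⟨3, 21579776, 21514240⟩, ⟨29, 2096720, 970320⟩, ⟨4, 784401, 53249⟩, ⟨7,
    1298439, 147463⟩, ⟨0, 3839, 1134⟩, ⟨6, 1306632, 233480⟩, ⟨5, 2087359, 711071⟩, ⟨14, 192380,
    189696⟩, ⟨29, 2097151, 1485519⟩, ⟨5, 1801582, 589864⟩, ⟨4, 2087391, 2081245⟩, ⟨8, 12009486,
    9781262⟩, ⟨9, 9819924, 8425492⟩, ⟨25, 262143, 58249⟩, ⟨24, 8388543, 1773757⟩, ⟨17, 2096639,
    388101⟩, ⟨29, 1898906, 837898⟩, ⟨8, 16182719, 263479⟩, ⟨13, 11758075, 223451⟩, ⟨8, 12748135,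
    4195617⟩, ⟨14, 262143, 117432⟩, ⟨5, 2086959, 1824811⟩, ⟨12, 8379258, 6623824⟩, ⟨25, 262143,
    259075⟩, ⟨3, 32766475, 20081163⟩, ⟨17, 2097151, 339016⟩, ⟨30, 3014455, 2997014⟩, ⟨31, 3537143,
    3193060⟩, ⟨32, 8388479, 7840553⟩, ⟨6, 1833023, 1685546⟩, ⟨33, 134086055, 33357095⟩, ⟨5,
    2097151, 598341⟩, ⟨34, 1071639519, 386361566⟩, ⟨13, 16777215, 11786285⟩, ⟨12, 16777215,
    7000692⟩, ⟨3, 33554431, 6191177⟩]) (by decide +kernel))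

theorem crossCovered_crossFamily_18432 : crossCovered (crossFamily 18432) := .of_refine 19 15 rfl
  (crossCovered_of_check (hs := [
    ⟨0, 7936, 2816⟩, ⟨0, 7936, 7424⟩, ⟨0, 3520, 1024⟩, ⟨1, 227584, 2048⟩, ⟨1, 18496, 64⟩, ⟨2,
    252356, 219524⟩, ⟨2, 29379, 12480⟩, ⟨0, 7668, 3348⟩, ⟨25, 255732, 49892⟩, ⟨0, 7679, 1516⟩, ⟨1,
    18688, 2304⟩, ⟨0, 8127, 4635⟩, ⟨2, 206308, 205252⟩, ⟨25, 189628, 155788⟩, ⟨0, 8183, 1799⟩,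
    ⟨14, 127978, 123562⟩, ⟨4, 1228238, 43332⟩, ⟨0, 8183, 3664⟩, ⟨1, 252415, 6399⟩, ⟨25, 229103,
    150093⟩, ⟨5, 1427069, 311389⟩, ⟨0, 8055, 4690⟩, ⟨4, 897870, 12⟩, ⟨25, 250879, 21373⟩, ⟨9,
    15069870, 10510382⟩, ⟨25, 262143, 42949⟩, ⟨6, 786431, 44842⟩, ⟨4, 2097151, 907332⟩, ⟨27,
    8388607, 6048932⟩]) (by decide +kernel))
  (crossCovered_of_check (hs := [
    ⟨0, 7936, 1792⟩, ⟨0, 6848, 6336⟩, ⟨0, 6192, 6192⟩, ⟨1, 84448, 84448⟩, ⟨2, 73984, 256⟩, ⟨0,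
    6194, 4098⟩, ⟨1, 84032, 81984⟩, ⟨2, 76548, 10500⟩, ⟨0, 3966, 3438⟩, ⟨2, 93824, 65664⟩, ⟨0,
    8104, 1280⟩, ⟨25, 258687, 126986⟩, ⟨23, 4142803, 2302546⟩, ⟨2, 258047, 11007⟩, ⟨7, 1700388,
    1175584⟩, ⟨2, 131071, 114959⟩, ⟨22, 4971126, 4298818⟩, ⟨1, 262113, 18465⟩, ⟨5, 1890202,
    1835416⟩, ⟨25, 262111, 228608⟩, ⟨0, 8191, 1752⟩, ⟨7, 1815076, 1048612⟩, ⟨4, 974567, 35015⟩,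
    ⟨2, 258421, 82277⟩, ⟨25, 131055, 115077⟩, ⟨6, 776159, 152021⟩, ⟨1, 262143, 55671⟩, ⟨36,
    96436105, 18293129⟩, ⟨4, 1507327, 1489092⟩, ⟨37, 54097405, 34685404⟩, ⟨8, 11915775, 1393103⟩,
    ⟨5, 2093055, 1894878⟩, ⟨22, 8388607, 5016079⟩, ⟨12, 16777215, 14553855⟩, ⟨8, 16758783,
    7874025⟩, ⟨3, 33554431, 29343870⟩, ⟨9, 16777215, 15775867⟩, ⟨13, 16777215, 15718606⟩])
    (by decide +kernel))

theorem crossCovered_crossFamily_26624 : crossCovered (crossFamily 26624) := .of_refine 19 15 rfl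
  (crossCovered_of_check (hs := [
    ⟨0, 7176, 5128⟩, ⟨0, 7012, 864⟩, ⟨1, 26880, 18688⟩, ⟨0, 7537, 3329⟩, ⟨1, 18692, 2052⟩, ⟨14,
    238453, 237921⟩, ⟨0, 7119, 4417⟩, ⟨2, 228869, 73733⟩, ⟨1, 14434, 14402⟩, ⟨1, 96555, 67883⟩,
    ⟨0, 7387, 3163⟩, ⟨2, 262143, 186868⟩, ⟨14, 249727, 246563⟩, ⟨25, 261246, 97304⟩, ⟨1, 262143,
    21330⟩, ⟨0, 8191, 5713⟩, ⟨24, 8388599, 3935857⟩, ⟨14, 262143, 167784⟩, ⟨35, 255827109,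
    218366117⟩, ⟨6, 2071963, 1806474⟩, ⟨1, 262143, 96344⟩]) (by decide +kernel))
  (crossCovered_of_check (hs := [
    ⟨0, 3216, 3216⟩, ⟨0, 8064, 7424⟩, ⟨2, 106944, 106944⟩, ⟨1, 85952, 65984⟩, ⟨0, 6192, 6176⟩, ⟨1,
    84960, 82400⟩, ⟨2, 221391, 65743⟩, ⟨0, 7151, 4672⟩, ⟨14, 248757, 246565⟩, ⟨25, 228991, 93246⟩,
    ⟨2, 109312, 98560⟩, ⟨0, 8159, 6550⟩, ⟨14, 262139, 139186⟩, ⟨22, 6269153, 4827297⟩, ⟨0, 8191,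
    4862⟩, ⟨0, 7679, 3451⟩, ⟨5, 2058206, 1982942⟩, ⟨7, 1563644, 446972⟩, ⟨2, 229061, 4293⟩, ⟨25,
    259839, 255030⟩, ⟨7, 1955351, 282643⟩, ⟨14, 229311, 222482⟩, ⟨5, 1890285, 840136⟩, ⟨1, 262143,
    73944⟩, ⟨0, 8191, 6791⟩, ⟨4, 1277934, 1079748⟩, ⟨25, 253903, 85383⟩, ⟨23, 8388597, 1177333⟩,
    ⟨14, 262143, 218449⟩, ⟨38, 498073406, 478299966⟩, ⟨6, 784383, 53726⟩, ⟨39, 8388607, 7770834⟩,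
    ⟨40, 62782447, 61710829⟩, ⟨41, 133103613, 59176180⟩, ⟨36, 134217727, 55452151⟩])
    (by decide +kernel))

theorem crossCovered_crossFamily_16640 : crossCovered (crossFamily 16640) := .of_refine 19 15 rfl
  (crossCovered_of_check (hs := [
    ⟨0, 3712, 1152⟩, ⟨0, 8064, 2816⟩, ⟨0, 3760, 1024⟩, ⟨0, 8112, 2992⟩, ⟨14, 41728, 41216⟩, ⟨25,
    217312, 147520⟩, ⟨1, 244096, 0⟩, ⟨2, 220552, 155008⟩, ⟨7, 1134596, 1052676⟩, ⟨23, 8350205,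
    7028745⟩, ⟨0, 8183, 1122⟩, ⟨14, 193503, 53315⟩, ⟨25, 243839, 2136⟩, ⟨1, 262141, 148312⟩, ⟨7,
    1397247, 1118362⟩]) (by decide +kernel))
  (crossCovered_of_check (hs := [
    ⟨0, 7936, 1024⟩, ⟨0, 7008, 4384⟩, ⟨0, 6240, 4160⟩, ⟨2, 96256, 65536⟩, ⟨0, 3217, 1153⟩, ⟨25,
    226785, 21920⟩, ⟨1, 63520, 47136⟩, ⟨14, 31552, 12864⟩, ⟨2, 89484, 72832⟩, ⟨25, 252652, 49288⟩,
    ⟨14, 221892, 90240⟩, ⟨7, 1378432, 1310848⟩, ⟨0, 8027, 6675⟩, ⟨1, 249280, 192⟩, ⟨25, 127201,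
    53376⟩, ⟨22, 993280, 796672⟩, ⟨14, 175968, 172032⟩, ⟨24, 7745024, 6554624⟩, ⟨1, 81025, 0⟩, ⟨3,
    5586944, 1064960⟩, ⟨2, 196036, 163268⟩, ⟨7, 1941570, 303170⟩, ⟨5, 1959302, 589830⟩, ⟨14,
    228049, 201297⟩, ⟨7, 1007684, 90116⟩, ⟨1, 253085, 166916⟩, ⟨2, 96432, 16560⟩, ⟨14, 259279,
    110794⟩, ⟨14, 222188, 90764⟩, ⟨24, 7859851, 2163723⟩, ⟨6, 2030035, 1882577⟩, ⟨5, 2087472,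
    530448⟩, ⟨3, 16531480, 4735000⟩, ⟨1, 253854, 2190⟩, ⟨4, 1964212, 1372164⟩, ⟨8, 7316571,
    2326529⟩, ⟨25, 253949, 118953⟩, ⟨13, 5357600, 4243456⟩, ⟨25, 245759, 1946⟩, ⟨17, 784382,
    599672⟩, ⟨2, 260095, 160865⟩, ⟨14, 196603, 189074⟩, ⟨9, 6200383, 430134⟩, ⟨23, 8355711,
    8066371⟩, ⟨6, 2097151, 1746836⟩, ⟨14, 262143, 136844⟩, ⟨25, 262143, 101991⟩, ⟨3, 30791695,
    12668940⟩, ⟨1, 262143, 177750⟩, ⟨12, 12079805, 2117785⟩, ⟨8, 16146014, 10754572⟩, ⟨13,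
    16510842, 1302592⟩, ⟨7, 1965439, 1599595⟩, ⟨6, 2029567, 1873452⟩, ⟨36, 132112863, 51282077⟩,
    ⟨9, 16645631, 10525726⟩, ⟨41, 31699711, 25362566⟩, ⟨4, 2097151, 234437⟩, ⟨30, 8388607,
    8383036⟩, ⟨42, 8388607, 3360953⟩, ⟨7, 2097143, 851492⟩, ⟨41, 134217727, 26657922⟩, ⟨26,
    134217727, 100367919⟩]) (by decide +kernel))

theorem crossCovered_crossFamily_24832 : crossCovered (crossFamily 24832) := .of_refine 19 15 rfl
  (crossCovered_of_check (hs := [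
    ⟨0, 2192, 2048⟩, ⟨0, 2224, 2224⟩, ⟨1, 84168, 67784⟩, ⟨1, 108672, 0⟩, ⟨0, 7990, 7440⟩, ⟨25,
    261100, 194664⟩, ⟨14, 196563, 167186⟩, ⟨0, 8191, 5846⟩, ⟨46, 251378687, 10621127⟩])
    (by decide +kernel))
  (crossCovered_of_check (hs := [
    ⟨0, 7936, 1024⟩, ⟨0, 7008, 6720⟩, ⟨0, 7936, 5376⟩, ⟨0, 6960, 6704⟩, ⟨14, 196288, 160896⟩, ⟨0,
    8038, 6434⟩, ⟨25, 98112, 87552⟩, ⟨1, 63488, 47104⟩, ⟨2, 260549, 106949⟩, ⟨14, 227672, 208976⟩,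
    ⟨25, 192737, 180352⟩, ⟨1, 228545, 198657⟩, ⟨22, 2533632, 428288⟩, ⟨14, 90816, 82048⟩, ⟨25,
    210704, 71168⟩, ⟨1, 122624, 22528⟩, ⟨14, 196275, 136194⟩, ⟨29, 2097151, 774016⟩, ⟨3, 7700512,
    3145728⟩, ⟨5, 2060316, 675868⟩, ⟨17, 827200, 790592⟩, ⟨14, 175428, 172032⟩, ⟨7, 1038352,
    278544⟩, ⟨14, 258031, 84643⟩, ⟨3, 7718912, 4278272⟩, ⟨5, 1026052, 722948⟩, ⟨25, 262139,
    21928⟩, ⟨25, 262138, 202320⟩, ⟨25, 253543, 85540⟩, ⟨13, 10176762, 1788154⟩, ⟨8, 6627328,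
    6619136⟩, ⟨4, 1964196, 1372164⟩, ⟨9, 9799828, 9472148⟩, ⟨29, 2096379, 1039611⟩, ⟨2, 262143,
    112320⟩, ⟨3, 16252303, 346127⟩, ⟨25, 262143, 57763⟩, ⟨7, 2088927, 970718⟩, ⟨32, 8306655,
    6329494⟩, ⟨43, 8388444, 4311640⟩, ⟨44, 8386550, 7411430⟩, ⟨3, 29359031, 19519638⟩, ⟨5,
    2097087, 1764895⟩, ⟨40, 50052539, 6365499⟩, ⟨13, 16777213, 1014013⟩, ⟨5, 2064383, 983195⟩,
    ⟨45, 30932008, 17857544⟩, ⟨27, 8388607, 3584229⟩, ⟨3, 33554431, 14198814⟩]) (by decide +kernel))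

theorem crossCovered_crossFamily_2304 : crossCovered (crossFamily 2304) := .of_refine 19 15 rfl
  (crossCovered_of_check (hs := [
    ⟨0, 7168, 3072⟩, ⟨0, 3476, 388⟩, ⟨1, 108736, 2048⟩, ⟨1, 84161, 16448⟩, ⟨0, 8180, 2820⟩, ⟨2,
    112896, 14336⟩, ⟨0, 3537, 336⟩, ⟨0, 6454, 4132⟩, ⟨2, 61384, 26120⟩, ⟨14, 163535, 134661⟩, ⟨1,
    245409, 177696⟩, ⟨25, 260591, 186439⟩, ⟨24, 8146767, 4458246⟩, ⟨1, 261737, 18504⟩, ⟨0, 8183,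
    4694⟩, ⟨1, 50881, 34304⟩, ⟨14, 260859, 137243⟩, ⟨2, 131071, 106954⟩, ⟨30, 5728765, 5521693⟩,
    ⟨25, 261583, 23626⟩, ⟨0, 8047, 871⟩, ⟨1, 192127, 19054⟩, ⟨14, 261855, 166912⟩, ⟨47, 265543355,
    194026641⟩]) (by decide +kernel))
  (crossCovered_of_check (hs := [
    ⟨0, 7936, 3840⟩, ⟨0, 2608, 2096⟩, ⟨0, 8096, 3200⟩, ⟨1, 23680, 22656⟩, ⟨2, 106944, 8384⟩, ⟨0,
    7329, 6273⟩, ⟨2, 254266, 188682⟩, ⟨1, 244160, 0⟩, ⟨1, 84288, 67904⟩, ⟨2, 112896, 33024⟩, ⟨1,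
    260577, 59744⟩, ⟨0, 8178, 1120⟩, ⟨25, 218048, 20672⟩, ⟨14, 162497, 137728⟩, ⟨1, 126945,
    60960⟩, ⟨2, 260545, 168065⟩, ⟨2, 96704, 18752⟩, ⟨5, 1990453, 675860⟩, ⟨13, 1954808, 315392⟩,
    ⟨7, 1286195, 1245232⟩, ⟨5, 1866182, 1866048⟩, ⟨12, 3085520, 852160⟩, ⟨14, 262143, 255284⟩,
    ⟨25, 262143, 12264⟩, ⟨24, 8257535, 6881169⟩, ⟨0, 8191, 3300⟩, ⟨7, 1964797, 391409⟩, ⟨14,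
    262143, 168819⟩, ⟨1, 262143, 145144⟩, ⟨5, 1177367, 4118⟩, ⟨23, 6029180, 222804⟩, ⟨22, 8388607,
    6925582⟩, ⟨2, 262143, 260352⟩, ⟨6, 1826733, 1164941⟩, ⟨25, 262143, 97290⟩, ⟨13, 16710460,
    16144436⟩, ⟨4, 1535931, 1388443⟩, ⟨8, 16776958, 10462216⟩, ⟨12, 11501010, 797122⟩, ⟨27,
    7339519, 2387157⟩, ⟨6, 2097151, 1599449⟩]) (by decide +kernel))

theorem crossCovered_crossFamily_18688 : crossCovered (crossFamily 18688) := .of_refine 19 15 rfl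
  (crossCovered_of_check (hs := [
    ⟨0, 3712, 3072⟩, ⟨0, 7936, 2816⟩, ⟨0, 7368, 3208⟩, ⟨14, 108288, 107008⟩, ⟨25, 219109, 17348⟩,
    ⟨1, 244096, 0⟩, ⟨25, 260557, 182348⟩, ⟨14, 191068, 174084⟩, ⟨25, 219971, 23360⟩, ⟨2, 262143,
    15599⟩, ⟨1, 259445, 325⟩, ⟨1, 220796, 137812⟩, ⟨7, 1372677, 1052676⟩, ⟨0, 7911, 3808⟩, ⟨0,
    7999, 4613⟩, ⟨1, 261055, 133646⟩, ⟨2, 196585, 155137⟩, ⟨48, 3557503, 149584⟩])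
    (by decide +kernel))
  (crossCovered_of_check (hs := [
    ⟨0, 3712, 1152⟩, ⟨0, 7936, 1792⟩, ⟨1, 89536, 88512⟩, ⟨0, 7014, 6432⟩, ⟨2, 90304, 82112⟩, ⟨14,
    175976, 172800⟩, ⟨1, 262113, 244193⟩, ⟨0, 4048, 3136⟩, ⟨0, 8025, 6673⟩, ⟨14, 160449, 143360⟩,
    ⟨1, 134848, 192⟩, ⟨2, 260533, 260484⟩, ⟨25, 250105, 180456⟩, ⟨14, 196243, 180754⟩, ⟨2, 74050,
    322⟩, ⟨7, 1284228, 1284228⟩, ⟨13, 3432474, 1335298⟩, ⟨0, 7145, 6464⟩, ⟨0, 8191, 4853⟩, ⟨7,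
    1025584, 327712⟩, ⟨2, 262138, 182026⟩, ⟨2, 261887, 70879⟩, ⟨17, 2097087, 862345⟩, ⟨25, 260095,
    21202⟩, ⟨14, 262143, 170322⟩, ⟨1, 229375, 150058⟩, ⟨0, 8191, 3768⟩, ⟨27, 3668980, 3467508⟩,
    ⟨7, 1759229, 151788⟩, ⟨0, 8191, 6629⟩, ⟨3, 8732673, 8404993⟩]) (by decide +kernel))

theorem crossCovered_crossFamily_26880 : crossCovered (crossFamily 26880) := .of_refine 19 15 rfl
  (crossCovered_of_check (hs := [
    ⟨0, 3216, 1024⟩, ⟨0, 7028, 2928⟩, ⟨0, 2240, 128⟩, ⟨0, 3832, 3160⟩, ⟨1, 93441, 18688⟩, ⟨14,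
    183092, 165924⟩, ⟨25, 252972, 154636⟩, ⟨1, 261281, 16417⟩, ⟨0, 6527, 4219⟩, ⟨14, 206634,
    132098⟩, ⟨29, 2097151, 187156⟩, ⟨31, 7766143, 3538955⟩, ⟨25, 259373, 53549⟩])
    (by decide +kernel))
  (crossCovered_of_check (hs := [
    ⟨0, 3216, 1168⟩, ⟨0, 3474, 1024⟩, ⟨1, 245728, 242144⟩, ⟨2, 106949, 106949⟩, ⟨1, 69600, 66016⟩,
    ⟨0, 6193, 6176⟩, ⟨0, 7629, 1345⟩, ⟨25, 193150, 188456⟩, ⟨2, 259212, 229388⟩, ⟨0, 8191, 4696⟩,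
    ⟨14, 262132, 245812⟩, ⟨0, 8191, 6527⟩, ⟨25, 261956, 128516⟩, ⟨27, 7176157, 2387161⟩, ⟨7,
    513789, 413884⟩, ⟨0, 7167, 4372⟩, ⟨3, 792622, 526350⟩, ⟨7, 2097151, 661990⟩])
    (by decide +kernel))

theorem crossCovered_crossFamily_26752 : crossCovered (crossFamily 26752) := .of_refine 19 15 rfl
  (crossCovered_of_check (hs := [
    ⟨0, 6240, 6240⟩, ⟨0, 2752, 640⟩, ⟨0, 2384, 336⟩, ⟨2, 260549, 65541⟩, ⟨1, 80128, 65792⟩, ⟨0,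
    7409, 7169⟩, ⟨1, 2241, 2241⟩, ⟨2, 223173, 147904⟩, ⟨2, 131015, 108993⟩, ⟨35, 34341017, 524441⟩])
    (by decide +kernel))
  (crossCovered_of_check (hs := [
    ⟨0, 6464, 6464⟩, ⟨0, 3712, 3712⟩, ⟨14, 156220, 155696⟩, ⟨25, 64559, 60462⟩, ⟨2, 112896,
    33024⟩, ⟨1, 88481, 65952⟩, ⟨2, 160455, 4293⟩, ⟨0, 8130, 6912⟩, ⟨14, 253922, 249474⟩, ⟨0, 8121,
    7353⟩, ⟨1, 220649, 219625⟩, ⟨2, 108821, 98581⟩, ⟨2, 93389, 10441⟩, ⟨14, 259999, 255774⟩, ⟨25,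
    262095, 222597⟩, ⟨23, 7339903, 2879074⟩, ⟨0, 7903, 7192⟩, ⟨25, 262143, 247486⟩, ⟨0, 8191,
    1378⟩, ⟨2, 262143, 186825⟩, ⟨5, 2096766, 923774⟩, ⟨6, 2096766, 481398⟩, ⟨2, 262143, 255⟩, ⟨24,
    6291391, 1989810⟩, ⟨31, 6289279, 6221948⟩, ⟨44, 8388607, 7337312⟩, ⟨7, 2097087, 225694⟩, ⟨1,
    262143, 90584⟩, ⟨4, 1703925, 1112564⟩, ⟨45, 32505855, 15695012⟩, ⟨42, 8388607, 6024433⟩, ⟨39,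
    6291455, 6248179⟩]) (by decide +kernel))

theorem crossCovered_crossFamily_384 : crossCovered (crossFamily 384) := .of_refine 19 15 rfl
  (crossCovered_of_check (hs := [
    ⟨0, 7936, 3072⟩, ⟨0, 3986, 2816⟩, ⟨0, 3986, 2960⟩, ⟨1, 202944, 2048⟩, ⟨1, 88320, 4096⟩, ⟨2,
    114624, 7680⟩, ⟨0, 8167, 3782⟩, ⟨1, 259521, 259456⟩, ⟨0, 8178, 5330⟩, ⟨1, 18433, 2048⟩, ⟨2,
    112901, 71685⟩, ⟨0, 8063, 4696⟩, ⟨0, 8063, 1319⟩, ⟨1, 262101, 18501⟩, ⟨25, 262126, 1930⟩, ⟨14,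
    245587, 69698⟩, ⟨1, 262143, 229694⟩, ⟨14, 189306, 49730⟩, ⟨13, 16777215, 1574671⟩, ⟨1, 262143,
    243432⟩, ⟨2, 257983, 184111⟩, ⟨0, 3287, 3223⟩, ⟨0, 8063, 6728⟩, ⟨14, 262127, 176013⟩, ⟨32,
    8239006, 1909534⟩, ⟨27, 4062207, 111421⟩, ⟨2, 262143, 186121⟩, ⟨25, 262143, 207721⟩, ⟨40,
    49526831, 13768743⟩, ⟨13, 4581181, 4294461⟩, ⟨28, 8388607, 5658611⟩]) (by decide +kernel))
  (crossCovered_of_check (hs := [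
    ⟨0, 7936, 1024⟩, ⟨0, 7936, 4864⟩, ⟨2, 106752, 98560⟩, ⟨0, 8178, 5362⟩, ⟨2, 106752, 0⟩, ⟨1,
    220665, 201153⟩, ⟨0, 7321, 4240⟩, ⟨1, 258497, 258497⟩, ⟨2, 73728, 65536⟩, ⟨1, 245728, 68032⟩,
    ⟨0, 8029, 6660⟩, ⟨0, 8185, 4368⟩, ⟨25, 208324, 206916⟩, ⟨0, 8154, 6464⟩, ⟨14, 252913, 183089⟩,
    ⟨1, 262113, 177696⟩, ⟨2, 238064, 164144⟩, ⟨0, 8029, 1361⟩, ⟨3, 13926401, 5537793⟩, ⟨25,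
    242915, 38016⟩, ⟨0, 8109, 3753⟩, ⟨7, 1572404, 86032⟩, ⟨9, 16740349, 8079444⟩, ⟨6, 1036777,
    725321⟩, ⟨29, 2097151, 2037322⟩, ⟨4, 2061745, 2061728⟩, ⟨0, 8191, 1325⟩, ⟨14, 262047, 209921⟩,
    ⟨1, 261692, 67644⟩, ⟨14, 262143, 15587⟩, ⟨1, 262143, 56890⟩, ⟨22, 7323318, 3090086⟩, ⟨40,
    48675321, 14950848⟩, ⟨6, 2018175, 1081868⟩, ⟨17, 2097151, 452006⟩, ⟨27, 4142991, 1311883⟩,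
    ⟨12, 12996159, 4459012⟩, ⟨8, 8316382, 1844694⟩]) (by decide +kernel))

theorem crossCovered_crossFamily_16768 : crossCovered (crossFamily 16768) := .of_refine 19 15 rfl
  (crossCovered_of_check (hs := [
    ⟨0, 3712, 3072⟩, ⟨0, 3986, 914⟩, ⟨0, 4018, 2816⟩, ⟨0, 2096, 32⟩, ⟨14, 75264, 8192⟩, ⟨1,
    243924, 2068⟩, ⟨14, 226921, 94313⟩, ⟨25, 252920, 186472⟩, ⟨1, 226777, 73⟩, ⟨25, 253439,
    148574⟩, ⟨14, 25112, 16384⟩, ⟨1, 262133, 201460⟩, ⟨14, 262126, 165958⟩, ⟨1, 121853, 20560⟩,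
    ⟨14, 262143, 256283⟩, ⟨7, 2097151, 1906765⟩]) (by decide +kernel))
  (crossCovered_of_check (hs := [
    ⟨0, 3712, 3200⟩, ⟨0, 7936, 6912⟩, ⟨0, 7632, 3136⟩, ⟨1, 260577, 242113⟩, ⟨14, 195264, 191104⟩,
    ⟨2, 74180, 452⟩, ⟨14, 59057, 57520⟩, ⟨1, 105665, 65729⟩, ⟨2, 73856, 65664⟩, ⟨14, 250440,
    180232⟩, ⟨0, 2875, 555⟩, ⟨1, 224505, 2113⟩, ⟨0, 8159, 3738⟩, ⟨7, 1128964, 1052672⟩, ⟨25,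
    229183, 97323⟩, ⟨14, 259279, 118986⟩, ⟨0, 8191, 1039⟩, ⟨27, 6283256, 838888⟩, ⟨25, 262062,
    227370⟩, ⟨1, 188127, 4300⟩, ⟨24, 8125597, 2692237⟩, ⟨23, 7331823, 2720993⟩, ⟨2, 262143, 4232⟩,
    ⟨40, 65468797, 35954957⟩, ⟨22, 8388607, 6469713⟩, ⟨14, 262143, 256298⟩, ⟨2, 262143, 40762⟩,
    ⟨23, 8388527, 108198⟩, ⟨17, 2097151, 455841⟩, ⟨5, 2056191, 1972684⟩, ⟨24, 8388607, 4525799⟩,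
    ⟨42, 8388479, 1518705⟩, ⟨3, 33419007, 29157475⟩]) (by decide +kernel))

theorem crossCovered_crossFamily_24960 : crossCovered (crossFamily 24960) := .of_refine 19 15 rfl
  (crossCovered_of_check (hs := [
    ⟨0, 2176, 2176⟩, ⟨0, 3472, 3072⟩, ⟨1, 2048, 0⟩, ⟨14, 242555, 172827⟩, ⟨25, 188349, 51244⟩,
    ⟨31, 2162751, 65595⟩]) (by decide +kernel))
  (crossCovered_of_check (hs := [
    ⟨0, 7936, 1024⟩, ⟨0, 7936, 4864⟩, ⟨0, 7352, 7352⟩, ⟨1, 258496, 242112⟩, ⟨2, 106821, 33093⟩,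
    ⟨1, 253425, 219601⟩, ⟨25, 249221, 117765⟩, ⟨14, 251885, 247465⟩, ⟨1, 262112, 84416⟩, ⟨2,
    125361, 8320⟩, ⟨0, 7423, 1274⟩, ⟨14, 226665, 222472⟩, ⟨0, 7133, 6660⟩, ⟨1, 85952, 65984⟩, ⟨2,
    195437, 57613⟩, ⟨17, 1897215, 844027⟩, ⟨49, 67108408, 3797048⟩, ⟨50, 49012249, 118801⟩, ⟨2,
    262143, 4289⟩, ⟨23, 8388607, 4302759⟩, ⟨22, 8388607, 6330865⟩, ⟨1, 65534, 16862⟩, ⟨46,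
    133675518, 94769654⟩, ⟨32, 8388603, 7212216⟩]) (by decide +kernel))

theorem crossCovered_crossFamily_2432 : crossCovered (crossFamily 2432) := .of_refine 19 15 rfl
  (crossCovered_of_check (hs := [
    ⟨0, 7936, 768⟩, ⟨0, 7936, 3072⟩, ⟨0, 8086, 4868⟩, ⟨0, 2964, 2964⟩, ⟨1, 258432, 0⟩, ⟨0, 8178,
    7410⟩, ⟨0, 8068, 3844⟩, ⟨14, 191064, 174104⟩, ⟨25, 219489, 22625⟩, ⟨17, 2097124, 1776388⟩, ⟨1,
    84457, 66017⟩, ⟨5, 658441, 8⟩]) (by decide +kernel))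
  (crossCovered_of_check (hs := [
    ⟨0, 2818, 2816⟩, ⟨0, 7936, 3072⟩, ⟨0, 6354, 6290⟩, ⟨1, 260577, 260577⟩, ⟨2, 106944, 8384⟩, ⟨2,
    114480, 33024⟩, ⟨1, 261345, 219361⟩, ⟨0, 8182, 7414⟩, ⟨2, 238026, 229642⟩, ⟨1, 194593, 18464⟩,
    ⟨0, 7168, 4096⟩, ⟨2, 109088, 40960⟩, ⟨1, 204257, 65985⟩, ⟨0, 8170, 1994⟩, ⟨2, 128436, 82176⟩,
    ⟨1, 126913, 60928⟩, ⟨14, 174812, 166428⟩, ⟨25, 154467, 22627⟩, ⟨2, 110560, 192⟩, ⟨2, 260991,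
    258827⟩, ⟨25, 262135, 40848⟩, ⟨32, 3087402, 3085312⟩, ⟨2, 225791, 221542⟩, ⟨27, 7338495,
    2549969⟩, ⟨14, 261103, 27072⟩, ⟨51, 4029663, 1384530⟩, ⟨25, 262143, 238413⟩, ⟨52, 132089707,
    89948514⟩, ⟨22, 8380415, 3624872⟩, ⟨14, 262113, 257537⟩, ⟨24, 8388571, 7067536⟩, ⟨25, 262143,
    259150⟩, ⟨25, 262143, 116835⟩, ⟨7, 1650359, 1048756⟩, ⟨4, 1506035, 1079923⟩, ⟨53, 191621999,
    187400998⟩, ⟨54, 57132538, 17008064⟩, ⟨23, 8388607, 7223560⟩]) (by decide +kernel))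

theorem crossCovered_crossFamily_18816 : crossCovered (crossFamily 18816) := .of_refine 19 15 rfl
  (crossCovered_of_check (hs := [
    ⟨0, 3712, 3072⟩, ⟨0, 3986, 2816⟩, ⟨0, 7840, 1696⟩, ⟨14, 212808, 207360⟩, ⟨0, 3990, 918⟩, ⟨25,
    188392, 187496⟩, ⟨14, 193881, 53313⟩, ⟨0, 3768, 1208⟩, ⟨1, 240004, 2052⟩, ⟨14, 174930,
    174082⟩, ⟨7, 1404963, 1052707⟩, ⟨25, 260083, 148418⟩, ⟨25, 256607, 51798⟩, ⟨14, 240507,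
    163851⟩, ⟨14, 228219, 94563⟩, ⟨1, 130557, 84461⟩, ⟨14, 245743, 240230⟩, ⟨1, 262143, 20845⟩])
    (by decide +kernel))
  (crossCovered_of_check (hs := [
    ⟨0, 3712, 1152⟩, ⟨0, 7936, 4864⟩, ⟨0, 7942, 1796⟩, ⟨14, 195088, 190480⟩, ⟨2, 90580, 16836⟩,
    ⟨0, 4050, 1088⟩, ⟨14, 58036, 58020⟩, ⟨1, 212449, 66017⟩, ⟨14, 74496, 74240⟩, ⟨2, 129813,
    114965⟩, ⟨1, 155131, 4587⟩, ⟨2, 90356, 8388⟩, ⟨0, 8127, 6842⟩, ⟨25, 216814, 215144⟩, ⟨14,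
    227069, 94448⟩, ⟨0, 7935, 1712⟩, ⟨1, 262137, 7113⟩, ⟨2, 118782, 115116⟩, ⟨0, 8183, 7493⟩, ⟨17,
    1892334, 316618⟩, ⟨14, 126681, 60056⟩, ⟨27, 5733374, 280810⟩, ⟨42, 7797743, 7506122⟩, ⟨13,
    11810014, 8650946⟩, ⟨14, 174970, 172298⟩, ⟨0, 8191, 2018⟩, ⟨14, 261631, 121298⟩, ⟨2, 244407,
    163874⟩, ⟨1, 262143, 49763⟩, ⟨40, 32439678, 2385216⟩]) (by decide +kernel))

theorem crossCovered_crossFamily_27008 : crossCovered (crossFamily 27008) := .of_refine 19 15 rfl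
  (crossCovered_of_check (hs := [
    ⟨0, 3216, 3072⟩, ⟨0, 3986, 2962⟩, ⟨0, 3537, 3281⟩, ⟨0, 6376, 6312⟩, ⟨1, 108672, 2048⟩, ⟨0,
    3547, 1499⟩, ⟨14, 192018, 175122⟩, ⟨25, 188136, 182376⟩, ⟨0, 8191, 4877⟩, ⟨31, 3135087,
    3035243⟩, ⟨14, 262143, 183998⟩]) (by decide +kernel))
  (crossCovered_of_check (hs := [
    ⟨0, 3712, 1152⟩, ⟨0, 6752, 6752⟩, ⟨0, 2354, 274⟩, ⟨1, 215521, 197057⟩, ⟨2, 47393, 33025⟩, ⟨0,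
    3475, 3072⟩, ⟨0, 7165, 6525⟩, ⟨25, 257431, 257045⟩, ⟨2, 254456, 8392⟩, ⟨14, 253773, 183813⟩,
    ⟨0, 3839, 1712⟩, ⟨1, 245153, 68000⟩, ⟨14, 192319, 189751⟩, ⟨2, 241911, 241889⟩, ⟨17, 1883903,
    828635⟩, ⟨25, 262143, 192663⟩, ⟨2, 262127, 231630⟩, ⟨32, 8388607, 7281909⟩, ⟨5, 2096959,
    917516⟩, ⟨31, 6289279, 6287483⟩, ⟨55, 67108863, 44435966⟩]) (by decide +kernel))

theorem crossCovered_crossFamily_24848 : crossCovered (crossFamily 24848) := .of_refine 19 15 rfl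
  (crossCovered_of_check (hs := [
    ⟨0, 2240, 0⟩, ⟨0, 2240, 2240⟩, ⟨1, 2103, 22⟩]) (by decide +kernel))
  (crossCovered_of_check (hs := [
    ⟨0, 7936, 7680⟩, ⟨0, 6752, 4160⟩, ⟨0, 2752, 0⟩, ⟨0, 3712, 3200⟩, ⟨25, 247700, 99844⟩, ⟨14,
    147264, 136704⟩, ⟨2, 260224, 32896⟩, ⟨1, 227809, 145408⟩, ⟨25, 243936, 163968⟩, ⟨0, 7638,
    3136⟩, ⟨0, 8166, 6274⟩, ⟨14, 226273, 82561⟩, ⟨29, 2022208, 969536⟩, ⟨23, 6513666, 73728⟩, ⟨1,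
    262123, 14561⟩, ⟨25, 97106, 70224⟩, ⟨0, 8190, 3158⟩, ⟨17, 2072516, 262144⟩, ⟨14, 97116,
    77888⟩, ⟨25, 218593, 152992⟩, ⟨17, 1856262, 278534⟩, ⟨14, 78656, 78336⟩, ⟨22, 6940672,
    4237312⟩, ⟨3, 29788160, 29362176⟩, ⟨25, 220983, 67109⟩, ⟨14, 262119, 89473⟩, ⟨1, 260607,
    246063⟩, ⟨1, 227817, 159969⟩, ⟨9, 11905024, 9799680⟩, ⟨25, 262142, 171966⟩, ⟨24, 1047288,
    326248⟩, ⟨25, 94715, 20616⟩, ⟨12, 11245247, 2101381⟩, ⟨14, 262143, 221373⟩, ⟨29, 2097151,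
    216992⟩, ⟨3, 16109680, 3194880⟩, ⟨23, 7595323, 3237177⟩, ⟨14, 262143, 209009⟩, ⟨25, 262143,
    177869⟩, ⟨25, 262143, 143048⟩, ⟨6, 2096639, 4162⟩, ⟨31, 7733247, 2228217⟩, ⟨39, 3407855,
    3310601⟩, ⟨32, 6216127, 5148955⟩, ⟨14, 128703, 70791⟩, ⟨44, 3880313, 144760⟩, ⟨1, 249835,
    182497⟩, ⟨7, 2097151, 1532185⟩, ⟨16, 16744191, 7687708⟩, ⟨11, 16774143, 9179288⟩, ⟨10,
    16777215, 9449472⟩, ⟨56, 16711423, 11456247⟩, ⟨5, 2097151, 1618888⟩, ⟨57, 17179869183,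
    13110858037⟩, ⟨58, 1073741823, 586145783⟩, ⟨59, 1073741823, 993786739⟩, ⟨60, 17179869183,
    12400409187⟩]) (by decide +kernel))

theorem crossCovered_crossFamily_18704 : crossCovered (crossFamily 18704) := .of_refine 19 15 rfl
  (crossCovered_of_check (hs := [
    ⟨0, 2096, 0⟩, ⟨0, 2100, 52⟩, ⟨25, 254065, 16448⟩, ⟨2, 261631, 8197⟩, ⟨0, 3580, 3352⟩, ⟨25,
    252600, 4744⟩, ⟨25, 257878, 181060⟩, ⟨0, 3775, 1195⟩, ⟨22, 4997053, 273200⟩])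
    (by decide +kernel))
  (crossCovered_of_check (hs := [
    ⟨0, 3712, 3200⟩, ⟨0, 7936, 6144⟩, ⟨0, 7936, 3840⟩, ⟨2, 108800, 106752⟩, ⟨0, 3986, 1024⟩, ⟨0,
    8037, 6501⟩, ⟨2, 74016, 8192⟩, ⟨17, 2097124, 320708⟩, ⟨1, 260577, 242144⟩, ⟨25, 226024,
    29408⟩, ⟨14, 175979, 164643⟩, ⟨2, 228213, 227652⟩, ⟨1, 196580, 31204⟩, ⟨0, 8191, 6683⟩, ⟨25,
    220906, 84010⟩, ⟨22, 7858938, 436960⟩, ⟨25, 262045, 99845⟩, ⟨48, 5488747, 245826⟩, ⟨25,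
    244973, 32940⟩]) (by decide +kernel))

theorem crossCovered_crossFamily_26896 : crossCovered (crossFamily 26896) := .of_refine 19 15 rfl
  (crossCovered_of_check (hs := [
    ⟨0, 2096, 2048⟩, ⟨0, 6256, 2160⟩, ⟨0, 6832, 4112⟩, ⟨1, 223713, 18432⟩, ⟨14, 223740, 141504⟩,
    ⟨0, 7979, 7713⟩, ⟨25, 259959, 17220⟩]) (by decide +kernel))
  (crossCovered_of_check (hs := [
    ⟨0, 3216, 1168⟩, ⟨0, 7936, 4096⟩, ⟨0, 3474, 3328⟩, ⟨1, 258496, 258496⟩, ⟨17, 2097124, 844996⟩,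
    ⟨2, 106949, 106949⟩, ⟨17, 1839639, 786436⟩, ⟨0, 8182, 1122⟩, ⟨0, 7423, 4341⟩, ⟨2, 205287,
    65735⟩, ⟨14, 64367, 57894⟩]) (by decide +kernel))

theorem crossCovered_crossFamily_2448 : crossCovered (crossFamily 2448) := .of_refine 19 15 rfl
  (crossCovered_of_check (hs := [
    ⟨0, 2112, 2048⟩, ⟨17, 586980, 0⟩]) (by decide +kernel))
  (crossCovered_of_check (hs := [
    ⟨0, 2820, 0⟩, ⟨0, 2948, 900⟩, ⟨0, 3056, 864⟩, ⟨14, 8960, 8192⟩, ⟨17, 2097124, 324804⟩, ⟨0,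
    3016, 2824⟩, ⟨17, 2063140, 1796900⟩, ⟨2, 125437, 10444⟩, ⟨2, 109055, 98561⟩, ⟨0, 3062, 100⟩,
    ⟨1, 126945, 84449⟩, ⟨25, 218007, 147591⟩, ⟨25, 219027, 70417⟩, ⟨0, 7671, 3472⟩, ⟨1, 126975,
    42497⟩, ⟨2, 131039, 32476⟩, ⟨0, 8191, 4716⟩, ⟨2, 228525, 154665⟩, ⟨25, 262143, 187875⟩, ⟨24,
    8388571, 5132169⟩, ⟨2, 228927, 52⟩, ⟨61, 33554365, 17503420⟩, ⟨0, 8191, 1861⟩, ⟨14, 262143,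
    255861⟩, ⟨62, 44196267, 41943073⟩, ⟨27, 3843223, 8192⟩]) (by decide +kernel))

theorem crossCovered_crossFamily_18832 : crossCovered (crossFamily 18832) := .of_refine 19 15 rfl
  (crossCovered_of_check (hs := [
    ⟨0, 2240, 2048⟩, ⟨17, 586980, 528384⟩]) (by decide +kernel))
  (crossCovered_of_check (hs := [
    ⟨0, 3712, 1152⟩, ⟨0, 8064, 4864⟩, ⟨0, 2144, 96⟩, ⟨0, 3028, 912⟩, ⟨1, 261089, 18432⟩, ⟨0, 8148,
    6288⟩, ⟨14, 57956, 49764⟩, ⟨2, 112900, 98564⟩, ⟨17, 2097124, 849120⟩, ⟨0, 8187, 1088⟩, ⟨2,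
    75920, 10368⟩, ⟨0, 8191, 3917⟩, ⟨0, 7915, 4776⟩, ⟨25, 227067, 81944⟩, ⟨17, 1965796, 296164⟩,
    ⟨14, 261869, 167941⟩, ⟨2, 261580, 193796⟩, ⟨1, 253695, 69856⟩, ⟨25, 262143, 173753⟩, ⟨0, 8191,
    3858⟩, ⟨2, 262135, 193⟩, ⟨42, 7753519, 1461281⟩]) (by decide +kernel))

theorem crossCovered_crossFamily_27024 : crossCovered (crossFamily 27024) := .of_refine 19 15 rfl
  (crossCovered_of_check (hs := [
    ⟨0, 2240, 2048⟩, ⟨17, 586980, 0⟩]) (by decide +kernel))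
  (crossCovered_of_check (hs := [
    ⟨0, 3216, 1168⟩, ⟨0, 6244, 6240⟩, ⟨0, 3474, 1280⟩, ⟨1, 219617, 201152⟩, ⟨17, 790532, 266240⟩,
    ⟨2, 66045, 472⟩]) (by decide +kernel))

theorem crossCovered_crossFamily_18692 : crossCovered (crossFamily 18692) := .of_refine 19 15 rfl
  (crossCovered_of_check (hs := [
    ⟨0, 7936, 768⟩, ⟨0, 3632, 3104⟩, ⟨0, 8064, 5376⟩, ⟨0, 8064, 3200⟩, ⟨14, 226690, 86018⟩, ⟨25,
    119859, 49168⟩, ⟨14, 191812, 165892⟩, ⟨25, 217140, 151588⟩, ⟨14, 107024, 106512⟩, ⟨0, 2100,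
    2080⟩, ⟨2, 243691, 13441⟩, ⟨0, 8179, 5506⟩, ⟨25, 218943, 153370⟩, ⟨1, 253951, 7135⟩, ⟨2,
    252887, 65940⟩, ⟨14, 229316, 209412⟩, ⟨0, 7932, 1140⟩, ⟨14, 196038, 51330⟩, ⟨25, 262075,
    171906⟩, ⟨25, 261167, 182313⟩, ⟨1, 196597, 193365⟩, ⟨4, 384518, 299526⟩, ⟨0, 8191, 6807⟩, ⟨1,
    172015, 2511⟩, ⟨25, 262127, 56899⟩, ⟨14, 262143, 188516⟩, ⟨3, 4003951, 1642568⟩, ⟨2, 262143,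
    155424⟩, ⟨1, 262143, 86362⟩, ⟨2, 262143, 20682⟩, ⟨44, 8388607, 3718054⟩, ⟨39, 8388607,
    8044793⟩, ⟨31, 6290431, 6070347⟩, ⟨8, 16776703, 11393178⟩, ⟨63, 8388095, 190661⟩])
    (by decide +kernel))
  (crossCovered_of_check (hs := [
    ⟨0, 3712, 3072⟩, ⟨0, 6464, 256⟩, ⟨0, 2736, 2224⟩, ⟨25, 219168, 149536⟩, ⟨14, 192076, 51716⟩,
    ⟨0, 6592, 2368⟩, ⟨25, 227285, 152512⟩, ⟨1, 258448, 16400⟩, ⟨14, 175491, 172289⟩, ⟨7, 334864,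
    269328⟩, ⟨25, 253915, 51226⟩, ⟨2, 98303, 15563⟩, ⟨14, 257759, 59916⟩, ⟨0, 8191, 4793⟩, ⟨1,
    262143, 29413⟩, ⟨25, 262143, 192739⟩, ⟨8, 663605, 655365⟩, ⟨1, 262143, 185208⟩])
    (by decide +kernel))

theorem crossCovered_crossFamily_10500 : crossCovered (crossFamily 10500) := .of_refine 19 15 rfl
  (crossCovered_of_check (hs := [
    ⟨0, 7936, 768⟩, ⟨0, 3344, 3072⟩, ⟨0, 6481, 2385⟩, ⟨14, 158518, 141348⟩, ⟨25, 219926, 149524⟩,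
    ⟨0, 8115, 4482⟩, ⟨14, 225616, 200784⟩, ⟨0, 3120, 3120⟩, ⟨25, 220471, 19476⟩, ⟨0, 3989, 2437⟩,
    ⟨25, 146432, 138240⟩, ⟨14, 156477, 139812⟩, ⟨1, 260971, 29248⟩, ⟨14, 225158, 222210⟩, ⟨1,
    258015, 28168⟩, ⟨25, 228213, 150081⟩, ⟨14, 223146, 206464⟩, ⟨25, 250263, 49168⟩, ⟨14, 125941,
    123408⟩, ⟨4, 1895581, 1097745⟩, ⟨1, 131071, 23116⟩, ⟨14, 128993, 102592⟩, ⟨25, 253373,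
    133545⟩, ⟨2, 262143, 259562⟩, ⟨25, 262047, 151195⟩, ⟨9, 11775037, 11766836⟩, ⟨1, 262143,
    26330⟩, ⟨64, 104644479, 103548176⟩]) (by decide +kernel))
  (crossCovered_of_check (hs := [
    ⟨0, 3344, 3088⟩, ⟨0, 6464, 2368⟩, ⟨0, 3538, 3072⟩, ⟨25, 250704, 16384⟩, ⟨0, 4032, 2304⟩, ⟨14,
    228048, 146112⟩, ⟨0, 7014, 4672⟩, ⟨25, 252440, 22552⟩, ⟨0, 8146, 1792⟩, ⟨1, 224683, 213291⟩,
    ⟨25, 219639, 18454⟩, ⟨2, 194625, 186433⟩, ⟨5, 806912, 266240⟩, ⟨1, 245758, 242154⟩, ⟨22,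
    516219, 376858⟩, ⟨2, 262143, 207469⟩, ⟨25, 262143, 11160⟩]) (by decide +kernel))

theorem crossCovered_crossFamily_26884 : crossCovered (crossFamily 26884) := .of_refine 19 15 rfl
  (crossCovered_of_check (hs := [
    ⟨0, 6464, 2368⟩, ⟨0, 3408, 1024⟩, ⟨0, 3778, 3136⟩, ⟨14, 79618, 77826⟩, ⟨25, 252822, 182294⟩,
    ⟨14, 156276, 139872⟩, ⟨0, 7297, 5249⟩, ⟨25, 152850, 17426⟩, ⟨14, 196479, 52258⟩, ⟨1, 122351,
    20810⟩, ⟨25, 251068, 49192⟩, ⟨14, 94130, 82962⟩, ⟨2, 262143, 34293⟩, ⟨0, 8189, 772⟩, ⟨39,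
    8387711, 8275056⟩, ⟨0, 8191, 3186⟩, ⟨3, 8210687, 5849160⟩]) (by decide +kernel))
  (crossCovered_of_check (hs := [
    ⟨0, 3216, 3216⟩, ⟨0, 2192, 0⟩, ⟨0, 8180, 500⟩, ⟨25, 250618, 49210⟩, ⟨1, 258504, 258504⟩, ⟨0,
    8112, 272⟩, ⟨0, 3577, 3240⟩, ⟨25, 185794, 181250⟩, ⟨1, 224699, 213307⟩, ⟨0, 8191, 1140⟩, ⟨2,
    221060, 388⟩]) (by decide +kernel))

theorem crossCovered_crossFamily_8580 : crossCovered (crossFamily 8580) := .of_refine 19 15 rfl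
  (crossCovered_of_check (hs := [
    ⟨0, 7936, 3072⟩, ⟨0, 3986, 2960⟩, ⟨0, 3986, 2816⟩, ⟨0, 7937, 5632⟩, ⟨25, 217477, 16388⟩, ⟨0,
    7025, 2336⟩, ⟨25, 217477, 196992⟩, ⟨0, 4019, 2449⟩, ⟨0, 7918, 6848⟩, ⟨25, 252804, 180228⟩, ⟨2,
    226815, 213263⟩, ⟨25, 220593, 66993⟩, ⟨0, 7479, 7191⟩, ⟨25, 256453, 172421⟩, ⟨0, 3046, 2340⟩,
    ⟨25, 122799, 115235⟩, ⟨25, 253327, 149512⟩, ⟨1, 229167, 97826⟩, ⟨2, 257787, 147649⟩, ⟨25,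
    262143, 103926⟩, ⟨65, 6381858, 2097408⟩, ⟨1, 262143, 179403⟩, ⟨14, 261855, 208512⟩, ⟨0, 8191,
    7386⟩, ⟨25, 187359, 53778⟩, ⟨25, 262143, 236427⟩, ⟨2, 262143, 99720⟩, ⟨66, 129884415,
    120144055⟩, ⟨25, 262143, 235983⟩, ⟨5, 2097143, 720341⟩]) (by decide +kernel))
  (crossCovered_of_check (hs := [
    ⟨0, 3344, 1024⟩, ⟨0, 3408, 2384⟩, ⟨0, 3408, 256⟩, ⟨25, 236096, 72256⟩, ⟨0, 3536, 3280⟩, ⟨25,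
    218096, 20480⟩, ⟨25, 236106, 137224⟩, ⟨1, 88322, 65794⟩, ⟨0, 8174, 3372⟩, ⟨25, 236155, 68184⟩,
    ⟨2, 195891, 15360⟩, ⟨25, 179807, 134681⟩, ⟨0, 6714, 26⟩, ⟨65, 5077653, 871060⟩, ⟨1, 96758,
    2356⟩, ⟨5, 475175, 475173⟩]) (by decide +kernel))

theorem crossCovered_crossFamily_24964 : crossCovered (crossFamily 24964) := .of_refine 19 15 rfl
  (crossCovered_of_check (hs := [
    ⟨0, 2194, 146⟩, ⟨0, 3537, 256⟩, ⟨0, 3536, 3072⟩, ⟨25, 121005, 53293⟩, ⟨25, 168992, 32800⟩, ⟨0,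
    8000, 5696⟩, ⟨0, 8093, 281⟩, ⟨25, 252869, 103364⟩, ⟨2, 125887, 16815⟩, ⟨25, 249973, 180228⟩,
    ⟨14, 26140, 16920⟩, ⟨0, 7999, 3105⟩, ⟨31, 7360687, 6295726⟩]) (by decide +kernel))
  (crossCovered_of_check (hs := [
    ⟨0, 3344, 1024⟩, ⟨0, 3408, 336⟩, ⟨0, 2944, 2432⟩, ⟨0, 3545, 3289⟩, ⟨1, 199112, 197064⟩, ⟨25,
    248808, 51240⟩, ⟨0, 6704, 4624⟩, ⟨2, 244727, 172465⟩, ⟨0, 8191, 4352⟩, ⟨2, 262143, 180271⟩,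
    ⟨31, 8388607, 5087378⟩]) (by decide +kernel))

theorem crossCovered_crossFamily_27012 : crossCovered (crossFamily 27012) := .of_refine 19 15 rfl
  (crossCovered_of_check (hs := [
    ⟨0, 2384, 336⟩, ⟨0, 3473, 1169⟩, ⟨0, 7505, 2305⟩, ⟨25, 251966, 55358⟩, ⟨0, 7993, 5665⟩, ⟨25,
    186302, 185406⟩, ⟨0, 8178, 3168⟩, ⟨2, 127957, 53717⟩, ⟨25, 193964, 192552⟩, ⟨2, 262143,
    13773⟩, ⟨25, 163315, 19475⟩]) (by decide +kernel))
  (crossCovered_of_check (hs := [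
    ⟨0, 3216, 3216⟩, ⟨0, 3472, 2304⟩, ⟨0, 3216, 1024⟩, ⟨0, 3538, 2514⟩, ⟨25, 54273, 21505⟩, ⟨1,
    76933, 2052⟩]) (by decide +kernel))

theorem crossCovered_crossFamily_26900 : crossCovered (crossFamily 26900) := .of_refine 19 15 rfl
  (crossCovered_of_check (hs := [
    ⟨0, 2116, 64⟩, ⟨14, 66054, 65542⟩, ⟨0, 8175, 4271⟩, ⟨25, 253183, 181334⟩, ⟨0, 3583, 1195⟩,
    ⟨14, 262143, 146146⟩]) (by decide +kernel))
  (crossCovered_of_check (hs := [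
    ⟨0, 2240, 2240⟩, ⟨0, 2240, 0⟩, ⟨1, 2068, 2068⟩]) (by decide +kernel))

theorem crossCovered_crossFamily_18836 : crossCovered (crossFamily 18836) := .of_refine 19 15 rfl
  (crossCovered_of_check (hs := [
    ⟨0, 2720, 160⟩, ⟨0, 3986, 2816⟩, ⟨0, 7012, 768⟩, ⟨14, 156734, 24612⟩, ⟨0, 3070, 2312⟩, ⟨0,
    2194, 2194⟩, ⟨25, 252694, 49156⟩, ⟨0, 2549, 2080⟩, ⟨2, 191949, 159116⟩, ⟨25, 259327, 57441⟩,
    ⟨0, 3838, 1142⟩, ⟨25, 262143, 31799⟩, ⟨2, 262085, 95620⟩]) (by decide +kernel))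
  (crossCovered_of_check (hs := [
    ⟨0, 2240, 2048⟩, ⟨17, 586980, 528384⟩]) (by decide +kernel))

theorem crossCovered_crossFamily_10644 : crossCovered (crossFamily 10644) := .of_refine 19 15 rfl
  (crossCovered_of_check (hs := [
    ⟨0, 2112, 64⟩, ⟨0, 7012, 4096⟩, ⟨0, 2802, 2706⟩, ⟨14, 8960, 8448⟩, ⟨25, 6162, 2066⟩])
    (by decide +kernel))
  (crossCovered_of_check (hs := [
    ⟨0, 2240, 2048⟩, ⟨17, 570596, 528384⟩]) (by decide +kernel))

theorem crossCovered_crossFamily_27028 : crossCovered (crossFamily 27028) := .of_refine 19 15 rfl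
  (crossCovered_of_check (hs := [
    ⟨0, 2129, 2129⟩, ⟨0, 2516, 2304⟩, ⟨14, 221747, 81955⟩, ⟨0, 3070, 238⟩, ⟨25, 246974, 181310⟩,
    ⟨14, 126235, 90112⟩]) (by decide +kernel))
  (crossCovered_of_check (hs := [
    ⟨0, 2240, 0⟩, ⟨0, 2244, 2240⟩, ⟨17, 586982, 4098⟩]) (by decide +kernel))

theorem crossCovered_crossFamily_27030 : crossCovered (crossFamily 27030) := .of_refine 19 15 rfl
  (crossCovered_of_check (hs := [
    ⟨0, 6244, 0⟩, ⟨0, 2161, 113⟩, ⟨29, 865535, 341247⟩]) (by decide +kernel))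
  (crossCovered_of_check (hs := [
    ⟨0, 2156, 8⟩, ⟨0, 2165, 2165⟩, ⟨1, 2071, 22⟩]) (by decide +kernel))

/-- Normal forms for the sets of odd-weight arm patterns, coded by the bits 1, 2, 4, 7, 8, 11, 13
and 14, under the symmetries of the cross and complementation. -/
def crossFamilyIndices : List ℕ :=
  [0, 16384, 24576, 18432, 26624, 16640, 24832, 2304, 18688, 26880, 26752, 384, 16768, 24960,
  2432, 18816, 27008, 24848, 18704, 26896, 2448, 18832, 27024, 18692, 10500, 26884, 8580, 24964,
  27012, 26900, 18836, 10644, 27028, 27030]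

theorem crossCovered_crossFamily : ∀ m ∈ crossFamilyIndices, crossCovered (crossFamily m) := by
  simp only [crossFamilyIndices, List.forall_mem_cons, List.not_mem_nil, false_imp_iff, forall_true_iff,
    and_true]
  exact ⟨crossCovered_crossFamily_0, crossCovered_crossFamily_16384, crossCovered_crossFamily_24576,
    crossCovered_crossFamily_18432, crossCovered_crossFamily_26624,
    crossCovered_crossFamily_16640, crossCovered_crossFamily_24832, crossCovered_crossFamily_2304,
    crossCovered_crossFamily_18688, crossCovered_crossFamily_26880,
    crossCovered_crossFamily_26752, crossCovered_crossFamily_384, crossCovered_crossFamily_16768,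
    crossCovered_crossFamily_24960, crossCovered_crossFamily_2432, crossCovered_crossFamily_18816,
    crossCovered_crossFamily_27008, crossCovered_crossFamily_24848,
    crossCovered_crossFamily_18704, crossCovered_crossFamily_26896, crossCovered_crossFamily_2448,
    crossCovered_crossFamily_18832, crossCovered_crossFamily_27024,
    crossCovered_crossFamily_18692, crossCovered_crossFamily_10500,
    crossCovered_crossFamily_26884, crossCovered_crossFamily_8580, crossCovered_crossFamily_24964,
    crossCovered_crossFamily_27012, crossCovered_crossFamily_26900,
    crossCovered_crossFamily_18836, crossCovered_crossFamily_10644,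
    crossCovered_crossFamily_27028, crossCovered_crossFamily_27030⟩

/-- The rules `r` that are permutive in their first arm when the centre holds `0`, with
`r 0 0 = r 1 0 = 0`. -/
def crossArmFamily : List Entry :=
  .zero :: List.replicate 7 .free ++ List.replicate 8 (.neg 7) ++ .same 15 :: List.replicate 15 .free

/-- Here 22 values are free. The two splits decide whether the centre is irrelevant at the arm
patterns 8 (only the first arm is one) and 4 (only the second). -/
theorem crossCovered_crossArmFamily : crossCovered crossArmFamily := .of_refine 24 15 rfl
  (.of_refine 20 15 rfl
  (crossCovered_of_check (hs := [
    ⟨0, 6336, 4224⟩, ⟨0, 6336, 4160⟩, ⟨0, 6336, 4288⟩, ⟨25, 201360, 135808⟩, ⟨14, 29360, 12976⟩,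
    ⟨1, 178688, 176640⟩, ⟨14, 29316, 8320⟩, ⟨25, 212490, 141824⟩, ⟨2, 196096, 155136⟩, ⟨0, 8143,
    4102⟩, ⟨25, 201664, 70592⟩, ⟨14, 80832, 6592⟩, ⟨25, 163342, 7690⟩, ⟨14, 130761, 121544⟩, ⟨0,
    6852, 6660⟩, ⟨1, 93966, 28160⟩, ⟨25, 177840, 144016⟩, ⟨14, 172672, 41600⟩, ⟨4, 2053640,
    2053640⟩, ⟨6, 1486336, 1486336⟩, ⟨44, 5652484, 0⟩, ⟨2, 254667, 246274⟩, ⟨14, 16069, 15557⟩,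
    ⟨1, 262143, 20007⟩, ⟨25, 168530, 168530⟩, ⟨9, 5664512, 5394176⟩, ⟨42, 6739882, 2118400⟩, ⟨39,
    7468425, 1139969⟩, ⟨23, 5226301, 4993340⟩, ⟨22, 6806495, 262927⟩, ⟨3, 25362816, 196992⟩, ⟨44,
    3295752, 2247176⟩, ⟨25, 227071, 139838⟩, ⟨14, 191211, 25323⟩, ⟨39, 2080169, 306433⟩, ⟨42,
    8143114, 4473088⟩, ⟨25, 250868, 66484⟩, ⟨4, 1988096, 1971712⟩, ⟨12, 5530112, 5530112⟩, ⟨45,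
    31822594, 768⟩, ⟨1, 192181, 181809⟩, ⟨8, 8044068, 5381636⟩, ⟨39, 3192256, 3158464⟩, ⟨14,
    161463, 148133⟩, ⟨0, 7935, 7231⟩, ⟨9, 16739837, 214325⟩, ⟨25, 250623, 573⟩, ⟨25, 262143,
    139970⟩, ⟨44, 7789272, 5692096⟩, ⟨42, 7656742, 6313254⟩, ⟨14, 261887, 160472⟩, ⟨25, 106255,
    103175⟩, ⟨9, 15085342, 4589340⟩, ⟨8, 11336198, 8444418⟩, ⟨14, 239054, 65674⟩, ⟨12, 11232252,
    8413496⟩, ⟨3, 32314772, 10552704⟩, ⟨2, 260607, 252272⟩, ⟨45, 33543002, 21332826⟩, ⟨22,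
    7863295, 7629589⟩, ⟨39, 4042025, 1584384⟩, ⟨42, 6607566, 20612⟩, ⟨25, 262143, 40483⟩, ⟨14,
    262143, 190407⟩, ⟨3, 15969982, 6368900⟩, ⟨1, 262143, 247485⟩, ⟨45, 24302416, 7525200⟩, ⟨4,
    487327, 485010⟩, ⟨8, 15645310, 8821316⟩, ⟨44, 7335871, 4392607⟩, ⟨42, 8116207, 3856294⟩, ⟨6,
    1832959, 570916⟩, ⟨8, 16711343, 13672064⟩, ⟨37, 134151765, 93208064⟩, ⟨39, 5634015, 1078162⟩,
    ⟨63, 8388607, 764119⟩, ⟨44, 8388607, 4135844⟩, ⟨3, 23035359, 5328325⟩]) (by decide +kernel))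
  (crossCovered_of_check (hs := [
    ⟨0, 6240, 6144⟩, ⟨0, 6592, 4544⟩, ⟨1, 51776, 33280⟩, ⟨2, 161984, 161984⟩, ⟨0, 6324, 6196⟩,
    ⟨14, 109248, 2752⟩, ⟨25, 137728, 131584⟩, ⟨14, 41616, 41616⟩, ⟨1, 31488, 29184⟩, ⟨4, 717314,
    553474⟩, ⟨6, 726273, 132096⟩, ⟨12, 8413728, 24576⟩, ⟨14, 227214, 201354⟩, ⟨1, 256980, 8896⟩,
    ⟨14, 79496, 71304⟩, ⟨0, 8187, 7771⟩, ⟨2, 254463, 188735⟩, ⟨14, 60048, 27264⟩, ⟨25, 201338,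
    201320⟩, ⟨6, 1915904, 1387520⟩, ⟨4, 1339994, 1335808⟩, ⟨9, 12332352, 1838400⟩, ⟨25, 163338,
    24072⟩, ⟨0, 8138, 7880⟩, ⟨3, 18519108, 17961984⟩, ⟨2, 221386, 221184⟩, ⟨44, 3300224, 1055616⟩,
    ⟨8, 1891394, 1072194⟩, ⟨1, 261115, 250624⟩, ⟨4, 1929729, 1913344⟩, ⟨3, 19596288, 2819072⟩, ⟨0,
    7537, 7456⟩, ⟨14, 130031, 73930⟩, ⟨12, 16742144, 14640896⟩, ⟨6, 1977868, 1058316⟩, ⟨39,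
    8256971, 370945⟩, ⟨2, 227583, 157805⟩, ⟨1, 65342, 32270⟩, ⟨6, 1541265, 230416⟩, ⟨44, 7494296,
    6294152⟩, ⟨9, 12476252, 149276⟩, ⟨32, 7592655, 84621⟩, ⟨25, 155616, 17344⟩, ⟨42, 7789007,
    299275⟩, ⟨25, 255999, 182129⟩, ⟨4, 225794, 514⟩, ⟨28, 2062530, 1331200⟩, ⟨12, 13494912,
    12905088⟩, ⟨14, 241644, 76736⟩, ⟨1, 65514, 50690⟩, ⟨44, 2287105, 2156033⟩, ⟨25, 245503,
    80630⟩, ⟨3, 33292212, 27348864⟩, ⟨0, 8191, 4955⟩, ⟨1, 225126, 156484⟩, ⟨39, 2090839, 992580⟩,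
    ⟨12, 15591166, 533562⟩, ⟨2, 261059, 162306⟩, ⟨8, 16502223, 2263311⟩, ⟨16, 13318906, 729752⟩,
    ⟨52, 47855832, 35131600⟩, ⟨25, 163831, 1953⟩, ⟨3, 33554381, 6629248⟩, ⟨45, 32177627,
    12625240⟩, ⟨4, 1955775, 5797⟩, ⟨14, 245759, 39927⟩, ⟨70, 63700479, 29998097⟩, ⟨24, 8388607,
    8059375⟩, ⟨8, 15326607, 14687502⟩, ⟨22, 8388607, 990968⟩, ⟨45, 24901615, 2172746⟩, ⟨42,
    7854543, 4559175⟩, ⟨70, 15982507, 1150465⟩, ⟨71, 54460405, 18497060⟩, ⟨72, 265219454,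
    117460324⟩, ⟨6, 2097151, 2000717⟩, ⟨32, 8388607, 5266260⟩]) (by decide +kernel)))
  (.of_refine 20 15 rfl
  (crossCovered_of_check (hs := [
    ⟨0, 6336, 6208⟩, ⟨0, 6340, 6276⟩, ⟨1, 215745, 131648⟩, ⟨14, 91012, 74372⟩, ⟨0, 6354, 4096⟩,
    ⟨25, 143952, 135760⟩, ⟨2, 163328, 163328⟩, ⟨25, 227067, 132608⟩, ⟨1, 196096, 196096⟩, ⟨14,
    15296, 14528⟩, ⟨25, 176848, 4800⟩, ⟨0, 6612, 6608⟩, ⟨23, 4617992, 4461824⟩, ⟨1, 262017, 1792⟩,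
    ⟨25, 218786, 1570⟩, ⟨22, 881432, 795400⟩, ⟨1, 154112, 137728⟩, ⟨14, 173190, 41090⟩, ⟨17,
    1865376, 1573376⟩, ⟨25, 136016, 4880⟩, ⟨0, 7807, 5688⟩, ⟨0, 8191, 5615⟩, ⟨4, 1400576, 329216⟩,
    ⟨8, 16146014, 399874⟩, ⟨3, 9897603, 9569920⟩, ⟨14, 29424, 29424⟩, ⟨44, 3099281, 19088⟩, ⟨9,
    16678813, 2492180⟩, ⟨14, 262143, 99974⟩, ⟨25, 252799, 164468⟩, ⟨3, 22906801, 21006208⟩, ⟨25,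
    244629, 230272⟩, ⟨42, 6746415, 2380046⟩, ⟨9, 1470209, 1314560⟩, ⟨1, 131038, 14046⟩, ⟨14,
    61155, 9410⟩, ⟨6, 1732096, 1191424⟩, ⟨25, 193491, 173010⟩, ⟨2, 195259, 188936⟩, ⟨3, 15009025,
    6292736⟩, ⟨25, 131059, 22066⟩, ⟨39, 4177839, 1715467⟩, ⟨14, 226283, 152554⟩, ⟨0, 7166, 6706⟩,
    ⟨12, 16447103, 11595816⟩, ⟨2, 227645, 162061⟩, ⟨5, 1572527, 435723⟩, ⟨14, 32767, 31429⟩, ⟨2,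
    260607, 246073⟩, ⟨8, 15163340, 6495948⟩, ⟨25, 258045, 93177⟩, ⟨25, 244671, 201602⟩, ⟨9,
    3374942, 1134428⟩, ⟨45, 32364827, 8749330⟩, ⟨39, 7861135, 1175823⟩, ⟨12, 14645246, 12607776⟩,
    ⟨31, 7077311, 6962571⟩, ⟨1, 262143, 85716⟩, ⟨29, 2097151, 512988⟩, ⟨7, 2068055, 2002432⟩, ⟨24,
    8388607, 1637167⟩, ⟨22, 8388607, 7628655⟩, ⟨4, 1996603, 538392⟩, ⟨44, 7956095, 9850⟩, ⟨31,
    3135967, 2185670⟩, ⟨24, 8388607, 6584149⟩, ⟨13, 16777023, 14659335⟩, ⟨12, 14679999, 10008617⟩,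
    ⟨69, 335405055, 5311633⟩, ⟨5, 2097151, 1884029⟩, ⟨39, 8388607, 6535618⟩]) (by decide +kernel))
  (crossCovered_of_check (hs := [
    ⟨0, 6336, 4096⟩, ⟨0, 6336, 6336⟩, ⟨1, 125921, 2560⟩, ⟨1, 178720, 176640⟩, ⟨0, 6704, 4640⟩,
    ⟨25, 144369, 5056⟩, ⟨14, 74724, 73920⟩, ⟨2, 161793, 161793⟩, ⟨25, 210834, 5888⟩, ⟨1, 89866,
    24072⟩, ⟨25, 144906, 136706⟩, ⟨14, 107400, 65664⟩, ⟨6, 1738584, 34576⟩, ⟨4, 1003008, 1000960⟩,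
    ⟨0, 6888, 4672⟩, ⟨0, 7156, 7056⟩, ⟨2, 225482, 147464⟩, ⟨24, 8194970, 6292224⟩, ⟨8, 8272606,
    2103814⟩, ⟨3, 10847489, 2098432⟩, ⟨12, 13330192, 12673792⟩, ⟨14, 175038, 174756⟩, ⟨9,
    12021245, 8389904⟩, ⟨6, 257196, 74752⟩, ⟨14, 110272, 11456⟩, ⟨25, 188227, 181057⟩, ⟨4,
    1997811, 545296⟩, ⟨17, 1965806, 1124874⟩, ⟨12, 15051578, 8431904⟩, ⟨2, 260602, 188720⟩, ⟨12,
    7170640, 5007936⟩, ⟨9, 9277277, 8455936⟩, ⟨0, 6965, 6436⟩, ⟨22, 7780047, 304640⟩, ⟨8, 8388186,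
    2235904⟩, ⟨12, 2977882, 2191360⟩, ⟨25, 244661, 238517⟩, ⟨1, 191199, 166428⟩, ⟨14, 128974,
    124038⟩, ⟨1, 262015, 15884⟩, ⟨24, 8345599, 6969224⟩, ⟨6, 892469, 361984⟩, ⟨3, 25163718,
    18159488⟩, ⟨23, 6750205, 268561⟩, ⟨42, 4127199, 561486⟩, ⟨30, 4109355, 3977251⟩, ⟨25, 262143,
    56307⟩, ⟨39, 5238573, 5188872⟩, ⟨3, 30647751, 1254784⟩, ⟨24, 8118271, 6326071⟩, ⟨8, 16773119,
    2230564⟩, ⟨42, 7995387, 3774338⟩, ⟨5, 260726, 195074⟩, ⟨8, 16773119, 14896430⟩, ⟨4, 1834743,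
    709254⟩, ⟨67, 100526591, 93145380⟩, ⟨3, 21706421, 16848512⟩, ⟨39, 7854079, 4216200⟩, ⟨30,
    5738391, 5505812⟩, ⟨68, 64487407, 22133380⟩, ⟨13, 16777215, 1290177⟩, ⟨12, 16777215, 1617288⟩])
    (by decide +kernel)))

/-! ### Symmetries of rules -/

theorem BoolRule.flip_zero (r : BoolRule) (b0 b1 b2 b3 b4 : Bool) :
    r.flip 0 b0 b1 b2 b3 b4 = r (!b0) b1 b2 b3 b4 := by
  cases b0 <;> cases b1 <;> cases b2 <;> cases b3 <;> cases b4 <;> rfl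

theorem BoolRule.flip_one (r : BoolRule) (b0 b1 b2 b3 b4 : Bool) :
    r.flip 1 b0 b1 b2 b3 b4 = r b0 (!b1) b2 b3 b4 := by
  cases b0 <;> cases b1 <;> cases b2 <;> cases b3 <;> cases b4 <;> rfl

theorem BoolRule.flip_two (r : BoolRule) (b0 b1 b2 b3 b4 : Bool) :
    r.flip 2 b0 b1 b2 b3 b4 = r b0 b1 (!b2) b3 b4 := by
  cases b0 <;> cases b1 <;> cases b2 <;> cases b3 <;> cases b4 <;> rfl

theorem BoolRule.flip_three (r : BoolRule) (b0 b1 b2 b3 b4 : Bool) :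
    r.flip 3 b0 b1 b2 b3 b4 = r b0 b1 b2 (!b3) b4 := by
  cases b0 <;> cases b1 <;> cases b2 <;> cases b3 <;> cases b4 <;> rfl

theorem BoolRule.flip_four (r : BoolRule) (b0 b1 b2 b3 b4 : Bool) :
    r.flip 4 b0 b1 b2 b3 b4 = r b0 b1 b2 b3 (!b4) := by
  cases b0 <;> cases b1 <;> cases b2 <;> cases b3 <;> cases b4 <;> rfl

def BoolRule.not (r : BoolRule) : BoolRule := fun b0 b1 b2 b3 b4 => !r b0 b1 b2 b3 b4

def BoolRule.compl (r : BoolRule) : BoolRule := fun b0 b1 b2 b3 b4 => r (!b0) (!b1) (!b2) (!b3) (!b4)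

theorem Erasable.of_equiv {S S' : Stencil} {r r' : BoolRule} (L : Site ≃ Site)
    (h : ∀ (s : Site → Bool) (y : Site),
      r' (s (L y + S'.u0)) (s (L y + S'.u1)) (s (L y + S'.u2)) (s (L y + S'.u3)) (s (L y + S'.u4)) =
      r (s (L (y + S.u0))) (s (L (y + S.u1))) (s (L (y + S.u2))) (s (L (y + S.u3)))
        (s (L (y + S.u4)))) (hr : Erasable S' r') : Erasable S r := by
  obtain ⟨s, s', hne, hfin, hs⟩ := hr
  refine ⟨s ∘ L, s' ∘ L, fun e => hne ?_, hfin.preimage L.injective.injOn, fun y => ?_⟩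
  · funext z
    simpa using congrFun e (L.symm z)
  · simp only [Function.comp, ← h, hs]

theorem Erasable.of_not {S : Stencil} {r : BoolRule} (h : Erasable S r.not) : Erasable S r := by
  obtain ⟨s, s', hne, hfin, hs⟩ := h
  exact ⟨s, s', hne, hfin, fun y => by simpa [BoolRule.not] using hs y⟩

theorem Erasable.of_compl {S : Stencil} {r : BoolRule} (h : Erasable S r.compl) : Erasable S r := by
  obtain ⟨s, s', hne, hfin, hs⟩ := h
  refine ⟨fun z => !s z, fun z => !s' z, fun e => hne ?_, by simpa using hfin, hs⟩
  funext z
  simpa using congrFun e z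

theorem BoolRule.DependsAt.not {r : BoolRule} {j : ℕ} (h : r.DependsAt j) : r.not.DependsAt j := by
  obtain ⟨b0, b1, b2, b3, b4, h⟩ := h
  exact ⟨b0, b1, b2, b3, b4, by simpa [BoolRule.not, BoolRule.flip] using h⟩

theorem BoolRule.FlatAt.not {r : BoolRule} {j : ℕ} (h : r.FlatAt j) : r.not.FlatAt j := by
  obtain ⟨b0, b1, b2, b3, b4, h⟩ := h
  exact ⟨b0, b1, b2, b3, b4, by simpa [BoolRule.not, BoolRule.flip] using h⟩

theorem BoolRule.DependsAt.compl {r : BoolRule} {j : ℕ} (h : r.DependsAt j) :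
    r.compl.DependsAt j := by
  obtain ⟨b0, b1, b2, b3, b4, h⟩ := h
  exact ⟨!b0, !b1, !b2, !b3, !b4, by simpa [BoolRule.compl, BoolRule.flip] using h⟩

theorem BoolRule.FlatAt.compl {r : BoolRule} {j : ℕ} (h : r.FlatAt j) : r.compl.FlatAt j := by
  obtain ⟨b0, b1, b2, b3, b4, h⟩ := h
  exact ⟨!b0, !b1, !b2, !b3, !b4, by simpa [BoolRule.compl, BoolRule.flip] using h⟩

theorem ErasableIf.of_not {S : Stencil} {D P : List ℕ} {r : BoolRule}
    (h : ErasableIf S D P r.not) : ErasableIf S D P r := fun hD hP =>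
  .of_not (h (fun j hj => (hD j hj).not) fun j hj => (hP j hj).not)

theorem ErasableIf.of_compl {S : Stencil} {D P : List ℕ} {r : BoolRule}
    (h : ErasableIf S D P r.compl) : ErasableIf S D P r := fun hD hP =>
  .of_compl (h (fun j hj => (hD j hj).compl) fun j hj => (hP j hj).compl)

/-- It suffices to treat one of a rule and its negation. -/
theorem ErasableIf.of_zero {S : Stencil} {D P : List ℕ} {r : BoolRule}
    (h : ∀ r' : BoolRule, r' = r ∨ r' = r.not → r' false false false false false = false →
      ErasableIf S D P r') : ErasableIf S D P r := by
  cases h0 : r false false false false false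
  · exact h r (.inl rfl) h0
  · exact .of_not (h r.not (.inr rfl) (by simp [BoolRule.not, h0]))

theorem BoolRule.values_eq (r : BoolRule) : r.values = [
    r false false false false false, r false false false false true, r false false false true false,
    r false false false true true, r false false true false false, r false false true false true,
    r false false true true false, r false false true true true, r false true false false false,
    r false true false false true, r false true false true false, r false true false true true,
    r false true true false false, r false true true false true, r false true true true false,
    r false true true true true, r true false false false false, r true false false false true,
    r true false false true false, r true false false true true, r true false true false false,
    r true false true false true, r true false true true false, r true false true true true,
    r true true false false false, r true true false false true, r true true false true false,
    r true true false true true, r true true true false false, r true true true false true,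
    r true true true true false, r true true true true true] :=
  rfl

/-! ### The corner -/

/-- Rule with the two legs of the corner exchanged. -/
def BoolRule.legSwap (r : BoolRule) : BoolRule := fun c a b d e => r c d e a b

theorem ErasableIf.of_legSwap {r : BoolRule}
    (h : ErasableIf cornerStencil [0, 1, 2, 3, 4] [0, 2, 4] r.legSwap) :
    ErasableIf cornerStencil [0, 1, 2, 3, 4] [0, 2, 4] r := by
  intro hD hP
  simp only [List.forall_mem_cons, List.not_mem_nil, false_imp_iff, forall_true_iff, and_true] at hD hP
  obtain ⟨⟨c0, a0, b0, d0, e0, h0⟩, ⟨c1, a1, b1, d1, e1, h1⟩, ⟨c2, a2, b2, d2, e2, h2⟩,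
    ⟨c3, a3, b3, d3, e3, h3⟩, ⟨c4, a4, b4, d4, e4, h4⟩⟩ := hD
  obtain ⟨⟨c5, a5, b5, d5, e5, h5⟩, ⟨c6, a6, b6, d6, e6, h6⟩, ⟨c7, a7, b7, d7, e7, h7⟩⟩ := hP
  refine .of_equiv (S' := cornerStencil) (Equiv.prodComm ℤ ℤ) (fun s y => rfl) (h ?_ ?_)
  · simp only [List.forall_mem_cons, List.not_mem_nil, false_imp_iff, forall_true_iff, and_true]
    exact ⟨⟨c0, d0, e0, a0, b0, h0⟩, ⟨c3, d3, e3, a3, b3, h3⟩, ⟨c4, d4, e4, a4, b4, h4⟩,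
      ⟨c1, d1, e1, a1, b1, h1⟩, ⟨c2, d2, e2, a2, b2, h2⟩⟩
  · simp only [List.forall_mem_cons, List.not_mem_nil, false_imp_iff, forall_true_iff, and_true]
    exact ⟨⟨c5, d5, e5, a5, b5, h5⟩, ⟨c7, d7, e7, a7, b7, h7⟩, ⟨c6, d6, e6, a6, b6, h6⟩⟩

/-- The far end of the first leg can be irrelevant when its middle holds `β`. -/
def BoolRule.FarFlat (r : BoolRule) (β : Bool) : Prop :=
  ∃ c d e, r c β false d e = r c β true d e

/-- The middle of the first leg can be irrelevant when the corner holds `β` and the far end `h`. -/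
def BoolRule.MidFlat (r : BoolRule) (β h : Bool) : Prop :=
  ∃ d e, r β false h d e = r β true h d e

theorem BoolRule.eq_not_of_not_farFlat {r : BoolRule} {β : Bool} (h : ¬r.FarFlat β) (c d e : Bool) :
    r c β true d e = !r c β false d e :=
  Bool.eq_not_of_ne fun e' => h ⟨c, d, e, e'.symm⟩

theorem BoolRule.eq_not_of_not_midFlat {r : BoolRule} {β h : Bool} (hr : ¬r.MidFlat β h)
    (d e : Bool) : r β true h d e = !r β false h d e :=
  Bool.eq_not_of_ne fun e' => hr ⟨d, e, e'.symm⟩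

/-- For each `β` the end of the leg is permutive when its middle holds `β`, or the middle is
permutive when the corner holds `β` and the end `false`. The four combinations give three families;
in the fourth the rule would be permutive at the end of the leg. -/
theorem erasableIf_corner_of_leg {r : BoolRule} (h0 : r false false false false false = false)
    (hr : ∀ β, r.FarFlat β → ¬r.MidFlat β false) :
    ErasableIf cornerStencil [0, 1, 2, 3, 4] [0, 2, 4] r := by
  intro hD hP
  by_cases hf : r.FarFlat false <;> by_cases ht : r.FarFlat true
  · have hf := BoolRule.eq_not_of_not_midFlat (hr _ hf)
    have ht := BoolRule.eq_not_of_not_midFlat (hr _ ht)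
    refine cornerCovered_cornerFamilyBoth r ?_ hD hP
    simp [Member, Entry.Holds, cornerFamilyBoth, BoolRule.values_eq, h0, hf, ht]
  · have hf := BoolRule.eq_not_of_not_midFlat (hr _ hf)
    have ht := BoolRule.eq_not_of_not_farFlat ht
    refine cornerCovered_cornerFamilyLeft r ?_ hD hP
    simp [Member, Entry.Holds, cornerFamilyLeft, BoolRule.values_eq, h0, hf, ht]
  · have hf := BoolRule.eq_not_of_not_farFlat hf
    have ht := BoolRule.eq_not_of_not_midFlat (hr _ ht)
    refine cornerCovered_cornerFamilyRight r ?_ hD hP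
    simp [Member, Entry.Holds, cornerFamilyRight, BoolRule.values_eq, h0, hf, ht]
  · obtain ⟨c, a, b, d, e, h⟩ := hP 2 (by simp)
    have h1 : r c a b d e = r c a (!b) d e := by rwa [BoolRule.flip_two] at h
    have h2 := BoolRule.eq_not_of_not_farFlat hf c d e
    have h3 := BoolRule.eq_not_of_not_farFlat ht c d e
    cases a <;> cases b <;> simp_all

theorem BoolRule.FarFlat.of_compl {r : BoolRule} {β : Bool} (h : r.compl.FarFlat β) :
    r.FarFlat (!β) := by
  obtain ⟨c, d, e, h⟩ := h
  exact ⟨!c, !d, !e, h.symm⟩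

theorem BoolRule.farFlat_not {r : BoolRule} {β : Bool} : r.not.FarFlat β ↔ r.FarFlat β := by
  simp [BoolRule.FarFlat, BoolRule.not]

theorem BoolRule.midFlat_not {r : BoolRule} {β h : Bool} : r.not.MidFlat β h ↔ r.MidFlat β h := by
  simp [BoolRule.MidFlat, BoolRule.not]

/-- Complementing the symbols reduces to `h = false`, and negating the output to `r 0 = 0`; neither
affects dependence or permutivity. -/
theorem erasableIf_corner_of_forall_not_midFlat {r : BoolRule} {h : Bool}
    (hr : ∀ β, r.FarFlat β → ¬r.MidFlat β h) :
    ErasableIf cornerStencil [0, 1, 2, 3, 4] [0, 2, 4] r := by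
  have key : ∀ r : BoolRule, (∀ β, r.FarFlat β → ¬r.MidFlat β false) →
      ErasableIf cornerStencil [0, 1, 2, 3, 4] [0, 2, 4] r := fun r hr => .of_zero fun r' e h0 => by
    refine erasableIf_corner_of_leg h0 ?_
    rcases e with rfl | rfl
    · exact hr
    · simpa only [BoolRule.farFlat_not, BoolRule.midFlat_not] using hr
  cases h
  · exact key r hr
  · exact .of_compl (key _ fun β h h' => hr _ h.of_compl (by
      obtain ⟨d, e, h'⟩ := h'
      exact ⟨!d, !e, h'.symm⟩))

/-- The configuration with the listed symbols. -/
def listConfig (l : List (Site × Bool)) (z : Site) : Bool := (l.lookup z).getD false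

/-- The configurations differ only at the origin, which is seen from just the five positions `-S.u0,
…, -S.u4`. The list `l` fixes the surroundings; unlisted cells hold `false`. -/
theorem erasable_of_flip {S : Stencil} {r : BoolRule} (l : List (Site × Bool))
    (h : ∀ y ∈ [-S.u0, -S.u1, -S.u2, -S.u3, -S.u4],
      let s := listConfig ((0, false) :: l)
      let s' := listConfig ((0, true) :: l)
      r (s (y + S.u0)) (s (y + S.u1)) (s (y + S.u2)) (s (y + S.u3)) (s (y + S.u4)) =
        r (s' (y + S.u0)) (s' (y + S.u1)) (s' (y + S.u2)) (s' (y + S.u3)) (s' (y + S.u4))) :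
    Erasable S r := by
  have hne : ∀ z, z ≠ 0 → listConfig ((0, false) :: l) z = listConfig ((0, true) :: l) z := by
    intro z hz
    simp [listConfig, List.lookup_cons, beq_false_of_ne hz]
  refine ⟨listConfig ((0, false) :: l), listConfig ((0, true) :: l), fun e => ?_,
    (Set.finite_singleton (0 : Site)).subset fun z hz => ?_, fun y => ?_⟩
  · simpa [listConfig] using congrFun e 0
  · by_contra h0
    exact hz (hne z h0)
  · by_cases hy : y ∈ [-S.u0, -S.u1, -S.u2, -S.u3, -S.u4]
    · exact h y hy
    · simp only [List.mem_cons, List.not_mem_nil, or_false, not_or, eq_neg_iff_add_eq_zero] at hy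
      rw [hne _ hy.1, hne _ hy.2.1, hne _ hy.2.2.1, hne _ hy.2.2.2.1, hne _ hy.2.2.2.2]

/-- A one-cell pair needs five patterns in which the changed cell is irrelevant, as vertex, middle
and end of each leg. They overlap only in a few cells: for the first leg, in the symbol `a` shared
by the patterns of vertex and middle, and in `β` shared by those of middle and end. If they fit
together for both legs there is a pair; if not for one leg, the rule lies in one of the families. -/
theorem erasableIf_corner (r : BoolRule) :
    ErasableIf cornerStencil [0, 1, 2, 3, 4] [0, 2, 4] r := by
  intro hD hP
  have h0 : ∃ a b d e, r false a b d e = r true a b d e := by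
    obtain ⟨c, a, b, d, e, h⟩ := hP 0 (by simp)
    refine ⟨a, b, d, e, ?_⟩
    rw [BoolRule.flip_zero] at h
    cases c
    · exact h
    · exact h.symm
  obtain ⟨a, b, d, e, h⟩ := h0
  by_cases h1 : ∀ β, r.FarFlat β → ¬r.MidFlat β a
  · exact erasableIf_corner_of_forall_not_midFlat h1 hD hP
  by_cases h2 : ∀ β, r.legSwap.FarFlat β → ¬r.legSwap.MidFlat β d
  · exact ErasableIf.of_legSwap (erasableIf_corner_of_forall_not_midFlat h2) hD hP
  push Not at h1 h2
  obtain ⟨β, ⟨c1, d1, e1, hβ⟩, d2, e2, hβ'⟩ := h1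
  obtain ⟨γ, ⟨c3, a3, b3, hγ⟩, a4, b4, hγ'⟩ := h2
  -- The first four cells surround the origin as vertex. The columns `x = -1` and `x = -2` complete
  -- the positions where it is middle and end of the first leg, the rows `y = -1` and `y = -2` those
  -- for the second leg.
  refine erasable_of_flip [((1, 0), a), ((2, 0), b), ((0, 1), d), ((0, 2), e),
    ((-1, 0), β), ((-1, 1), d2), ((-1, 2), e2), ((-2, 0), c1), ((-2, 1), d1), ((-2, 2), e1),
    ((0, -1), γ), ((1, -1), a4), ((2, -1), b4), ((0, -2), c3), ((1, -2), a3), ((2, -2), b3)] ?_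
  simp only [List.forall_mem_cons, List.not_mem_nil, false_imp_iff, forall_true_iff, and_true]
  exact ⟨h, hβ', hβ, hγ', hγ⟩

/-! ### The tee -/

/-- Rule with the two arms of the tee exchanged. -/
def BoolRule.armSwap (r : BoolRule) : BoolRule := fun c e w d f => r c w e d f

theorem ErasableIf.of_armSwap {r : BoolRule}
    (h : ErasableIf teeStencil [0, 1, 2, 3, 4] [1, 2, 4] r.armSwap) :
    ErasableIf teeStencil [0, 1, 2, 3, 4] [1, 2, 4] r := by
  intro hD hP
  simp only [List.forall_mem_cons, List.not_mem_nil, false_imp_iff, forall_true_iff, and_true] at hD hP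
  obtain ⟨⟨c0, a0, b0, d0, e0, h0⟩, ⟨c1, a1, b1, d1, e1, h1⟩, ⟨c2, a2, b2, d2, e2, h2⟩,
    ⟨c3, a3, b3, d3, e3, h3⟩, ⟨c4, a4, b4, d4, e4, h4⟩⟩ := hD
  obtain ⟨⟨c5, a5, b5, d5, e5, h5⟩, ⟨c6, a6, b6, d6, e6, h6⟩, ⟨c7, a7, b7, d7, e7, h7⟩⟩ := hP
  refine .of_equiv (S' := teeStencil) ((Equiv.neg ℤ).prodCongr (Equiv.refl ℤ)) (fun s y => ?_)
    (h ?_ ?_)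
  · obtain ⟨y1, y2⟩ := y
    simp [BoolRule.armSwap, teeStencil, add_comm]
  · simp only [List.forall_mem_cons, List.not_mem_nil, false_imp_iff, forall_true_iff, and_true]
    exact ⟨⟨c0, b0, a0, d0, e0, h0⟩, ⟨c2, b2, a2, d2, e2, h2⟩, ⟨c1, b1, a1, d1, e1, h1⟩,
      ⟨c3, b3, a3, d3, e3, h3⟩, ⟨c4, b4, a4, d4, e4, h4⟩⟩
  · simp only [List.forall_mem_cons, List.not_mem_nil, false_imp_iff, forall_true_iff, and_true]
    exact ⟨⟨c6, b6, a6, d6, e6, h6⟩, ⟨c5, b5, a5, d5, e5, h5⟩, ⟨c7, b7, a7, d7, e7, h7⟩⟩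

theorem erasableIf_tee_of_centre {r : BoolRule}
    (hr : ∀ e w d f, r true e w d f = !r false e w d f) :
    ErasableIf teeStencil [0, 1, 2, 3, 4] [1, 2, 4] r := .of_zero fun r' e h0 => by
  have hr' : ∀ e w d f, r' true e w d f = !r' false e w d f := by
    rcases e with rfl | rfl
    · exact hr
    · simpa [BoolRule.not] using hr
  refine teeCovered_teeFamilyCentre r' ?_
  simp [Member, Entry.Holds, teeFamilyCentre, BoolRule.values_eq, h0, hr']

theorem erasableIf_tee_of_arm {r : BoolRule} {c : Bool}
    (hr : ∀ w d f, r c true w d f = !r c false w d f) :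
    ErasableIf teeStencil [0, 1, 2, 3, 4] [1, 2, 4] r := by
  have key : ∀ r : BoolRule, (∀ w d f, r false true w d f = !r false false w d f) →
      ErasableIf teeStencil [0, 1, 2, 3, 4] [1, 2, 4] r := fun r hr => .of_zero fun r' e h0 => by
    have hr' : ∀ w d f, r' false true w d f = !r' false false w d f := by
      rcases e with rfl | rfl
      · exact hr
      · simpa [BoolRule.not] using hr
    refine teeCovered_teeFamilyArm r' ?_
    simp [Member, Entry.Holds, teeFamilyArm, BoolRule.values_eq, h0, hr']
  cases c
  · exact key r hr
  · exact .of_compl (key _ fun w d f => by simp [BoolRule.compl, hr])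

/-- The end of the stem can be irrelevant when its middle holds `β`. -/
def BoolRule.EndFlat (r : BoolRule) (β : Bool) : Prop :=
  ∃ c e w, r c e w β false = r c e w β true

/-- The middle of the stem can be irrelevant when the centre holds `β` and the end `v`. -/
def BoolRule.StemFlat (r : BoolRule) (β v : Bool) : Prop :=
  ∃ e w, r β e w false v = r β e w true v

theorem BoolRule.eq_not_of_not_endFlat {r : BoolRule} {β : Bool} (h : ¬r.EndFlat β) (c e w : Bool) :
    r c e w β true = !r c e w β false :=
  Bool.eq_not_of_ne fun e' => h ⟨c, e, w, e'.symm⟩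

theorem BoolRule.eq_not_of_not_stemFlat {r : BoolRule} {β v : Bool} (hr : ¬r.StemFlat β v)
    (e w : Bool) : r β e w true v = !r β e w false v :=
  Bool.eq_not_of_ne fun e' => hr ⟨e, w, e'.symm⟩

theorem BoolRule.EndFlat.of_compl {r : BoolRule} {β : Bool} (h : r.compl.EndFlat β) :
    r.EndFlat (!β) := by
  obtain ⟨c, e, w, h⟩ := h
  exact ⟨!c, !e, !w, h.symm⟩

theorem BoolRule.endFlat_not {r : BoolRule} {β : Bool} : r.not.EndFlat β ↔ r.EndFlat β := by
  simp [BoolRule.EndFlat, BoolRule.not]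

theorem BoolRule.stemFlat_not {r : BoolRule} {β h : Bool} :
    r.not.StemFlat β h ↔ r.StemFlat β h := by
  simp [BoolRule.StemFlat, BoolRule.not]

/-- For each `β`, either the end of the stem is permutive when its middle holds `β`, or the middle
is permutive when the centre holds `β` and the end `false`. If the first held for both `β`, the rule
would be permutive at the end of the stem. -/
theorem erasableIf_tee_of_stem {r : BoolRule} (h0 : r false false false false false = false)
    (hr : ∀ β, r.EndFlat β → ¬r.StemFlat β false) :
    ErasableIf teeStencil [0, 1, 2, 3, 4] [1, 2, 4] r := by
  intro hD hP
  by_cases hf : r.EndFlat false <;> by_cases ht : r.EndFlat true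
  · have hf := BoolRule.eq_not_of_not_stemFlat (hr _ hf)
    have ht := BoolRule.eq_not_of_not_stemFlat (hr _ ht)
    refine teeCovered_teeFamilyBoth r ?_ hD hP
    simp [Member, Entry.Holds, teeFamilyBoth, BoolRule.values_eq, h0, hf, ht]
  · have hf := BoolRule.eq_not_of_not_stemFlat (hr _ hf)
    have ht := BoolRule.eq_not_of_not_endFlat ht
    refine teeCovered_teeFamilyLeft r ?_ hD hP
    simp [Member, Entry.Holds, teeFamilyLeft, BoolRule.values_eq, h0, hf, ht]
  · have hf := BoolRule.eq_not_of_not_endFlat hf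
    have ht := BoolRule.eq_not_of_not_stemFlat (hr _ ht)
    refine teeCovered_teeFamilyRight r ?_ hD hP
    simp [Member, Entry.Holds, teeFamilyRight, BoolRule.values_eq, h0, hf, ht]
  · obtain ⟨c, e, w, d, f, h⟩ := hP 4 (by simp)
    have h1 : r c e w d f = r c e w d (!f) := by rwa [BoolRule.flip_four] at h
    have h2 := BoolRule.eq_not_of_not_endFlat hf c e w
    have h3 := BoolRule.eq_not_of_not_endFlat ht c e w
    cases d <;> cases f <;> simp_all

theorem erasableIf_tee_of_forall_not_stemFlat {r : BoolRule} {v : Bool}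
    (hr : ∀ β, r.EndFlat β → ¬r.StemFlat β v) :
    ErasableIf teeStencil [0, 1, 2, 3, 4] [1, 2, 4] r := by
  have key : ∀ r : BoolRule, (∀ β, r.EndFlat β → ¬r.StemFlat β false) →
      ErasableIf teeStencil [0, 1, 2, 3, 4] [1, 2, 4] r := fun r hr => .of_zero fun r' e h0 => by
    refine erasableIf_tee_of_stem h0 ?_
    rcases e with rfl | rfl
    · exact hr
    · simpa only [BoolRule.endFlat_not, BoolRule.stemFlat_not] using hr
  cases v
  · exact key r hr
  · exact .of_compl (key _ fun β h h' => hr _ h.of_compl (by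
      obtain ⟨e, w, h'⟩ := h'
      exact ⟨!e, !w, h'.symm⟩))

/-- Again a one-cell pair is attempted. It fails only if the centre is permutive, if an arm is
permutive for the relevant value of the centre, or if the patterns for the middle and the end of the
stem clash; each failure puts the rule into a family. Starting from a pattern with arms `x`, `y`
that makes the centre irrelevant, the neighbouring centres hold `x` and `y`, whence the values in
`h1` and `h2`. -/
theorem erasableIf_tee (r : BoolRule) :
    ErasableIf teeStencil [0, 1, 2, 3, 4] [1, 2, 4] r := by
  intro hD hP
  by_cases h0 : ∀ e w d f, r true e w d f = !r false e w d f
  · exact erasableIf_tee_of_centre h0 hD hP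
  push Not at h0
  obtain ⟨x, y, v, f, h⟩ := h0
  by_cases h1 : ∀ w d f, r y true w d f = !r y false w d f
  · exact erasableIf_tee_of_arm h1 hD hP
  by_cases h2 : ∀ w d f, r.armSwap x true w d f = !r.armSwap x false w d f
  · exact ErasableIf.of_armSwap (erasableIf_tee_of_arm h2) hD hP
  by_cases h3 : ∀ β, r.EndFlat β → ¬r.StemFlat β v
  · exact erasableIf_tee_of_forall_not_stemFlat h3 hD hP
  push Not at h1 h2 h3
  obtain ⟨w1, d1, f1, h1⟩ := h1
  obtain ⟨e2, d2, f2, h2⟩ := h2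
  obtain ⟨β, ⟨c4, e4, w4, h4⟩, e3, w3, h3⟩ := h3
  rw [ne_eq, Bool.not_eq_not] at h h1 h2
  -- The first four cells serve the origin as centre, the cells with `w1, d1, f1` and `e2, d2, f2`
  -- the origin as east and west arm, and the rows `y = -1` and `y = -2` the origin as middle and
  -- end of the stem.
  refine erasable_of_flip [((1, 0), x), ((-1, 0), y), ((0, 1), v), ((0, 2), f),
    ((-2, 0), w1), ((-1, 1), d1), ((-1, 2), f1), ((2, 0), e2), ((1, 1), d2), ((1, 2), f2),
    ((0, -1), β), ((1, -1), e3), ((-1, -1), w3), ((0, -2), c4), ((1, -2), e4), ((-1, -2), w4)] ?_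
  simp only [List.forall_mem_cons, List.not_mem_nil, false_imp_iff, forall_true_iff, and_true]
  exact ⟨h.symm, h1.symm, h2.symm, h3, h4⟩

/-! ### The cross -/

abbrev CrossErasable (r : BoolRule) : Prop :=
  ErasableIf crossStencil [0, 1, 2, 3, 4] [1, 2, 3, 4] r

/-- Rule with the two axes of the cross exchanged. -/
def BoolRule.axisSwap (r : BoolRule) : BoolRule := fun c e w n s => r c n s e w

/-- Rule with the two vertical arms of the cross exchanged. -/
def BoolRule.verticalSwap (r : BoolRule) : BoolRule := fun c e w n s => r c e w s n

theorem CrossErasable.of_armSwap {r : BoolRule} (h : CrossErasable r.armSwap) :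
    CrossErasable r := by
  intro hD hP
  simp only [List.forall_mem_cons, List.not_mem_nil, false_imp_iff, forall_true_iff, and_true]
    at hD hP
  obtain ⟨⟨c0, a0, b0, d0, e0, h0⟩, ⟨c1, a1, b1, d1, e1, h1⟩, ⟨c2, a2, b2, d2, e2, h2⟩,
    ⟨c3, a3, b3, d3, e3, h3⟩, ⟨c4, a4, b4, d4, e4, h4⟩⟩ := hD
  obtain ⟨⟨c5, a5, b5, d5, e5, h5⟩, ⟨c6, a6, b6, d6, e6, h6⟩, ⟨c7, a7, b7, d7, e7, h7⟩,
    ⟨c8, a8, b8, d8, e8, h8⟩⟩ := hP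
  refine .of_equiv (S' := crossStencil) ((Equiv.neg ℤ).prodCongr (Equiv.refl ℤ)) (fun s y => ?_)
    (h ?_ ?_)
  · obtain ⟨y1, y2⟩ := y
    simp [BoolRule.armSwap, crossStencil, add_comm]
  · simp only [List.forall_mem_cons, List.not_mem_nil, false_imp_iff, forall_true_iff, and_true]
    exact ⟨⟨c0, b0, a0, d0, e0, h0⟩, ⟨c2, b2, a2, d2, e2, h2⟩, ⟨c1, b1, a1, d1, e1, h1⟩,
      ⟨c3, b3, a3, d3, e3, h3⟩, ⟨c4, b4, a4, d4, e4, h4⟩⟩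
  · simp only [List.forall_mem_cons, List.not_mem_nil, false_imp_iff, forall_true_iff, and_true]
    exact ⟨⟨c6, b6, a6, d6, e6, h6⟩, ⟨c5, b5, a5, d5, e5, h5⟩, ⟨c7, b7, a7, d7, e7, h7⟩,
      ⟨c8, b8, a8, d8, e8, h8⟩⟩

theorem CrossErasable.of_axisSwap {r : BoolRule} (h : CrossErasable r.axisSwap) :
    CrossErasable r := by
  intro hD hP
  simp only [List.forall_mem_cons, List.not_mem_nil, false_imp_iff, forall_true_iff, and_true]
    at hD hP
  obtain ⟨⟨c0, a0, b0, d0, e0, h0⟩, ⟨c1, a1, b1, d1, e1, h1⟩, ⟨c2, a2, b2, d2, e2, h2⟩,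
    ⟨c3, a3, b3, d3, e3, h3⟩, ⟨c4, a4, b4, d4, e4, h4⟩⟩ := hD
  obtain ⟨⟨c5, a5, b5, d5, e5, h5⟩, ⟨c6, a6, b6, d6, e6, h6⟩, ⟨c7, a7, b7, d7, e7, h7⟩,
    ⟨c8, a8, b8, d8, e8, h8⟩⟩ := hP
  refine .of_equiv (S' := crossStencil) (Equiv.prodComm ℤ ℤ) (fun s y => rfl) (h ?_ ?_)
  · simp only [List.forall_mem_cons, List.not_mem_nil, false_imp_iff, forall_true_iff, and_true]
    exact ⟨⟨c0, d0, e0, a0, b0, h0⟩, ⟨c3, d3, e3, a3, b3, h3⟩, ⟨c4, d4, e4, a4, b4, h4⟩,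
      ⟨c1, d1, e1, a1, b1, h1⟩, ⟨c2, d2, e2, a2, b2, h2⟩⟩
  · simp only [List.forall_mem_cons, List.not_mem_nil, false_imp_iff, forall_true_iff, and_true]
    exact ⟨⟨c7, d7, e7, a7, b7, h7⟩, ⟨c8, d8, e8, a8, b8, h8⟩, ⟨c5, d5, e5, a5, b5, h5⟩,
      ⟨c6, d6, e6, a6, b6, h6⟩⟩

theorem CrossErasable.of_verticalSwap {r : BoolRule} (h : CrossErasable r.verticalSwap) :
    CrossErasable r :=
  .of_axisSwap (.of_armSwap (.of_axisSwap h))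

/-- A pair for the rule on the sublattice of even sites, with the centre removed, extends to a pair
for the rule on the cross. -/
theorem Erasable.cross_of_block {r : BoolRule}
    (hz : r true false false false false = r false false false false false)
    (h : Erasable blockStencil fun _ e w n s => r false e w n s) : Erasable crossStencil r := by
  obtain ⟨s, s', hne, hfin, hs⟩ := h
  -- The map `(p, q) ↦ (p - q, p + q)` identifies `ℤ²` with the sites of even coordinate sum; the
  -- configuration is spread out over these and is `false` at the odd sites.
  let ext : (Site → Bool) → Site → Bool := fun t z =>
    if Even (z.1 + z.2) then t ((z.1 + z.2) / 2, (z.2 - z.1) / 2) else false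
  have hext : ∀ (t : Site → Bool) (p q : ℤ), ext t (p - q, p + q) = t (p, q) := by
    intro t p q
    have h1 : p - q + (p + q) = 2 * p := by ring
    have h2 : p + q - (p - q) = 2 * q := by ring
    simp [ext, h1, h2]
  have hodd : ∀ (t : Site → Bool) (z : Site), ¬Even (z.1 + z.2) → ext t z = false := by
    intro t z hz
    simp [ext, hz]
  refine ⟨ext s, ext s', fun e => hne ?_, ?_, fun y => ?_⟩
  · funext z
    have := congrFun e (z.1 - z.2, z.1 + z.2)
    rwa [hext, hext] at this
  · refine (hfin.image fun z : Site => (z.1 - z.2, z.1 + z.2)).subset fun z hz => ?_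
    have hev : Even (z.1 + z.2) := by
      by_contra hn
      exact hz (by rw [hodd s z hn, hodd s' z hn])
    obtain ⟨p, hp⟩ := hev
    have hz' : z = (p - (z.2 - p), p + (z.2 - p)) := by
      exact Prod.ext (by dsimp only; omega) (by dsimp only; omega)
    rw [hz', Set.mem_ofPred_eq, hext, hext] at hz
    exact ⟨(p, z.2 - p), hz, hz'.symm⟩
  -- At an even position all arms hold `false`, so the centre is irrelevant by `hz`. At an odd
  -- position the centre holds `false` and the arms form a 2×2 block of the sublattice.
  · by_cases hev : Even (y.1 + y.2)
    · have h1 : ∀ t, ext t (y + (1, 0)) = false := fun t => hodd t _ (by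
        simp only [Prod.fst_add, Prod.snd_add]; grind)
      have h2 : ∀ t, ext t (y + (-1, 0)) = false := fun t => hodd t _ (by
        simp only [Prod.fst_add, Prod.snd_add]; grind)
      have h3 : ∀ t, ext t (y + (0, 1)) = false := fun t => hodd t _ (by
        simp only [Prod.fst_add, Prod.snd_add]; grind)
      have h4 : ∀ t, ext t (y + (0, -1)) = false := fun t => hodd t _ (by
        simp only [Prod.fst_add, Prod.snd_add]; grind)
      have key : ∀ b, r b false false false false = r false false false false false := by
        rintro ⟨⟩
        exacts [rfl, hz]
      simp only [crossStencil, h1, h2, h3, h4]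
      rw [key, key (ext s' _)]
    · obtain ⟨p, hp⟩ := Int.not_even_iff_odd.1 hev
      have hy : y = (1 + (p - (y.2 - p)), p + (y.2 - p)) := by
        exact Prod.ext (by dsimp only; omega) (by dsimp only; omega)
      generalize y.2 - p = q at hy
      subst hy
      have h0 : ∀ t, ext t ((1 + (p - q), p + q) + (0, 0)) = false := fun t => hodd t _ (by
        simpa using hev)
      have h1 : ((1 + (p - q), p + q) + (1, 0) : Site) = (p + 1 - (q + -1), p + 1 + (q + -1)) := by
        ext <;> simp <;> ring
      have h2 : ((1 + (p - q), p + q) + (-1, 0) : Site) = (p + 0 - (q + 0), p + 0 + (q + 0)) := by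
        ext <;> simp
      have h3 : ((1 + (p - q), p + q) + (0, 1) : Site) = (p + 1 - (q + 0), p + 1 + (q + 0)) := by
        ext <;> simp <;> ring
      have h4 : ((1 + (p - q), p + q) + (0, -1) : Site) = (p + 0 - (q + -1), p + 0 + (q + -1)) := by
        ext <;> simp <;> ring
      simp only [crossStencil, h0]
      rw [h1, h2, h3, h4]
      simp only [hext]
      exact hs (p, q)

theorem crossErasable_of_arm {r : BoolRule}
    (hz : r true false false false false = r false false false false false)
    (hr : ∀ w n s, r false true w n s = !r false false w n s) : CrossErasable r :=
  .of_zero fun r' e h0 => by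
    have hz' : r' true false false false false = false := by
      rcases e with rfl | rfl
      · exact hz.trans h0
      · exact (congrArg Bool.not hz).trans h0
    have hr' : ∀ w n s, r' false true w n s = !r' false false w n s := by
      rcases e with rfl | rfl
      · exact hr
      · simpa [BoolRule.not] using hr
    refine crossCovered_crossArmFamily r' ?_
    simp [Member, Entry.Holds, crossArmFamily, BoolRule.values_eq, h0, hz', hr']

/-- Fix the centre to `false`. Either the rule is then permutive in some arm, which up to symmetry
is the first and belongs to `crossArmFamily`, or the four-argument rule of the arms is permutive
nowhere, and a pair for it on the 2×2 block transfers to the cross. -/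
theorem crossErasable_of_centre_irrelevant {r : BoolRule}
    (hz : r true false false false false = r false false false false false) : CrossErasable r := by
  by_cases h1 : ∀ w n s, r false true w n s = !r false false w n s
  · exact crossErasable_of_arm hz h1
  by_cases h2 : ∀ e n s, r false e true n s = !r false e false n s
  · exact .of_armSwap (crossErasable_of_arm hz fun e n s => h2 e n s)
  by_cases h3 : ∀ e w s, r false e w true s = !r false e w false s
  · exact .of_axisSwap (crossErasable_of_arm hz fun s e w => h3 e w s)
  by_cases h4 : ∀ e w n, r false e w n true = !r false e w n false
  · exact .of_axisSwap (.of_armSwap (crossErasable_of_arm hz fun n e w => h4 e w n))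
  refine .of_zero fun r' e h0 _ _ => ?_
  have hz' : r' true false false false false = r' false false false false false := by
    rcases e with rfl | rfl
    · exact hz
    · simp [BoolRule.not, hz]
  have flat : ∀ j ∈ [1, 2, 3, 4], BoolRule.FlatAt (fun _ e w n s => r' false e w n s) j := by
    have flat' : ∀ j ∈ [1, 2, 3, 4], BoolRule.FlatAt (fun _ e w n s => r false e w n s) j := by
      push Not at h1 h2 h3 h4
      obtain ⟨w1, n1, s1, h1⟩ := h1
      obtain ⟨e2, n2, s2, h2⟩ := h2
      obtain ⟨e3, w3, s3, h3⟩ := h3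
      obtain ⟨e4, w4, n4, h4⟩ := h4
      rw [ne_eq, Bool.not_eq_not] at h1 h2 h3 h4
      simp only [List.forall_mem_cons, List.not_mem_nil, false_imp_iff, forall_true_iff, and_true]
      exact ⟨⟨false, true, w1, n1, s1, by simpa [BoolRule.flip_one] using h1⟩,
         ⟨false, e2, true, n2, s2, by simpa [BoolRule.flip_two] using h2⟩,
        ⟨false, e3, w3, true, s3, by simpa [BoolRule.flip_three] using h3⟩,
        ⟨false, e4, w4, n4, true, by simpa [BoolRule.flip_four] using h4⟩⟩
    rcases e with rfl | rfl
    · exact flat'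
    · exact fun j hj => (flat' j hj).not
  refine .cross_of_block hz' (blockCovered_blockFamily _ ?_ (by simp) flat)
  simp [Member, Entry.Holds, blockFamily, BoolRule.values_eq, h0, List.replicate_succ]

/-- The set of arm patterns for which the centre is irrelevant. -/
def BoolRule.zeros (r : BoolRule) (e w n s : Bool) : Bool :=
  r true e w n s == r false e w n s

/-- The values of a function of four arguments at the patterns with an odd number of ones. -/
def oddCode (z : Bool → Bool → Bool → Bool → Bool) : ℕ :=
  2 * (z false false false true).toNat + 4 * (z false false true false).toNat +
    16 * (z false true false false).toNat + 128 * (z false true true true).toNat +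
    256 * (z true false false false).toNat + 2048 * (z true false true true).toNat +
    8192 * (z true true false true).toNat + 16384 * (z true true true false).toNat

theorem Entry.holds_zero {acc : List Bool} {v : Bool} : Entry.zero.Holds acc v ↔ v = false := .rfl

theorem Entry.holds_free {acc : List Bool} {v : Bool} : Entry.free.Holds acc v ↔ True := .rfl

theorem Entry.holds_neg {acc : List Bool} {d : ℕ} {v : Bool} :
    (Entry.neg d).Holds acc v ↔ v = !acc.getD d false := .rfl

theorem Entry.holds_ite {acc : List Bool} {d : ℕ} {b v : Bool} :
    (if b then Entry.same d else .neg d).Holds acc v ↔ v = (b == acc.getD d false) := by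
  cases b <;> simp [Entry.Holds]

/-- Negating the output does not change where the centre is irrelevant, so `r 0 = 0` may be assumed;
the values with centre `1` follow from those with centre `0` except at patterns of weight 2. -/
theorem crossErasable_of_oddCode {r : BoolRule} (hz : r.zeros false false false false = false)
    (hz' : r.zeros true true true true = false) (hr : oddCode r.zeros ∈ crossFamilyIndices) :
    CrossErasable r := .of_zero fun r' e h0 => by
  have hrr : r'.zeros = r.zeros := by
    rcases e with rfl | rfl
    · rfl
    · funext e w n s
      simp [BoolRule.zeros, BoolRule.not]
  rw [← hrr] at hz hz' hr
  have h : ∀ e w n s, r' true e w n s = (r'.zeros e w n s == r' false e w n s) := by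
    intro e w n s
    rw [BoolRule.zeros]
    cases r' true e w n s <;> cases r' false e w n s <;> rfl
  -- The bits of `oddCode` at the numbers of the odd patterns recover the set, a check over `2 ^ 8`
  -- cases.
  have key : ∀ z1 z2 z4 z7 z8 z11 z13 z14 : Bool, ∀ m,
      m = 2 * z1.toNat + 4 * z2.toNat + 16 * z4.toNat + 128 * z7.toNat + 256 * z8.toNat +
        2048 * z11.toNat + 8192 * z13.toNat + 16384 * z14.toNat →
      m.testBit 0 = false ∧ m.testBit 1 = z1 ∧ m.testBit 2 = z2 ∧ m.testBit 4 = z4 ∧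
      m.testBit 7 = z7 ∧ m.testBit 8 = z8 ∧ m.testBit 11 = z11 ∧ m.testBit 13 = z13 ∧
      m.testBit 14 = z14 ∧ m.testBit 15 = false := by
    simp only [forall_eq]
    decide +kernel
  obtain ⟨t0, t1, t2, t4, t7, t8, t11, t13, t14, t15⟩ := key _ _ _ _ _ _ _ _ _ (Eq.refl (oddCode r'.zeros))
  refine crossCovered_crossFamily _ hr r' ?_
  simp [Member, crossFamily, BoolRule.values_eq, List.range_succ, List.replicate_succ, h0,
    Entry.holds_ite, Entry.holds_zero, Entry.holds_free, Entry.holds_neg, t0, t1, t2, t4, t7, t8, t11, t13, t14, t15,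
    h, hz, hz']

/-- The actions of the symmetries of the cross and of the exchange of symbols on sets of arm
patterns. -/
def armAct (X Y T C : Bool) (z : Bool → Bool → Bool → Bool → Bool) :
    Bool → Bool → Bool → Bool → Bool := fun e w n s =>
  let neg : Bool → Bool := fun b => bif C then !b else b
  bif T then z (neg (bif X then s else n)) (neg (bif X then n else s))
    (neg (bif Y then w else e)) (neg (bif Y then e else w))
  else z (neg (bif X then w else e)) (neg (bif X then e else w))
    (neg (bif Y then s else n)) (neg (bif Y then n else s))

/-- A function of four arguments with given values at the patterns with an odd number of ones. -/
def oddTable (z1 z2 z4 z7 z8 z11 z13 z14 e w n s : Bool) : Bool :=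
  bif e then bif w then bif n then z14 else z13 else bif n then z11 else z8
  else bif w then bif n then z7 else z4 else bif n then z2 else bif s then z1 else false

theorem exists_oddCode_armAct_oddTable : ∀ z1 z2 z4 z7 z8 z11 z13 z14, ∃ X Y T C,
    oddCode (armAct X Y T C (oddTable z1 z2 z4 z7 z8 z11 z13 z14)) ∈ crossFamilyIndices := by
  decide +kernel

/-- Permuting or complementing four bits preserves the parity of the weight, so the odd part of a
transformed set depends only on the odd part of the set, and the finite check on tables applies. -/
theorem exists_oddCode_armAct (z : Bool → Bool → Bool → Bool → Bool) :
    ∃ X Y T C, oddCode (armAct X Y T C z) ∈ crossFamilyIndices := by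
  obtain ⟨X, Y, T, C, h⟩ := exists_oddCode_armAct_oddTable (z false false false true)
    (z false false true false) (z false true false false) (z false true true true)
    (z true false false false) (z true false true true) (z true true false true)
    (z true true true false)
  refine ⟨X, Y, T, C, ?_⟩
  cases X <;> cases Y <;> cases T <;> cases C <;> exact h

/-- If the centre is irrelevant when all arms hold `false`, or when all hold `true` (by
complementation), the sublattice argument applies. Otherwise both constant arm patterns have a
relevant centre, a property kept by all symmetries, and a symmetry brings the odd patterns to a
listed normal form. -/
theorem erasableIf_cross (r : BoolRule) : CrossErasable r := by
  by_cases hz : r.zeros false false false false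
  · exact crossErasable_of_centre_irrelevant (by simpa [BoolRule.zeros] using hz)
  by_cases hz' : r.zeros true true true true
  · refine .of_compl (crossErasable_of_centre_irrelevant ?_)
    simpa [BoolRule.zeros, BoolRule.compl] using (beq_iff_eq.1 hz').symm
  obtain ⟨X, Y, T, C, h⟩ := exists_oddCode_armAct r.zeros
  have step : ∀ r' : BoolRule, r'.zeros = armAct X Y T C r.zeros → CrossErasable r' := by
    intro r' e
    refine crossErasable_of_oddCode ?_ ?_ (e ▸ h) <;> rw [e] <;>
      cases X <;> cases Y <;> cases T <;> cases C <;>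
        simp_all [armAct]
  have hC : ∀ r', CrossErasable (bif C then r'.compl else r') → CrossErasable r' := fun r' => by
    cases C
    exacts [id, .of_compl]
  have hX : ∀ r', CrossErasable (bif X then r'.armSwap else r') → CrossErasable r' := fun r' => by
    cases X
    exacts [id, .of_armSwap]
  have hY : ∀ r', CrossErasable (bif Y then r'.verticalSwap else r') → CrossErasable r' :=
    fun r' => by
      cases Y
      exacts [id, .of_verticalSwap]
  have hT : ∀ r', CrossErasable (bif T then r'.axisSwap else r') → CrossErasable r' := fun r' => by
    cases T
    exacts [id, .of_axisSwap]
  refine hC _ (hX _ (hY _ (hT _ (step _ ?_))))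
  -- Complementing also exchanges the two values of the centre, so in half of the cases the
  -- comparison is read backwards.
  cases X <;> cases Y <;> cases T <;> cases C <;>
    first | rfl | (funext e w n s; exact Bool.beq_comm)

/-! ### Rules on neighbourhoods and five-site rules -/

def Stencil.site (S : Stencil) : Fin 5 → Site := ![S.u0, S.u1, S.u2, S.u3, S.u4]

section Transfer

variable {A : Type*} {N : Finset Site}

/-- The five-site rule that corresponds to a local rule. -/
def boolRuleOf (e : A ≃ Bool) (σ : Fin 5 ≃ N) (f : (N → A) → A) : BoolRule :=
  fun b0 b1 b2 b3 b4 => e (f fun u => e.symm (![b0, b1, b2, b3, b4] (σ.symm u)))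

theorem boolRuleOf_apply (e : A ≃ Bool) (σ : Fin 5 ≃ N) (f : (N → A) → A) (b : N → A) :
    boolRuleOf e σ f (e (b (σ 0))) (e (b (σ 1))) (e (b (σ 2))) (e (b (σ 3))) (e (b (σ 4))) =
      e (f b) := by
  have h : ∀ j, ![e (b (σ 0)), e (b (σ 1)), e (b (σ 2)), e (b (σ 3)), e (b (σ 4))] j =
      e (b (σ j)) := by
    intro j
    fin_cases j <;> rfl
  simp [boolRuleOf, h]

/-- With two symbols, patterns that differ at exactly one site differ there by negation. -/
theorem flip_boolRuleOf_apply (e : A ≃ Bool) (σ : Fin 5 ≃ N) (f : (N → A) → A) {b b' : N → A}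
    {j : Fin 5} (h : ∀ u, u ≠ σ j → b u = b' u) (hj : b (σ j) ≠ b' (σ j)) :
    (boolRuleOf e σ f).flip j (e (b (σ 0))) (e (b (σ 1))) (e (b (σ 2))) (e (b (σ 3)))
      (e (b (σ 4))) = e (f b') := by
  have key : ∀ i : Fin 5, (Nat.beq j i ^^ e (b (σ i))) = e (b' (σ i)) := by
    intro i
    by_cases hi : i = j
    · subst hi
      rw [Nat.beq_refl, Bool.true_xor]
      exact (Bool.eq_not_of_ne fun h' => hj (e.injective h').symm).symm
    · rw [show Nat.beq j i = false from Bool.eq_false_iff.2 fun h' =>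
        hi (Fin.ext (Nat.eq_of_beq_eq_true h').symm),
        Bool.false_xor, h _ fun h' => hi (σ.injective h')]
  rw [← boolRuleOf_apply e σ f b', ← key 0, ← key 1, ← key 2, ← key 3, ← key 4]
  rfl

theorem DependsOnSite.dependsAt (e : A ≃ Bool) (σ : Fin 5 ≃ N) {f : (N → A) → A} {j : Fin 5}
    (h : DependsOnSite f (σ j)) : (boolRuleOf e σ f).DependsAt j := by
  obtain ⟨b, b', hb, hf⟩ := h
  have hj : b (σ j) ≠ b' (σ j) := fun hj => hf (congrArg f (funext fun u => by
    by_cases hu : u = σ j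
    · rw [hu, hj]
    · exact hb u hu))
  refine ⟨e (b (σ 0)), e (b (σ 1)), e (b (σ 2)), e (b (σ 3)), e (b (σ 4)),
    fun h => hf (e.injective ?_)⟩
  exact (boolRuleOf_apply e σ f b).symm.trans (h.trans (flip_boolRuleOf_apply e σ f hb hj))

theorem flatAt_of_not_permutiveAt (e : A ≃ Bool) (σ : Fin 5 ≃ N) {f : (N → A) → A} {j : Fin 5}
    (h : ¬PermutiveAt f (σ j)) : (boolRuleOf e σ f).FlatAt j := by
  simp only [PermutiveAt, Function.Injective, not_forall] at h
  obtain ⟨b, x, y, hf, hxy⟩ := h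
  refine ⟨_, _, _, _, _, (boolRuleOf_apply e σ f (Function.update b (σ j) x)).trans
    ((congrArg e hf).trans (flip_boolRuleOf_apply e σ f (fun u hu => ?_) ?_).symm)⟩
  · simp [hu]
  · simpa using hxy

variable {S : Stencil} {G : Site ≃+ Site} {t : Site}

/-- The pair is transported along `G`: the position `x` of the neighbourhood `N` corresponds to the
position `G.symm (t + x)` of the stencil. -/
theorem not_surjective_of_erasable (e : A ≃ Bool) (σ : Fin 5 ≃ N)
    (hσ : ∀ j, (σ j : Site) = G (S.site j) + t) {f : (N → A) → A}
    (h : Erasable S (boolRuleOf e σ f)) : ¬Function.Surjective (globalMap f) := by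
  have := Finite.of_equiv Bool e.symm
  obtain ⟨s, s', hne, hfin, hs⟩ := h
  have key : ∀ (w : Site → Bool) (x : Site),
      e (globalMap f (fun z => e.symm (w (G.symm z))) x) =
        boolRuleOf e σ f (w (G.symm (t + x) + S.u0)) (w (G.symm (t + x) + S.u1))
          (w (G.symm (t + x) + S.u2)) (w (G.symm (t + x) + S.u3)) (w (G.symm (t + x) + S.u4)) := by
    intro w x
    have hw : ∀ j, e (e.symm (w (G.symm ((σ j : Site) + x)))) =
        w (G.symm (t + x) + S.site j) := by
      intro j
      rw [hσ, add_assoc, map_add, G.symm_apply_apply, add_comm, e.apply_symm_apply]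
    rw [globalMap, ← boolRuleOf_apply, hw, hw, hw, hw, hw]
    rfl
  refine not_surjective_of_pair f (s := fun z => e.symm (s (G.symm z)))
    (s' := fun z => e.symm (s' (G.symm z))) (fun h' => hne ?_) ?_ ?_
  · funext z
    simpa using congrFun h' (G z)
  · simpa using hfin.preimage G.symm.injective.injOn
  · funext x
    exact e.injective (by rw [key, key, hs])

/-- A functional that is strictly maximal at a site of the stencil, composed with the inverse of
`G`, is strictly maximal at the image of that site; the translation adds a constant. -/
theorem sliceable_of_site (σ : Fin 5 ≃ N) (hσ : ∀ j, (σ j : Site) = G (S.site j) + t) {j : Fin 5}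
    (a b : ℤ) (h : ∀ i, i ≠ j →
      a * (S.site i).1 + b * (S.site i).2 < a * (S.site j).1 + b * (S.site j).2) :
    Sliceable N (σ j) := by
  let lin : Site →+ ℚ :=
    { toFun := fun z => ((a * z.1 + b * z.2 : ℤ) : ℚ)
      map_zero' := by simp
      map_add' := fun x y => by
        simp only [Prod.fst_add, Prod.snd_add]
        push_cast
        ring }
  refine sliceable_of_forall_lt (σ j).2 (l := lin.comp G.symm.toAddMonoidHom) fun u hu hne => ?_
  obtain ⟨i, hi⟩ := σ.surjective ⟨u, hu⟩
  have hi' : u = G (S.site i) + t := by rw [← hσ, hi]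
  have hij : i ≠ j := by
    rintro rfl
    exact hne (congrArg Subtype.val hi).symm
  have hlin : ∀ z, lin.comp G.symm.toAddMonoidHom (G z + t) = lin z + lin (G.symm t) := by
    intro z
    change lin (G.symm (G z + t)) = _
    rw [map_add, G.symm_apply_apply, map_add]
  rw [hσ, hi', hlin, hlin, add_lt_add_iff_right]
  exact Int.cast_lt.2 (h i hij)

/-- The equivalence for a neighbourhood that is the image of a stencil whose extremal sites `P`
are known to admit erasable pairs. -/
theorem surjective_iff_of_stencil (hA : Nat.card A = 2) (hS : Function.Injective S.site)
    (hN : N = Finset.univ.image fun j => G (S.site j) + t) (P : List (Fin 5 × ℤ × ℤ))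
    (hP : ∀ p ∈ P, ∀ i, i ≠ p.1 →
      p.2.1 * (S.site i).1 + p.2.2 * (S.site i).2 <
        p.2.1 * (S.site p.1).1 + p.2.2 * (S.site p.1).2)
    (hr : ∀ r, ErasableIf S [0, 1, 2, 3, 4] (P.map fun p => (p.1 : ℕ)) r)
    {f : (N → A) → A} (hf : ∀ v : N, DependsOnSite f v) :
    Function.Surjective (globalMap f) ↔ SlicePermutive f := by
  have hA' : Finite A := Nat.finite_of_card_ne_zero (by omega)
  have hne : Nonempty A := (Nat.card_pos_iff.1 (by omega)).1
  refine ⟨fun hsurj => ?_, fun h => h.surjective⟩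
  obtain ⟨e⟩ : Nonempty (A ≃ Bool) := (Finite.card_eq.1 (by simpa using hA))
  let σ : Fin 5 ≃ N := Equiv.ofBijective
    (fun j => ⟨G (S.site j) + t, hN.symm.subset (Finset.mem_image_of_mem _ (Finset.mem_univ j))⟩)
    ⟨fun i j h => hS (G.injective (add_right_cancel (congrArg Subtype.val h))), fun u => by
      obtain ⟨j, -, hj⟩ := Finset.mem_image.1 (hN.subset u.2)
      exact ⟨j, Subtype.ext hj⟩⟩
  have hσ : ∀ j, (σ j : Site) = G (S.site j) + t := fun _ => rfl
  by_contra hn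
  refine not_surjective_of_erasable e σ hσ (hr (boolRuleOf e σ f) ?_ ?_) hsurj
  · have hd : ∀ j : Fin 5, (boolRuleOf e σ f).DependsAt j := fun j => (hf (σ j)).dependsAt e σ
    simp only [List.forall_mem_cons, List.not_mem_nil, false_imp_iff, forall_true_iff, and_true]
    exact ⟨hd 0, hd 1, hd 2, hd 3, hd 4⟩
  · intro j hj
    obtain ⟨p, hp, rfl⟩ := List.mem_map.1 hj
    exact flatAt_of_not_permutiveAt e σ fun h =>
      hn ⟨_, sliceable_of_site σ hσ p.2.1 p.2.2 (hP p hp), h⟩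

end Transfer

/-- The shear that takes the cross to the Z-pentomino. -/
def crossShear : Site ≃+ Site where
  toFun z := (z.1 + z.2, -z.2)
  invFun z := (z.1 + z.2, -z.2)
  left_inv z := by simp
  right_inv z := by simp
  map_add' x y := by
    ext
    · simp only [Prod.fst_add, Prod.snd_add]
      ring
    · simp only [Prod.snd_add, neg_add]

/-- The notions involved are compatible with additive automorphisms of `ℤ²`, so Z is treated as a
sheared cross. The triples list each extremal argument with the coefficients of a functional that is
strictly maximal there. -/
theorem mainTheorem2 {A : Type*} (hA : Nat.card A = 2) (N : Finset Site)
    (hN : HasShape N pentominoT ∨ HasShape N pentominoV ∨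
      HasShape N pentominoX ∨ HasShape N pentominoZ)
    (f : (N → A) → A) (hf : ∀ v : N, DependsOnSite f v) :
    Function.Surjective (globalMap f) ↔ SlicePermutive f := by
  rcases hN with ⟨g, t, -, hN⟩ | ⟨g, t, -, hN⟩ | ⟨g, t, -, hN⟩ | ⟨g, t, -, hN⟩
  · refine surjective_iff_of_stencil (S := teeStencil) (G := g) (t := g (1, 0) + t) hA (by decide)
      ?_ [(1, 2, -1), (2, -2, -1), (4, 0, 1)] (by decide) erasableIf_tee hf
    have h : pentominoT = Finset.univ.image fun j => teeStencil.site j + (1, 0) := by decide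
    simp only [hN, h, Finset.image_image, Function.comp_def, map_add, add_assoc]
  · refine surjective_iff_of_stencil (S := cornerStencil) (G := g) (t := t) hA (by decide)
      ?_ [(0, -1, -1), (2, 1, 0), (4, 0, 1)] (by decide) erasableIf_corner hf
    have h : pentominoV = Finset.univ.image cornerStencil.site := by decide
    simp only [hN, h, Finset.image_image, Function.comp_def]
  · refine surjective_iff_of_stencil (S := crossStencil) (G := g) (t := t) hA (by decide)
      ?_ [(1, 1, 0), (2, -1, 0), (3, 0, 1), (4, 0, -1)] (by decide) erasableIf_cross hf
    have h : pentominoX = Finset.univ.image crossStencil.site := by decide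
    simp only [hN, h, Finset.image_image, Function.comp_def]
  · refine surjective_iff_of_stencil (S := crossStencil) (G := crossShear.trans g)
      (t := g (1, 1) + t) hA (by decide)
      ?_ [(1, 1, 0), (2, -1, 0), (3, 0, 1), (4, 0, -1)] (by decide) erasableIf_cross hf
    have h : pentominoZ = Finset.univ.image fun j => crossShear (crossStencil.site j) + (1, 1) := by
      decide
    simp only [hN, h, Finset.image_image, Function.comp_def, map_add, add_assoc]
    rfl
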